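/- **Setting.** Let $1\le k_1<k_2$ and $D_1,D_2\ge 2$ be integers, $\lambda_1,\lambda_2$ non-negative integers with $\lambda_1k_1<\lambda_2k_2$, and let $k'\in(k_1,k_2)$ be real. Let $\delta_{1,\ell_1}$ $(1\le\ell_1\le D_1)$, $\delta_{2,\ell_2}$ $(1\le \ell_2\le D_2)$ and $\Delta_{\ell_1\ell_2}$ be non-negative integers with $k_1\delta_{1,D_1}+k_2\delta_{2,D_2}>0$, $\Delta_{D_1D_2}=\lambda_1k_1\delta_{1,D_1}+\lambda_2k_2\delta_{2,D_2}$ and, for all $1\le\ell_1\le D_1-1$, $1\le\ell_2\le D_2-1$, $$\Delta_{\ell_1\ell_2}>\lambda_1k_1\delta_{1,\ell_1}+\lambda_2k_2\delta_{2,\ell_2},\qquad k_1\delta_{1,D_1}+k_2\delta_{2,D_2}\ge k_1\delta_{1,\ell_1}+k_2\delta_{2,\ell_2}.$$ Let $Q,R_{D_1D_2},R_{\ell_1\ell_2}\in\mathbb C[X]$ with $\deg R_{\ell_1\ell_2}\le\deg R_{D_1D_2}$, $R_{D_1D_2}(im)\ne0$ for $m\in\mathbb R$, and such that $Q(im)/R_{D_1D_2}(im)$,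 $m\in\mathbb R$, stays in a sectorial annulus $\{r^1\le|z|\le r^2,\ \arg z\in(\alpha,\alpha')\}$ with $0<r^1<r^2$, $\alpha<\alpha'$. Let $\beta,\nu,\epsilon_0>0$ and $\mu>1+\deg R_{\ell_1\ell_2}$ for all $\ell_1,\ell_2$. Write $H_b=\{z\in\mathbb C:|\operatorname{Im}z|<b\}$, $D(0,r)$ for the open disc, $\mathcal F^{-1}(g)(z)=(2\pi)^{-1/2}\int_{\mathbb R}g(m)e^{izm}\,dm$ and $L_\gamma=(0,\infty)e^{i\gamma}$. Let $c_{\ell_1\ell_2}(z,\epsilon)=\mathcal F^{-1}(m\mapsto C_{\ell_1\ell_2}(m,\epsilon))(z)$ be holomorphic on $H_\beta\times D(0,\epsilon_0)$, where $C_{\ell_1\ell_2}(\cdot,\epsilon)$ is continuous and $(1+|m|)^\mu e^{\beta|m|}|C_{\ell_1\ell_2}(m,\epsilon)|$ is bounded on $\mathbb R\times D(0,\epsilon_0)$. Let $\psi:\mathbb C\times\mathbb R\times D(0,\epsilon_0)\to\mathbb C$ be entire in the first variable, continuous in the second and holomorphic in the third, with $|\psi(\tau,m,\epsilon)|\le C_\psi(1+|m|)^{-\mu}e^{-\beta|m|}e^{\nu|\tau|^{k'}}|\tau|$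 for some $C_\psi>0$. Put $$F(T_1,T_2,m,\epsilon)=\int_{L_\gamma}\psi(u,m,\epsilon)\exp\Big(-\big(\tfrac u{T_1}\big)^{k_1}-\big(\tfrac u{T_2}\big)^{k_2}\Big)\frac{du}u,\quad \gamma=\arg T_2,$$ $$f(t_1,t_2,z,\epsilon)=\mathcal F^{-1}\big(m\mapsto F(\epsilon^{\lambda_1}t_1,\epsilon^{\lambda_2}t_2,m,\epsilon)\big)(z),$$ and consider the equation $$Q(\partial_z)u=\epsilon^{\Delta_{D_1D_2}}(t_1^{k_1+1}\partial_{t_1})^{\delta_{1,D_1}}(t_2^{k_2+1}\partial_{t_2})^{\delta_{2,D_2}}R_{D_1D_2}(\partial_z)u+\sum_{\substack{1\le\ell_1\le D_1-1\\1\le\ell_2\le D_2-1}}\epsilon^{\Delta_{\ell_1\ell_2}}(t_1^{k_1+1}\partial_{t_1})^{\delta_{1,\ell_1}}(t_2^{k_2+1}\partial_{t_2})^{\delta_{2,\ell_2}}c_{\ell_1\ell_2}(z,\epsilon)R_{\ell_1\ell_2}(\partial_z)u+f\qquad(1)$$ with initial data $u(0,t_2,z,\epsilon)\equiv0$, $u(t_1,0,z,\epsilon)\equiv0$.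 Let $P_m(\tau)=Q(im)-(k_1\tau^{k_1})^{\delta_{1,D_1}}(k_2\tau^{k_2})^{\delta_{2,D_2}}R_{D_1D_2}(im)$. The auxiliary equation is $$P_m(\tau)\,\omega(\tau,m,\epsilon)=\sum_{\ell_1,\ell_2}\epsilon^{\Delta_{\ell_1\ell_2}-\lambda_1k_1\delta_{1,\ell_1}-\lambda_2k_2\delta_{2,\ell_2}}(k_1\tau^{k_1})^{\delta_{1,\ell_1}}(k_2\tau^{k_2})^{\delta_{2,\ell_2}}\frac1{(2\pi)^{1/2}}\int_{\mathbb R}C_{\ell_1\ell_2}(m-m_1,\epsilon)R_{\ell_1\ell_2}(im_1)\omega(\tau,m_1,\epsilon)\,dm_1+\psi(\tau,m,\epsilon).\qquad(2)$$ Sectors have vertex $0$, are open, and have opening in $(0,2\pi]$; each comes with an open interval of arguments. For an unbounded sector $S$ and $\rho>0$, $\mathrm{Exp}_{S,\rho}$ is the space of continuous functions $w$ on $(S\cup\overline D(0,\rho))\times\mathbb R$, holomorphic in $\tau\in S\cup D(0,\rho)$, with finite norm $\|w\|=\sup(1+|m|)^\mu e^{\beta|m|}e^{-\nu|\tau|^{k'}}|\tau|^{-1}|w(\tau,m)|$.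 **Good covering.** A good covering of opening $\pi/(\lambda_2k_2)$ in $D(0,\epsilon_1)$ is a family $(\mathcal E_h)_{0\le h\le\iota-1}$, $\iota\ge2$, of bounded sectors in $D(0,\epsilon_1)$ with openings larger than $\pi/(\lambda_2k_2)$, such that $\mathcal E_h\cap\mathcal E_{h+1}\ne\emptyset$ (indices modulo $\iota$), the intersection of any three members with different indices is empty, and the union contains a punctured disc centred at $0$. **Admissible set.** Given a bounded sector $\mathcal T_1$, an unbounded sector $\mathcal T_2$ and unbounded sectors $(S_h)_{0\le h\le\iota-1}$, the set $\{\mathcal T_1,\mathcal T_2,(\mathcal E_h),(S_h)\}$ is admissible (with constant $\delta>0$) if for all $h$, $t_1\in\mathcal T_1$, $t_2\in\mathcal T_2$, $\epsilon\in\mathcal E_h$ there is an argument $\xi$ of $S_h$ with $$k_j\xi-k_j\arg(\epsilon^{\lambda_j}t_j)\in\big(-\tfrac\pi2+\delta,\tfrac\pi2-\delta\big),\quad j=1,2,\qquad(3)$$ where $\arg(\epsilon^{\lambda_j}t_j)=\lambda_j\arg\epsilon+\arg t_j$ with arguments in the given intervals. **Theorem.** For every $\mathfrak m>0$ there are $\epsilon_1\in(0,\epsilon_0]$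 and $K>0$, depending only on $\mathfrak m$ and on the data of (1) other than $\psi$, such that the following holds. Let $\rho>0$ and let $(S_h)_{0\le h\le \iota-1}$ be unbounded sectors such that $|\tau-q|\ge\mathfrak m(1+|\tau|)$ for all $h$, all $\tau\in S_h\cup D(0,\rho)$, all $m\in\mathbb R$ and all roots $q$ of $P_m$. Then, for every $h$ and every $\epsilon\in D(0,\epsilon_1)$, equation (2) has a unique solution $\omega_h(\cdot,\cdot,\epsilon)\in\mathrm{Exp}_{S_h,\rho}$; it satisfies $\|\omega_h(\cdot,\cdot,\epsilon)\|\le KC_\psi$ and depends holomorphically on $\epsilon\in D(0,\epsilon_1)$. Let $(\mathcal E_h)_{0\le h\le\iota-1}$ be a good covering of opening $\pi/(\lambda_2k_2)$ in $D(0,\epsilon_1)$, and let $\{\mathcal T_1,\mathcal T_2,(\mathcal E_h),(S_h)\}$ be admissible. Then the absolutely convergent integral $$u_h(t_1,t_2,z,\epsilon)=\frac1{(2\pi)^{1/2}}\int_{-\infty}^\infty\int_{L_\xi}\omega_h(u,m,\epsilon)\exp\Big(-\big(\tfrac u{\epsilon^{\lambda_1}t_1}\big)^{k_1}-\big(\tfrac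 u{\epsilon^{\lambda_2}t_2}\big)^{k_2}\Big)e^{izm}\,\frac{du}u\,dm,$$ with $\xi$ any argument of $S_h$ satisfying (3), does not depend on the choice of $\xi$, and for every $\rho_2>0$ and $0<\beta'<\beta$: 1. $u_h$ is holomorphic and bounded on $\mathcal T_1\times(\mathcal T_2\cap D(0,\rho_2))\times H_{\beta'}\times\mathcal E_h$, satisfies (1) there, and tends to $0$ as $t_1\to0$ in $\mathcal T_1$ and as $t_2\to0$ in $\mathcal T_2$, the other variables being fixed; 2. there are $\hat C,\hat D>0$ such that for all $h$ (modulo $\iota$) and all $\epsilon\in\mathcal E_h\cap\mathcal E_{h+1}$ $$\sup_{t_1\in\mathcal T_1,\ t_2\in\mathcal T_2\cap D(0,\rho_2),\ z\in H_{\beta'}}|u_{h+1}(t_1,t_2,z,\epsilon)-u_h(t_1,t_2,z,\epsilon)|\le\hat C\exp\Big(-\frac{\hat D}{|\epsilon|^{\lambda_2k_2}}\Big).$$ -/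

import Mathlib

open Complex MeasureTheory Set Filter Topology Polynomial

namespace OuterPDE

noncomputable section

/-! ### Sectors -/

/-- Angular data of a sector with vertex at the origin: bisecting direction and opening.
Since the opening is at most `2π`, each point of the sector has exactly one argument in `angles`. -/
structure Sector where
  dir : ℝ
  opening : ℝ
  opening_pos : 0 < opening
  opening_le : opening ≤ 2 * Real.pi

/-- The open interval of arguments of the points of the sector. -/
def Sector.angles (S : Sector) : Set ℝ :=
  Ioo (S.dir - S.opening / 2) (S.dir + S.opening / 2)

/-- The unbounded open sector. -/
def Sector.unbounded (S : Sector) : Set ℂ :=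
  {x | ∃ r : ℝ, 0 < r ∧ ∃ φ ∈ S.angles, x = r * exp (φ * I)}

/-- The bounded open sector of radius `R`. -/
def Sector.bounded (S : Sector) (R : ℝ) : Set ℂ :=
  {x | ∃ r : ℝ, 0 < r ∧ r < R ∧ ∃ φ ∈ S.angles, x = r * exp (φ * I)}

/-- The horizontal strip `|Im z| < β`. -/
def strip (β : ℝ) : Set ℂ := {z | |z.im| < β}

/-! ### Fourier and Laplace-like integrals -/

/-- Inverse Fourier transform, evaluated at a complex point. -/
def invFourier (g : ℝ → ℂ) (z : ℂ) : ℂ :=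
  ((Real.sqrt (2 * Real.pi))⁻¹ : ℝ) * ∫ m : ℝ, g m * exp (I * z * m)

/-- The integrand of `∫_{L_γ} g(u) exp(-(u/T₁)^{k₁} - (u/T₂)^{k₂}) du/u` in the parametrization
`u = r e^{iγ}`, for which `du/u = dr/r`. -/
def rayIntegrand (k₁ k₂ : ℕ) (g : ℂ → ℂ) (γ : ℝ) (T₁ T₂ : ℂ) (r : ℝ) : ℂ :=
  g (r * exp (γ * I)) *
    exp (-(r * exp (γ * I) / T₁) ^ k₁ - (r * exp (γ * I) / T₂) ^ k₂) * (r : ℂ)⁻¹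

/-- `∫_{L_γ} g(u) exp(-(u/T₁)^{k₁} - (u/T₂)^{k₂}) du/u`, where `L_γ = (0,∞) e^{iγ}`. -/
def rayIntegral (k₁ k₂ : ℕ) (g : ℂ → ℂ) (γ : ℝ) (T₁ T₂ : ℂ) : ℂ :=
  ∫ r in Ioi (0 : ℝ), rayIntegrand k₁ k₂ g γ T₁ T₂ r

/-! ### The main equation -/

/-- The data of the equation, apart from the forcing term. -/
structure Equation where
  (k₁ k₂ D₁ D₂ lam₁ lam₂ : ℕ)
  /-- `δ₁ ℓ₁`, for `1 ≤ ℓ₁ ≤ D₁` -/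
  δ₁ : ℕ → ℕ
  /-- `δ₂ ℓ₂`, for `1 ≤ ℓ₂ ≤ D₂` -/
  δ₂ : ℕ → ℕ
  Δ : ℕ → ℕ → ℕ
  Q : ℂ[X]
  /-- the polynomial `R_{D₁D₂}` of the leading term -/
  RD : ℂ[X]
  /-- the polynomials `R_{ℓ₁ℓ₂}`, for `1 ≤ ℓ₁ < D₁` and `1 ≤ ℓ₂ < D₂` -/
  R : ℕ → ℕ → ℂ[X]
  (β μ ν k' ε₀ : ℝ)
  /-- `C_{ℓ₁ℓ₂}(m, ε)` -/
  C : ℕ → ℕ → ℝ → ℂ → ℂ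

namespace Equation

variable (e : Equation)

/-- The coefficient `c_{ℓ₁ℓ₂}(z, ε)`. -/
def c (l₁ l₂ : ℕ) (z ε : ℂ) : ℂ := invFourier (fun m => e.C l₁ l₂ m ε) z

/-- The standing assumptions on the data of the equation. -/
structure Assumptions : Prop where
  one_le_k₁ : 1 ≤ e.k₁
  k₁_lt_k' : (e.k₁ : ℝ) < e.k'
  k'_lt_k₂ : e.k' < (e.k₂ : ℝ)
  two_le_D₁ : 2 ≤ e.D₁
  two_le_D₂ : 2 ≤ e.D₂
  lam_lt : e.lam₁ * e.k₁ < e.lam₂ * e.k₂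
  /-- the leading term contains a derivative in time -/
  leading_pos : 0 < e.k₁ * e.δ₁ e.D₁ + e.k₂ * e.δ₂ e.D₂
  Δ_leading : e.Δ e.D₁ e.D₂ = e.lam₁ * e.k₁ * e.δ₁ e.D₁ + e.lam₂ * e.k₂ * e.δ₂ e.D₂
  Δ_lower : ∀ l₁ ∈ Finset.Ico 1 e.D₁, ∀ l₂ ∈ Finset.Ico 1 e.D₂,
    e.lam₁ * e.k₁ * e.δ₁ l₁ + e.lam₂ * e.k₂ * e.δ₂ l₂ < e.Δ l₁ l₂
  δ_lower : ∀ l₁ ∈ Finset.Ico 1 e.D₁, ∀ l₂ ∈ Finset.Ico 1 e.D₂,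
    e.k₁ * e.δ₁ l₁ + e.k₂ * e.δ₂ l₂ ≤ e.k₁ * e.δ₁ e.D₁ + e.k₂ * e.δ₂ e.D₂
  RD_ne_zero : ∀ m : ℝ, e.RD.eval (I * m) ≠ 0
  /-- the quotient `Q(im)/R_{D₁D₂}(im)` stays in a sectorial annulus -/
  annulus : ∃ r₁ r₂ a b : ℝ, 0 < r₁ ∧ r₁ < r₂ ∧ a < b ∧ ∀ m : ℝ,
    ∃ r ∈ Icc r₁ r₂, ∃ φ ∈ Ioo a b, e.Q.eval (I * m) / e.RD.eval (I * m) = r * exp (φ * I)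
  natDegree_le : ∀ l₁ ∈ Finset.Ico 1 e.D₁, ∀ l₂ ∈ Finset.Ico 1 e.D₂,
    (e.R l₁ l₂).natDegree ≤ e.RD.natDegree
  β_pos : 0 < e.β
  ν_pos : 0 < e.ν
  μ_gt : ∀ l₁ ∈ Finset.Ico 1 e.D₁, ∀ l₂ ∈ Finset.Ico 1 e.D₂,
    1 + ((e.R l₁ l₂).natDegree : ℝ) < e.μ
  ε₀_pos : 0 < e.ε₀
  C_cont : ∀ l₁ ∈ Finset.Ico 1 e.D₁, ∀ l₂ ∈ Finset.Ico 1 e.D₂,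
    ∀ ε ∈ Metric.ball (0 : ℂ) e.ε₀, Continuous fun m => e.C l₁ l₂ m ε
  C_bound : ∀ l₁ ∈ Finset.Ico 1 e.D₁, ∀ l₂ ∈ Finset.Ico 1 e.D₂, ∃ B > 0,
    ∀ ε ∈ Metric.ball (0 : ℂ) e.ε₀, ∀ m : ℝ,
      (1 + |m|) ^ e.μ * Real.exp (e.β * |m|) * ‖e.C l₁ l₂ m ε‖ ≤ B
  c_holo : ∀ l₁ ∈ Finset.Ico 1 e.D₁, ∀ l₂ ∈ Finset.Ico 1 e.D₂,
    DifferentiableOn ℂ (fun p : ℂ × ℂ => e.c l₁ l₂ p.1 p.2)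
      (strip e.β ×ˢ Metric.ball (0 : ℂ) e.ε₀)

/-- The assumptions on the function `ψ(τ, m, ε)` generating the forcing term, with the constant
`Cψ` of its growth bound. -/
structure IsForcingKernel (ψ : ℂ → ℝ → ℂ → ℂ) (Cψ : ℝ) : Prop where
  const_pos : 0 < Cψ
  entire : ∀ m : ℝ, ∀ ε ∈ Metric.ball (0 : ℂ) e.ε₀, Differentiable ℂ fun τ => ψ τ m ε
  cont : ∀ τ : ℂ, ∀ ε ∈ Metric.ball (0 : ℂ) e.ε₀, Continuous fun m => ψ τ m ε
  holo : ∀ τ : ℂ, ∀ m : ℝ, DifferentiableOn ℂ (fun ε => ψ τ m ε) (Metric.ball (0 : ℂ) e.ε₀)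
  bound : ∀ τ : ℂ, ∀ m : ℝ, ∀ ε ∈ Metric.ball (0 : ℂ) e.ε₀,
    ‖ψ τ m ε‖ ≤ Cψ / (1 + |m|) ^ e.μ * Real.exp (-(e.β * |m|)) *
      Real.exp (e.ν * ‖τ‖ ^ e.k') * ‖τ‖

/-- `F(T₁, T₂, m, ε) = ∫_{L_γ} ψ(u, m, ε) exp(-(u/T₁)^{k₁} - (u/T₂)^{k₂}) du/u`. The half-line
turns with `T₂`: `γ = arg T₂`. As `ψ` is entire of exponential growth of order `k' < k₂` and
`k₁ < k'`, any `γ` with `|γ - arg T₂| < π/(2k₂)` gives the same value. -/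
def forcingF (ψ : ℂ → ℝ → ℂ → ℂ) (T₁ T₂ : ℂ) (m : ℝ) (ε : ℂ) : ℂ :=
  rayIntegral e.k₁ e.k₂ (fun τ => ψ τ m ε) (arg T₂) T₁ T₂

/-- The forcing term `f(t₁, t₂, z, ε)`. -/
def forcing (ψ : ℂ → ℝ → ℂ → ℂ) (t₁ t₂ z ε : ℂ) : ℂ :=
  invFourier (fun m => e.forcingF ψ (ε ^ e.lam₁ * t₁) (ε ^ e.lam₂ * t₂) m ε) z

/-- The operator `t₁^{k+1} ∂_{t₁}` on functions of `(t₁, t₂, z, ε)`. -/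
def timeOp₁ (k : ℕ) (u : ℂ → ℂ → ℂ → ℂ → ℂ) : ℂ → ℂ → ℂ → ℂ → ℂ :=
  fun t₁ t₂ z ε => t₁ ^ (k + 1) * deriv (fun s => u s t₂ z ε) t₁

/-- The operator `t₂^{k+1} ∂_{t₂}` on functions of `(t₁, t₂, z, ε)`. -/
def timeOp₂ (k : ℕ) (u : ℂ → ℂ → ℂ → ℂ → ℂ) : ℂ → ℂ → ℂ → ℂ → ℂ :=
  fun t₁ t₂ z ε => t₂ ^ (k + 1) * deriv (fun s => u t₁ s z ε) t₂

/-- The operator `P(∂_z)` on functions of `(t₁, t₂, z, ε)`. -/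
def spaceOp (P : ℂ[X]) (u : ℂ → ℂ → ℂ → ℂ → ℂ) : ℂ → ℂ → ℂ → ℂ → ℂ :=
  fun t₁ t₂ z ε => P.sum fun n a => a * iteratedDeriv n (fun w => u t₁ t₂ w ε) z

/-- `u` satisfies the main equation, with forcing term generated by `ψ`, at `(t₁, t₂, z, ε)`. -/
def SolvesAt (ψ : ℂ → ℝ → ℂ → ℂ) (u : ℂ → ℂ → ℂ → ℂ → ℂ) (t₁ t₂ z ε : ℂ) : Prop :=
  spaceOp e.Q u t₁ t₂ z ε =
    ε ^ e.Δ e.D₁ e.D₂ *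
      ((timeOp₁ e.k₁)^[e.δ₁ e.D₁] ((timeOp₂ e.k₂)^[e.δ₂ e.D₂] (spaceOp e.RD u))) t₁ t₂ z ε
    + ∑ l₁ ∈ Finset.Ico 1 e.D₁, ∑ l₂ ∈ Finset.Ico 1 e.D₂,
        ε ^ e.Δ l₁ l₂ *
          ((timeOp₁ e.k₁)^[e.δ₁ l₁] ((timeOp₂ e.k₂)^[e.δ₂ l₂]
            (fun s₁ s₂ w η => e.c l₁ l₂ w η * spaceOp (e.R l₁ l₂) u s₁ s₂ w η))) t₁ t₂ z ε
    + e.forcing ψ t₁ t₂ z ε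

/-! ### The auxiliary equation in the Borel plane -/

/-- `P_m(τ) = Q(im) - (k₁τ^{k₁})^{δ_{D₁}} (k₂τ^{k₂})^{δ_{D₂}} R_{D₁D₂}(im)`. -/
def Pm (m : ℝ) (τ : ℂ) : ℂ :=
  e.Q.eval (I * m) -
    (e.k₁ * τ ^ e.k₁) ^ e.δ₁ e.D₁ * (e.k₂ * τ ^ e.k₂) ^ e.δ₂ e.D₂ * e.RD.eval (I * m)

/-- The points of `S ∪ D(0, ρ)` keep away from all the roots of all the `P_m`, with constant `𝔪`. -/
def RootSeparated (S : Sector) (ρ 𝔪 : ℝ) : Prop :=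
  ∀ τ ∈ S.unbounded ∪ Metric.ball (0 : ℂ) ρ, ∀ m : ℝ, ∀ q : ℂ, e.Pm m q = 0 →
    𝔪 * (1 + ‖τ‖) ≤ ‖τ - q‖

/-- `h` belongs to the Banach space `Exp^d_{(ν,β,μ,k')}` attached to the sector `S` and the disc of
radius `ρ`, and its norm there is at most `B`. -/
structure MemExp (S : Sector) (ρ B : ℝ) (h : ℂ → ℝ → ℂ) : Prop where
  cont : ContinuousOn (fun p : ℂ × ℝ => h p.1 p.2)
    ((S.unbounded ∪ Metric.closedBall (0 : ℂ) ρ) ×ˢ univ)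
  holo : ∀ m : ℝ, DifferentiableOn ℂ (fun τ => h τ m) (S.unbounded ∪ Metric.ball (0 : ℂ) ρ)
  bound : ∀ τ ∈ S.unbounded ∪ Metric.closedBall (0 : ℂ) ρ, ∀ m : ℝ,
    (1 + |m|) ^ e.μ * Real.exp (e.β * |m|) * Real.exp (-(e.ν * ‖τ‖ ^ e.k')) * ‖h τ m‖ ≤ B * ‖τ‖

/-- `h` solves, for the parameter `ε`, the auxiliary equation on `(S ∪ closed disc) × ℝ`. -/
def SolvesBorel (S : Sector) (ρ : ℝ) (ψ : ℂ → ℝ → ℂ → ℂ) (ε : ℂ) (h : ℂ → ℝ → ℂ) : Prop :=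
  ∀ τ ∈ S.unbounded ∪ Metric.closedBall (0 : ℂ) ρ, ∀ m : ℝ,
    e.Pm m τ * h τ m =
      ∑ l₁ ∈ Finset.Ico 1 e.D₁, ∑ l₂ ∈ Finset.Ico 1 e.D₂,
        ε ^ (e.Δ l₁ l₂ - e.lam₁ * e.k₁ * e.δ₁ l₁ - e.lam₂ * e.k₂ * e.δ₂ l₂) *
          (e.k₁ * τ ^ e.k₁) ^ e.δ₁ l₁ * (e.k₂ * τ ^ e.k₂) ^ e.δ₂ l₂ *
          (((Real.sqrt (2 * Real.pi))⁻¹ : ℝ) *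
            ∫ m₁ : ℝ, e.C l₁ l₂ (m - m₁) ε * (e.R l₁ l₂).eval (I * m₁) * h τ m₁)
      + ψ τ m ε

/-- `ω = (ω_h)` is the family of solutions of the auxiliary equation, for the sectors `S h`: for
every `ε ∈ D(0, ε₁)`, `ω_h(·,·,ε)` is the unique solution in the space of functions of exponential
growth attached to `S h`, its norm is at most `B`, and it depends holomorphically on `ε`. -/
structure IsBorelSolution {ι : ℕ} (S : Fin ι → Sector) (ρ : ℝ) (ψ : ℂ → ℝ → ℂ → ℂ) (ε₁ B : ℝ)
    (ω : Fin ι → ℂ → ℝ → ℂ → ℂ) : Prop where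
  mem : ∀ h, ∀ ε ∈ Metric.ball (0 : ℂ) ε₁, e.MemExp (S h) ρ B fun τ m => ω h τ m ε
  solves : ∀ h, ∀ ε ∈ Metric.ball (0 : ℂ) ε₁, e.SolvesBorel (S h) ρ ψ ε fun τ m => ω h τ m ε
  unique : ∀ h, ∀ ε ∈ Metric.ball (0 : ℂ) ε₁, ∀ (B' : ℝ) (w : ℂ → ℝ → ℂ),
    e.MemExp (S h) ρ B' w → e.SolvesBorel (S h) ρ ψ ε w →
      ∀ τ ∈ (S h).unbounded ∪ Metric.closedBall (0 : ℂ) ρ, ∀ m : ℝ, w τ m = ω h τ m ε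
  holo : ∀ h, ∀ τ ∈ (S h).unbounded ∪ Metric.closedBall (0 : ℂ) ρ, ∀ m : ℝ,
    DifferentiableOn ℂ (fun ε => ω h τ m ε) (Metric.ball (0 : ℂ) ε₁)

/-! ### Geometry -/

/-- Good covering of `ℂ∖{0}` of opening `π/(λ₂k₂)` by the bounded sectors `(E h).bounded (rE h)`,
contained in `D(0, ε₁)`. Addition in `Fin ι` is cyclic. -/
structure IsGoodCovering {ι : ℕ} [NeZero ι] (ε₁ : ℝ) (E : Fin ι → Sector) (rE : Fin ι → ℝ) :
    Prop where
  two_le : 2 ≤ ι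
  radius_pos : ∀ h, 0 < rE h
  subset : ∀ h, (E h).bounded (rE h) ⊆ Metric.ball (0 : ℂ) ε₁
  consecutive : ∀ h, ((E h).bounded (rE h) ∩ (E (h + 1)).bounded (rE (h + 1))).Nonempty
  triple : ∀ h i j, h ≠ i → h ≠ j → i ≠ j →
    (E h).bounded (rE h) ∩ (E i).bounded (rE i) ∩ (E j).bounded (rE j) = ∅
  covers : ∃ r > 0, Metric.ball (0 : ℂ) r \ {0} ⊆ ⋃ h, (E h).bounded (rE h)
  opening : ∀ h, Real.pi / (e.lam₂ * e.k₂) < (E h).opening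

/-- `ξ` is a direction of `S` with `k_j ξ - k_j arg(ε^{λ_j} t_j) ∈ (-π/2 + δ, π/2 - δ)`, `j = 1, 2`,
where `η`, `φ₁`, `φ₂` are the arguments of `ε`, `t₁`, `t₂`. -/
def GoodDirection (S : Sector) (δ φ₁ φ₂ η ξ : ℝ) : Prop :=
  ξ ∈ S.angles ∧
  e.k₁ * ξ - e.k₁ * (e.lam₁ * η + φ₁) ∈ Ioo (-(Real.pi / 2) + δ) (Real.pi / 2 - δ) ∧
  e.k₂ * ξ - e.k₂ * (e.lam₂ * η + φ₂) ∈ Ioo (-(Real.pi / 2) + δ) (Real.pi / 2 - δ)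

/-- Admissibility of `{𝒯₁, 𝒯₂, (ℰ_h), (S_h)}`, with the constant `δ`. -/
def Admissible {ι : ℕ} (δ : ℝ) (T₁ T₂ : Sector) (E S : Fin ι → Sector) : Prop :=
  ∀ h, ∀ φ₁ ∈ T₁.angles, ∀ φ₂ ∈ T₂.angles, ∀ η ∈ (E h).angles,
    ∃ ξ, e.GoodDirection (S h) δ φ₁ φ₂ η ξ

/-- `u` is given on `𝒯₁ × 𝒯₂ × H_β × ℰ` by the absolutely convergent double integral
`(2π)^{-1/2} ∫_ℝ ∫_{L_ξ} ω(u,m,ε) exp(-(u/(ε^{λ₁}t₁))^{k₁} - (u/(ε^{λ₂}t₂))^{k₂}) e^{izm} du/u dm`,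
for every direction `ξ` allowed by the admissibility condition at the point considered. -/
def IsGivenByIntegral (δ : ℝ) (T₁ T₂ : Sector) (r₁ : ℝ) (E : Sector) (rE : ℝ) (S : Sector)
    (ω : ℂ → ℝ → ℂ → ℂ) (u : ℂ → ℂ → ℂ → ℂ → ℂ) : Prop :=
  ∀ x₁ x₂ x : ℝ, x₁ ∈ Ioo 0 r₁ → 0 < x₂ → x ∈ Ioo 0 rE →
    ∀ φ₁ ∈ T₁.angles, ∀ φ₂ ∈ T₂.angles, ∀ η ∈ E.angles,
      ∀ ξ, e.GoodDirection S δ φ₁ φ₂ η ξ → ∀ z ∈ strip e.β,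
        let t₁ : ℂ := x₁ * exp (φ₁ * I)
        let t₂ : ℂ := x₂ * exp (φ₂ * I)
        let ε : ℂ := x * exp (η * I)
        Integrable (fun p : ℝ × ℝ =>
            rayIntegrand e.k₁ e.k₂ (fun τ => ω τ p.1 ε) ξ (ε ^ e.lam₁ * t₁) (ε ^ e.lam₂ * t₂) p.2 *
              exp (I * z * p.1))
          (volume.prod (volume.restrict (Ioi 0))) ∧
        u t₁ t₂ z ε = invFourier (fun m =>
          rayIntegral e.k₁ e.k₂ (fun τ => ω τ m ε) ξ (ε ^ e.lam₁ * t₁) (ε ^ e.lam₂ * t₂)) z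

end Equation

end

end OuterPDE

open OuterPDE

/-! The equation is solved by a Laplace–Fourier transform. Put `T_j = ε^{λ_j} t_j`. On the kernel
`exp(-(u/T_1)^{k_1} - (u/T_2)^{k_2}) e^{izm}` the operator `t_j^{k_j+1} ∂_{t_j}` is multiplication
by `k_j u^{k_j} ε^{-λ_j k_j}`, `∂_z` is multiplication by `im`, and multiplying the integral by
`c_{ℓ₁ℓ₂}` amounts to a convolution in `m`. The conditions on `Δ` make the powers of `ε` match, so
the main equation for `u` follows from the auxiliary equation for `ω` (`solvesAt_of_isLaplace`).

The auxiliary equation is solved separately for each `τ`, as a fixed point equation in `m`.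
Separation from the roots gives `|P_m(τ)| ≥ a |R_D(im)| (1+|τ|)^N`, with `N` the degree of `P_m` in
`τ` (`exists_le_norm_Pm`). The degree conditions bound every term on the right by the same quantity
times the weight, and the strict inequality for `Δ` leaves a factor `|ε|`. For small `ε` the
operator therefore halves norms (`exists_contraction`), and a Neumann series gives the solution. As
`τ` is only a parameter, the series `borelSolution` lives on the set of all points separated from
the roots and depends on no sector. One function thus serves as `ω_h` for every `h`.

Along a ray `ω` grows like `e^{ν|u|^{k'}}` with `k' < k_2`, so the `k_2`-exponential alone ensures
convergence. Of the `k_1`-exponential only a lower bound on the real part of its argument is needed,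
since `k_1 < k_2`. Cauchy's theorem between rays gives independence of the direction, and moves the
half-line of the forcing term from `arg T_2` to `ξ`.

For neighbouring sectors the two rays may be separated by roots, but `ω` is holomorphic in `D(0,
ρ)`. The inner segments can be joined there by an arc of radius `ρ/2`. What remains is that arc and
the two tails, on which the kernel is `O(exp(-D/|ε|^{λ_2 k_2}))` (`norm_rayIntegral_sub_le`). Since
`ε` may have arguments differing by a multiple of `2π` in the two sectors,
`GoodDirection.exists_common` first brings both directions into one interval of decay.

Holomorphy in `ε` requires that of `C_{ℓ₁ℓ₂}(m, ·)`, which is recovered from that of its transform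
`c_{ℓ₁ℓ₂}` by Gaussian inversion (`differentiableOn_of_invFourier`). -/

namespace OuterPDE

/-! ### Holomorphic parametric integrals -/

section ParametricIntegral

variable {E : Type*} [NormedAddCommGroup E] [NormedSpace ℂ E]

/-- Cauchy's estimate for the Fréchet derivative. -/
theorem norm_fderiv_le_of_ball {f : E → ℂ} {x₀ x : E} {R b : ℝ} (hR : 0 < R)
    (hf : DifferentiableOn ℂ f (Metric.ball x₀ R)) (hb : ∀ y ∈ Metric.ball x₀ R, ‖f y‖ ≤ b)
    (hx : x ∈ Metric.ball x₀ (R / 2)) : ‖fderiv ℂ f x‖ ≤ 4 / R * b := by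
  have hx' : x ∈ Metric.ball x₀ R := Metric.ball_subset_ball (by linarith) hx
  have hb0 : 0 ≤ b := (norm_nonneg _).trans (hb x hx')
  refine ContinuousLinearMap.opNorm_le_bound _ (by positivity) fun v => ?_
  rcases eq_or_ne v 0 with rfl | hv
  · simp
  have hv' : 0 < ‖v‖ := norm_pos_iff.2 hv
  -- With this radius `‖t • v‖ ≤ R / 4`, so the complex line through `x` stays within `R/2 + R/4 <
  -- R` of `x₀`; it is the source of the constant `4 / R`.
  set r : ℝ := R / (4 * ‖v‖) with hr
  have hr0 : 0 < r := by positivity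
  have hmem : ∀ t ∈ Metric.closedBall (0 : ℂ) r, x + t • v ∈ Metric.ball x₀ R := by
    intro t ht
    rw [mem_closedBall_zero_iff] at ht
    rw [Metric.mem_ball, dist_eq_norm] at hx ⊢
    have h1 : ‖t • v‖ ≤ R / 4 := by
      rw [norm_smul]
      calc ‖t‖ * ‖v‖ ≤ r * ‖v‖ := by gcongr
        _ = R / 4 := by rw [hr]; field_simp
    calc ‖x + t • v - x₀‖ = ‖(x - x₀) + t • v‖ := by congr 1; abel
      _ ≤ ‖x - x₀‖ + ‖t • v‖ := norm_add_le _ _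
      _ < R := by linarith
  have hd : DifferentiableOn ℂ (fun t : ℂ => f (x + t • v)) (Metric.closedBall 0 r) := by
    intro t ht
    have h1 : DifferentiableAt ℂ f (x + t • v) :=
      hf.differentiableAt (Metric.isOpen_ball.mem_nhds (hmem t ht))
    have h2 : DifferentiableAt ℂ (fun t : ℂ => x + t • v) t := by fun_prop
    exact (h1.comp t h2).differentiableWithinAt
  have hderiv : deriv (fun t : ℂ => f (x + t • v)) 0 = fderiv ℂ f x v := by
    have h1 : HasFDerivAt f (fderiv ℂ f x) (x + (0 : ℂ) • v) := by
      simpa using (hf.differentiableAt (Metric.isOpen_ball.mem_nhds hx')).hasFDerivAt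
    have h2 : HasDerivAt (fun t : ℂ => x + t • v) v 0 := by
      simpa using ((hasDerivAt_id (0 : ℂ)).smul_const v).const_add x
    exact (h1.comp_hasDerivAt (0 : ℂ) h2).deriv
  have := Complex.norm_deriv_le_of_forall_mem_sphere_norm_le hr0 (hd.diffContOnCl_ball le_rfl)
    (fun t ht => hb _ (hmem t (Metric.sphere_subset_closedBall ht)))
  rw [hderiv] at this
  refine this.trans (le_of_eq ?_)
  rw [hr]; field_simp

variable [FiniteDimensional ℂ E] {α : Type*} [MeasurableSpace α] {μ : Measure α}

/-- A locally dominated integral of holomorphic functions is holomorphic. -/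
theorem differentiableAt_integral_of_dominated {F : E → α → ℂ} {x₀ : E} {U : Set E}
    (hU : U ∈ 𝓝 x₀) {b : α → ℝ} (hb : Integrable b μ)
    (hmeas : ∀ x ∈ U, AEStronglyMeasurable (F x) μ)
    (hdiff : ∀ᵐ a ∂μ, DifferentiableOn ℂ (fun x => F x a) U)
    (hbound : ∀ᵐ a ∂μ, ∀ x ∈ U, ‖F x a‖ ≤ b a) :
    DifferentiableAt ℂ (fun x => ∫ a, F x a ∂μ) x₀ := by
  obtain ⟨R, hR, hRU⟩ := Metric.mem_nhds_iff.1 hU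
  have hx₀ : x₀ ∈ U := mem_of_mem_nhds hU
  have hdx₀ : ∀ᵐ a ∂μ, HasFDerivAt (fun x => F x a) (fderiv ℂ (fun x => F x a) x₀) x₀ := by
    filter_upwards [hdiff] with a ha using (ha.differentiableAt hU).hasFDerivAt
  -- Each directional derivative is an a.e. limit of measurable difference quotients with steps
  -- `1/(n+1)`; finite dimension then assembles the full derivative from a basis.
  have hmeas' : AEStronglyMeasurable (fun a => fderiv ℂ (fun x => F x a) x₀) μ := by
    let B := Module.finBasis ℂ E
    have key : ∀ v : E, AEStronglyMeasurable (fun a => fderiv ℂ (fun x => F x a) x₀ v) μ := by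
      intro v
      have hlim : Tendsto (fun n : ℕ => x₀ + ((n : ℂ) + 1)⁻¹ • v) atTop (𝓝 x₀) := by
        have : Tendsto (fun n : ℕ => ((n : ℂ) + 1)⁻¹) atTop (𝓝 0) := by
          simpa [one_div] using tendsto_one_div_add_atTop_nhds_zero_nat (𝕜 := ℂ)
        simpa using (this.smul_const v).const_add x₀
      -- Shifting the sequence by `N` puts every evaluation point inside `U`, where measurability is
      -- known.
      obtain ⟨N, hN⟩ := eventually_atTop.1 (hlim.eventually_mem hU)
      refine aestronglyMeasurable_of_tendsto_ae (u := atTop)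
        (f := fun (n : ℕ) a => (((n + N : ℕ) : ℂ) + 1) *
          (F (x₀ + (((n + N : ℕ) : ℂ) + 1)⁻¹ • v) a - F x₀ a)) ?_ ?_
      · intro n
        exact ((hmeas _ (hN _ (by omega))).sub (hmeas _ hx₀)).const_mul _
      · filter_upwards [hdx₀] with a ha
        have h1 : Tendsto (fun n : ℕ => ((n : ℂ) + 1) *
            (F (x₀ + ((n : ℂ) + 1)⁻¹ • v) a - F x₀ a)) atTop
            (𝓝 (fderiv ℂ (fun x => F x a) x₀ v)) := by
          have hl : Tendsto (fun n : ℕ => ((n : ℂ) + 1)⁻¹) atTop (𝓝[≠] 0) := by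
            refine tendsto_nhdsWithin_iff.2 ⟨by
              simpa [one_div] using tendsto_one_div_add_atTop_nhds_zero_nat (𝕜 := ℂ), ?_⟩
            exact Eventually.of_forall fun n => inv_ne_zero (Nat.cast_add_one_ne_zero n)
          have h2 : HasDerivAt (fun t : ℂ => F (x₀ + t • v) a)
              (fderiv ℂ (fun x => F x a) x₀ v) 0 := by
            have h1 : HasFDerivAt (fun x => F x a) (fderiv ℂ (fun x => F x a) x₀)
                (x₀ + (0 : ℂ) • v) := by simpa using ha
            have h2 : HasDerivAt (fun t : ℂ => x₀ + t • v) v 0 := by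
              simpa using ((hasDerivAt_id (0 : ℂ)).smul_const v).const_add x₀
            exact h1.comp_hasDerivAt (0 : ℂ) h2
          have h3 := (hasDerivAt_iff_tendsto_slope.1 h2).comp hl
          refine h3.congr fun n => ?_
          simp [slope, Function.comp]
        exact h1.comp (tendsto_add_atTop_nat N)
    have hsum : (fun a => fderiv ℂ (fun x => F x a) x₀) = fun a =>
        ∑ i, (fderiv ℂ (fun x => F x a) x₀ (B i)) • (B.coord i).toContinuousLinearMap := by
      ext a v
      conv_lhs => rw [← B.sum_repr v]
      rw [map_sum]
      simp only [map_smul, smul_eq_mul, sum_apply,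
        smul_apply, LinearMap.coe_toContinuousLinearMap', B.coord_apply]
      exact Finset.sum_congr rfl fun i _ => mul_comm _ _
    rw [hsum]
    exact Finset.aestronglyMeasurable_fun_sum _ fun i _ => (key (B i)).smul_const _
  have h_int : Integrable (F x₀) μ :=
    hb.mono' (hmeas x₀ hx₀) (hbound.mono fun a ha => ha x₀ hx₀)
  exact (hasFDerivAt_integral_of_dominated_of_fderiv_le
    (F' := fun x a => fderiv ℂ (fun x => F x a) x) (bound := fun a => 4 / R * b a)
    (Metric.ball_mem_nhds x₀ (half_pos hR)) (eventually_of_mem hU hmeas) h_int hmeas'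
    (by
      filter_upwards [hdiff, hbound] with a ha hba x hx
      exact norm_fderiv_le_of_ball hR (ha.mono hRU) (fun y hy => hba y (hRU hy)) hx)
    (hb.const_mul _)
    (by
      filter_upwards [hdiff] with a ha x hx
      refine (ha.differentiableAt (mem_of_superset (Metric.isOpen_ball.mem_nhds ?_) hRU)).hasFDerivAt
      exact Metric.ball_subset_ball (by linarith) hx)).differentiableAt

/-- A uniformly dominated integral of holomorphic functions on an open set is holomorphic. -/
theorem differentiableOn_integral_of_dominated {F : E → α → ℂ} {U : Set E}
    (hU : IsOpen U) {b : α → ℝ} (hb : Integrable b μ)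
    (hmeas : ∀ x ∈ U, AEStronglyMeasurable (F x) μ)
    (hdiff : ∀ᵐ a ∂μ, DifferentiableOn ℂ (fun x => F x a) U)
    (hbound : ∀ᵐ a ∂μ, ∀ x ∈ U, ‖F x a‖ ≤ b a) :
    DifferentiableOn ℂ (fun x => ∫ a, F x a ∂μ) U := fun _ hx =>
  (differentiableAt_integral_of_dominated (hU.mem_nhds hx) hb hmeas hdiff
    hbound).differentiableWithinAt

end ParametricIntegral

/-- A pointwise limit of a bounded sequence of holomorphic functions is holomorphic. -/
theorem differentiableOn_of_tendsto_of_bounded {F : ℕ → ℂ → ℂ} {f : ℂ → ℂ} {U : Set ℂ}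
    (hU : IsOpen U) {M : ℝ} (hF : ∀ n, DifferentiableOn ℂ (F n) U)
    (hM : ∀ n, ∀ z ∈ U, ‖F n z‖ ≤ M)
    (hlim : ∀ z ∈ U, Tendsto (fun n => F n z) atTop (𝓝 (f z))) : DifferentiableOn ℂ f U := by
  intro c hc
  obtain ⟨R', hR', hRU'⟩ := Metric.isOpen_iff.1 hU c hc
  obtain ⟨R, hR, hRR'⟩ := exists_between hR'
  have hRU : Metric.closedBall c R ⊆ U :=
    (Metric.closedBall_subset_ball hRR').trans hRU'
  have hmap : ∀ θ, circleMap c R θ ∈ U := fun θ =>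
    hRU (circleMap_mem_closedBall c hR.le θ)
  have hcont : ∀ n, Continuous fun θ => F n (circleMap c R θ) := fun n =>
    (hF n).continuousOn.comp_continuous (continuous_circleMap c R) hmap
  have hfb : ∀ z ∈ U, ‖f z‖ ≤ M := fun z hz =>
    le_of_tendsto (hlim z hz).norm (Eventually.of_forall fun n => hM n z hz)
  have hfm : AEStronglyMeasurable (fun θ => f (circleMap c R θ))
      (volume.restrict (uIoc 0 (2 * Real.pi))) :=
    aestronglyMeasurable_of_tendsto_ae atTop (fun n => (hcont n).aestronglyMeasurable)
      (Eventually.of_forall fun θ => hlim _ (hmap θ))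
  have hfc : CircleIntegrable f c R := by
    rw [CircleIntegrable, intervalIntegrable_iff]
    exact Integrable.mono' (g := fun _ => M) (intervalIntegrable_iff.1 intervalIntegrable_const) hfm
      (Eventually.of_forall fun θ => hfb _ (hmap θ))
  -- Cauchy's formula for `F n` survives the pointwise limit by dominated convergence on the circle,
  -- so `f` is itself a Cauchy integral near `c`.
  have hrep : ∀ w ∈ Metric.ball c R,
      (2 * Real.pi * I : ℂ)⁻¹ • ∮ z in C(c, R), (z - w)⁻¹ • f z = f w := by
    intro w hw
    refine tendsto_nhds_unique ?_ (hlim w (hRU (Metric.ball_subset_closedBall hw)))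
    have h1 : ∀ n, (2 * Real.pi * I : ℂ)⁻¹ • ∮ z in C(c, R), (z - w)⁻¹ • F n z = F n w := by
      intro n
      exact ((hF n).mono hRU).diffContOnCl_ball (le_refl _)
        |>.two_pi_i_inv_smul_circleIntegral_sub_inv_smul hw
    simp_rw [← h1]
    refine Tendsto.const_smul ?_ _
    have hd : 0 < R - dist w c := by simpa using hw
    have hne : ∀ θ, R - dist w c ≤ ‖circleMap c R θ - w‖ := by
      intro θ
      have h2 : dist (circleMap c R θ) c = R := by
        exact Metric.mem_sphere.1 (circleMap_mem_sphere c hR.le θ)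
      have h3 := dist_triangle_right (circleMap c R θ) c w
      rw [← dist_eq_norm, dist_comm w c]
      linarith
    refine intervalIntegral.tendsto_integral_filter_of_dominated_convergence
      (fun _ => R * ((R - dist w c)⁻¹ * M)) ?_ ?_ ?_ ?_
    · refine Eventually.of_forall fun n => Continuous.aestronglyMeasurable ?_
      simp only [deriv_circleMap]
      have : ∀ θ, circleMap c R θ - w ≠ 0 := fun θ h => by
        have := hne θ; rw [h, norm_zero] at this; linarith
      exact ((continuous_circleMap 0 R).mul continuous_const).smul
        ((((continuous_circleMap c R).sub continuous_const).inv₀ this).smul (hcont n))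
    · refine Eventually.of_forall fun n => Eventually.of_forall fun θ _ => ?_
      have := hM n _ (hmap θ)
      simp only [norm_smul, deriv_circleMap, norm_mul, norm_circleMap_zero, norm_I, mul_one,
        abs_of_pos hR, norm_inv]
      gcongr
      · exact hne θ
    · simp
    · refine Eventually.of_forall fun θ _ => ?_
      exact ((hlim _ (hmap θ)).const_smul _).const_smul _
  lift R to NNReal using hR.le
  have := (hasFPowerSeriesOn_cauchy_integral hfc (by exact_mod_cast hR)).differentiableOn
  have hd : DifferentiableAt ℂ (fun w => (2 * Real.pi * I : ℂ)⁻¹ • ∮ z in C(c, R),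
      (z - w)⁻¹ • f z) c := by
    refine this.differentiableAt ?_
    rw [Metric.eball_coe]
    exact Metric.ball_mem_nhds c hR
  refine (hd.congr_of_eventuallyEq ?_).differentiableWithinAt
  filter_upwards [Metric.ball_mem_nhds c hR] with w hw using (hrep w hw).symm

end OuterPDE

namespace OuterPDE

/-! ### Comparison of powers -/

/-- The higher power wins beyond the threshold `R = (|A|/c)^{1/(q-p)}`; below it the left side is at
most `|A| R^p`, which is the witness. -/
theorem exists_mul_rpow_le (A : ℝ) {c p q : ℝ} (hc : 0 < c) (hp : 0 ≤ p) (hpq : p < q) :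
    ∃ M : ℝ, 0 ≤ M ∧ ∀ r : ℝ, 0 ≤ r → A * r ^ p ≤ M + c * r ^ q := by
  set B : ℝ := |A| / c with hB
  set R : ℝ := B ^ (q - p)⁻¹ with hR
  have hB0 : 0 ≤ B := by positivity
  have hR0 : 0 ≤ R := by positivity
  refine ⟨|A| * R ^ p, by positivity, fun r hr => ?_⟩
  have h0 : A * r ^ p ≤ |A| * r ^ p := by gcongr; exact le_abs_self A
  refine h0.trans ?_
  rcases le_total r R with h | h
  · have : |A| * r ^ p ≤ |A| * R ^ p := by gcongr
    have : 0 ≤ c * r ^ q := by positivity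
    linarith
  · have h1 : B ≤ r ^ (q - p) := by
      have : R ^ (q - p) ≤ r ^ (q - p) := Real.rpow_le_rpow hR0 h (by linarith)
      rwa [hR, Real.rpow_inv_rpow hB0 (by linarith)] at this
    have h2 : |A| ≤ c * r ^ (q - p) := by
      rw [hB, div_le_iff₀ hc] at h1; linarith
    have h3 : |A| * r ^ p ≤ c * r ^ q := by
      rcases hr.eq_or_lt with rfl | hr'
      -- At `r = 0` with `p = 0` the value `0 ^ 0 = 1` matters: then `R ≤ 0` forces `R = 0`, hence
      -- `A = 0`.
      · rcases hp.eq_or_lt with rfl | hp'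
        · have : R = 0 := le_antisymm h hR0
          rw [hR, Real.rpow_eq_zero hB0 (inv_ne_zero (by linarith))] at this
          have hA : |A| = 0 := by
            rw [hB, div_eq_zero_iff] at this
            exact this.resolve_right hc.ne'
          rw [hA]; simp; positivity
        · rw [Real.zero_rpow hp'.ne', Real.zero_rpow (by linarith)]; simp
      · calc |A| * r ^ p ≤ c * r ^ (q - p) * r ^ p := by gcongr
          _ = c * r ^ q := by rw [mul_assoc, ← Real.rpow_add hr']; ring_nf
    have : 0 ≤ |A| * R ^ p := by positivity
    linarith

/-! ### Rotation of half-lines -/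

/-- Cauchy's theorem for the sector bounded by the segments `(0, R] e^{ia}`, `(0, R] e^{ib}` and the
arc of radius `R`, for the form `G(u) du/u`. -/
theorem integral_segment_sub_segment {G : ℂ → ℂ} {R a b B : ℝ} (hR : 0 < R)
    (hG : ∀ r ∈ Ioc 0 R, ∀ y ∈ uIcc a b, DifferentiableAt ℂ G (r * exp (y * I)))
    (hB : ∀ r ∈ Ioc 0 R, ∀ y ∈ uIcc a b, ‖G (r * exp (y * I))‖ ≤ B * r) :
    (∫ r in (0 : ℝ)..R, G (r * exp (a * I)) * (r : ℂ)⁻¹) -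
      (∫ r in (0 : ℝ)..R, G (r * exp (b * I)) * (r : ℂ)⁻¹) =
      - (I * ∫ y in a..b, G (R * exp (y * I))) := by
  have h_int : ∀ y ∈ uIcc a b,
      IntegrableOn (fun r : ℝ => G (r * exp (y * I)) * (r : ℂ)⁻¹) (Icc 0 R) volume := by
    intro y hy
    rw [integrableOn_Icc_iff_integrableOn_Ioc]
    refine Integrable.mono' (g := fun _ => B) (integrableOn_const (by simp)) ?_ ?_
    · refine ContinuousOn.aestronglyMeasurable ?_ measurableSet_Ioc
      intro r hr
      have h1 : ContinuousAt (fun r : ℝ => G (r * exp (y * I))) r :=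
        ContinuousAt.comp (f := fun r : ℝ => (r : ℂ) * exp (y * I)) (hG r hr y hy).continuousAt
          (by fun_prop)
      have h2 : ContinuousAt (fun r : ℝ => (r : ℂ)⁻¹) r :=
        Complex.continuous_ofReal.continuousAt.inv₀ (by exact_mod_cast hr.1.ne')
      exact (h1.mul h2).continuousWithinAt
    · filter_upwards [ae_restrict_mem measurableSet_Ioc] with r hr
      rw [norm_mul, norm_inv, norm_real, Real.norm_of_nonneg hr.1.le, ← div_eq_mul_inv,
        div_le_iff₀ hr.1]
      exact hB r hr y hy
  -- Under `u = e^w` the form `du/u` becomes `dw` and the sector truncated at radius `s` becomes a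
  -- rectangle, to which Cauchy's theorem applies; then `s → 0`.
  have hsub : ∀ s ∈ Ioo 0 R, ∀ y : ℝ, y ∈ uIcc a b →
      ∫ x in Real.log s..Real.log R, G (exp (x + y * I)) =
        ∫ r in s..R, G (r * exp (y * I)) * (r : ℂ)⁻¹ := by
    intro s hs y hy
    have h := intervalIntegral.integral_deriv_smul_comp'' (f := Real.exp) (f' := Real.exp)
      (a := Real.log s) (b := Real.log R) (g := fun r : ℝ => G (r * exp (y * I)) * (r : ℂ)⁻¹)
      Real.continuous_exp.continuousOn (fun x _ => (Real.hasDerivAt_exp x).hasDerivWithinAt)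
      Real.continuous_exp.continuousOn ?_
    · rw [Real.exp_log hs.1, Real.exp_log hR] at h
      rw [← h]
      refine intervalIntegral.integral_congr fun x _ => ?_
      have : (Real.exp x : ℂ) ≠ 0 := by exact_mod_cast (Real.exp_pos x).ne'
      simp only [Function.comp, real_smul]
      rw [exp_add, ← ofReal_exp]
      field_simp
    · rintro _ ⟨x, hx, rfl⟩
      rw [uIcc_of_le (Real.log_le_log hs.1 hs.2.le)] at hx
      have hr : Real.exp x ∈ Ioc 0 R :=
        ⟨Real.exp_pos x, by rw [← Real.exp_log hR]; exact Real.exp_le_exp.2 hx.2⟩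
      have h1 : ContinuousAt (fun r : ℝ => G (r * exp (y * I))) (Real.exp x) :=
        ContinuousAt.comp (f := fun r : ℝ => (r : ℂ) * exp (y * I))
          (hG _ hr y hy).continuousAt (by fun_prop)
      have h2 : ContinuousAt (fun r : ℝ => (r : ℂ)⁻¹) (Real.exp x) :=
        Complex.continuous_ofReal.continuousAt.inv₀ (by exact_mod_cast hr.1.ne')
      exact (h1.mul h2).continuousWithinAt
  have hrect : ∀ s ∈ Ioo 0 R,
      (∫ r in s..R, G (r * exp (a * I)) * (r : ℂ)⁻¹) -
        (∫ r in s..R, G (r * exp (b * I)) * (r : ℂ)⁻¹) +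
        I * (∫ y in a..b, G (R * exp (y * I))) - I * (∫ y in a..b, G (s * exp (y * I))) = 0 := by
    intro s hs
    have h := integral_boundary_rect_eq_zero_of_differentiableOn (fun w => G (exp w))
      (Real.log s + a * I) (Real.log R + b * I) ?_
    · simp only [add_re, ofReal_re, mul_re, I_re, mul_zero, ofReal_im, I_im, mul_one, sub_self,
        add_zero, add_im, mul_im, zero_add, smul_eq_mul] at h
      rw [hsub s hs a left_mem_uIcc, hsub s hs b right_mem_uIcc] at h
      have e : ∀ r : ℝ, 0 < r → ∀ y : ℝ, exp (Real.log r + y * I) = r * exp (y * I) := by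
        intro r hr y
        rw [exp_add, ← ofReal_exp, Real.exp_log hr]
      simpa only [e R hR, e s hs.1] using h
    · intro w hw
      rw [mem_reProdIm] at hw
      simp only [add_re, ofReal_re, mul_re, I_re, mul_zero, ofReal_im, I_im, mul_one, sub_self,
        add_zero, add_im, mul_im, zero_add] at hw
      rw [uIcc_of_le (Real.log_le_log hs.1 hs.2.le)] at hw
      have hr : Real.exp w.re ∈ Ioc 0 R :=
        ⟨Real.exp_pos _, by rw [← Real.exp_log hR]; exact Real.exp_le_exp.2 hw.1.2⟩
      have he : exp w = Real.exp w.re * exp (w.im * I) := by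
        rw [ofReal_exp, ← exp_add, re_add_im]
      have hd : DifferentiableAt ℂ G (exp w) := by rw [he]; exact hG _ hr _ hw.2
      exact (hd.comp w differentiableAt_exp).differentiableWithinAt
  have hlim : ∀ y ∈ uIcc a b, Tendsto (fun s => ∫ r in s..R, G (r * exp (y * I)) * (r : ℂ)⁻¹)
      (𝓝[>] 0) (𝓝 (∫ r in (0 : ℝ)..R, G (r * exp (y * I)) * (r : ℂ)⁻¹)) := by
    intro y hy
    have hi := h_int y hy
    have hc := (intervalIntegral.continuousOn_primitive_interval_left
      (μ := volume) (a := 0) (b := R)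
      (by rwa [uIcc_of_le hR.le])) 0 left_mem_uIcc
    rw [uIcc_of_le hR.le] at hc
    refine hc.mono_left ?_
    rw [← nhdsWithin_Ioo_eq_nhdsGT hR]
    exact nhdsWithin_mono _ Ioo_subset_Icc_self
  -- The bound `B * s` kills the small arc, so no regularity of `G` at the vertex is needed.
  have harc : Tendsto (fun s : ℝ => ∫ y in a..b, G (s * exp (y * I))) (𝓝[>] 0) (𝓝 0) := by
    have h1 : Tendsto (fun s : ℝ => B * s * |b - a|) (𝓝[>] 0) (𝓝 0) := by
      have : Tendsto (fun s : ℝ => B * s * |b - a|) (𝓝 0) (𝓝 (B * 0 * |b - a|)) :=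
        Continuous.tendsto (by fun_prop) 0
      simp only [mul_zero, zero_mul] at this
      exact this.mono_left nhdsWithin_le_nhds
    refine squeeze_zero_norm' ?_ h1
    filter_upwards [Ioo_mem_nhdsGT hR] with s hs
    exact intervalIntegral.norm_integral_le_of_norm_le_const fun y hy =>
      hB s ⟨hs.1, hs.2.le⟩ y (uIoc_subset_uIcc hy)
  have htot := ((((hlim a left_mem_uIcc).sub (hlim b right_mem_uIcc)).add_const
    (I * (∫ y in a..b, G (R * exp (y * I))))).sub (harc.const_mul I))
  have hz := tendsto_nhds_unique htot (tendsto_const_nhds.congr' (by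
    filter_upwards [Ioo_mem_nhdsGT hR] with s hs using (hrect s hs).symm))
  linear_combination hz

/-- The factor `r` in the bound cancels the `1/r` of `du/u`, leaving the integrable majorant `B
e^{-r}`. -/
theorem integrableOn_Ioi_of_le_mul_exp_neg {G : ℂ → ℂ} {y B : ℝ}
    (hG : ∀ r : ℝ, 0 < r → ContinuousAt G (r * exp (y * I)))
    (hB : ∀ r : ℝ, 0 < r → ‖G (r * exp (y * I))‖ ≤ B * r * Real.exp (-r)) :
    IntegrableOn (fun r : ℝ => G (r * exp (y * I)) * (r : ℂ)⁻¹) (Ioi 0) := by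
  have h0 : IntegrableOn (fun r : ℝ => B * Real.exp (-r)) (Ioi 0) :=
    (integrableOn_exp_neg_Ioi 0).const_mul B
  refine Integrable.mono' h0 ?_ ?_
  · refine ContinuousOn.aestronglyMeasurable ?_ measurableSet_Ioi
    intro r hr
    have h1 : ContinuousAt (fun r : ℝ => G (r * exp (y * I))) r :=
      ContinuousAt.comp (f := fun r : ℝ => (r : ℂ) * exp (y * I)) (hG r hr) (by fun_prop)
    have h2 : ContinuousAt (fun r : ℝ => (r : ℂ)⁻¹) r :=
      Complex.continuous_ofReal.continuousAt.inv₀ (by exact_mod_cast (ne_of_gt hr))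
    exact (h1.mul h2).continuousWithinAt
  · filter_upwards [ae_restrict_mem measurableSet_Ioi] with r hr
    have hr : 0 < r := hr
    rw [norm_mul, norm_inv, norm_real, Real.norm_of_nonneg hr.le, ← div_eq_mul_inv,
      div_le_iff₀ hr]
    linarith [hB r hr]

/-- Integrals of `G(u) du/u` along two half-lines agree if `G` is holomorphic between them and
decays. -/
theorem integral_ray_eq_integral_ray {G : ℂ → ℂ} {a b B : ℝ}
    (hG : ∀ r : ℝ, 0 < r → ∀ y ∈ uIcc a b, DifferentiableAt ℂ G (r * exp (y * I)))
    (hB : ∀ r : ℝ, 0 < r → ∀ y ∈ uIcc a b, ‖G (r * exp (y * I))‖ ≤ B * r * Real.exp (-r)) :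
    (∫ r in Ioi (0 : ℝ), G (r * exp (a * I)) * (r : ℂ)⁻¹) =
      ∫ r in Ioi (0 : ℝ), G (r * exp (b * I)) * (r : ℂ)⁻¹ := by
  have hB0 : 0 ≤ B := by
    have := (norm_nonneg _).trans (hB 1 one_pos a left_mem_uIcc)
    simp only [mul_one] at this
    exact nonneg_of_mul_nonneg_left this (Real.exp_pos _)
  have hseg : ∀ R : ℝ, 0 < R → (∫ r in (0 : ℝ)..R, G (r * exp (a * I)) * (r : ℂ)⁻¹) -
      (∫ r in (0 : ℝ)..R, G (r * exp (b * I)) * (r : ℂ)⁻¹) =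
      - (I * ∫ y in a..b, G (R * exp (y * I))) := fun R hR =>
    integral_segment_sub_segment (B := B) hR (fun r hr y hy => hG r hr.1 y hy) (fun r hr y hy => by
      refine (hB r hr.1 y hy).trans ?_
      have h1 : Real.exp (-r) ≤ 1 := Real.exp_le_one_iff.2 (by linarith [hr.1])
      exact mul_le_of_le_one_right (mul_nonneg hB0 hr.1.le) h1)
  have hlim : ∀ y ∈ uIcc a b, Tendsto (fun R : ℝ => ∫ r in (0 : ℝ)..R,
      G (r * exp (y * I)) * (r : ℂ)⁻¹) atTop
      (𝓝 (∫ r in Ioi (0 : ℝ), G (r * exp (y * I)) * (r : ℂ)⁻¹)) := fun y hy =>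
    intervalIntegral_tendsto_integral_Ioi 0 (integrableOn_Ioi_of_le_mul_exp_neg
      (fun r hr => (hG r hr y hy).continuousAt) (fun r hr => hB r hr y hy)) tendsto_id
  have harc : Tendsto (fun R : ℝ => - (I * ∫ y in a..b, G (R * exp (y * I)))) atTop (𝓝 0) := by
    have h1 : Tendsto (fun R : ℝ => B * (R ^ 1 * Real.exp (-R)) * |b - a|) atTop (𝓝 0) := by
      simpa using ((Real.tendsto_pow_mul_exp_neg_atTop_nhds_zero 1).const_mul B).mul_const |b - a|
    refine squeeze_zero_norm' ?_ h1
    filter_upwards [Ioi_mem_atTop 0] with R hR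
    rw [norm_neg, norm_mul, norm_I, one_mul]
    refine intervalIntegral.norm_integral_le_of_norm_le_const fun y hy => ?_
    rw [pow_one, ← mul_assoc]
    exact hB R hR y (uIoc_subset_uIcc hy)
  have h := (hlim a left_mem_uIcc).sub (hlim b right_mem_uIcc)
  have h' := tendsto_nhds_unique h (harc.congr' (by
    filter_upwards [Ioi_mem_atTop 0] with R hR using (hseg R hR).symm))
  exact sub_eq_zero.1 h'

end OuterPDE

namespace OuterPDE

/-! ### Holomorphic dependence of a function on a parameter through its Fourier transform -/

open FourierTransform in
theorem fourier_eq_invFourier (f : ℝ → ℂ) (w : ℝ) :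
    𝓕 f w = (Real.sqrt (2 * Real.pi) : ℂ) * invFourier f ((-(2 * Real.pi * w) : ℝ) : ℂ) := by
  have h0 : (Real.sqrt (2 * Real.pi) : ℂ) ≠ 0 := by
    exact_mod_cast (Real.sqrt_pos.2 Real.two_pi_pos).ne'
  rw [invFourier, ofReal_inv, mul_inv_cancel_left₀ h0, Real.fourier_real_eq_integral_exp_smul]
  refine integral_congr_ae (Eventually.of_forall fun m => ?_)
  simp only [smul_eq_mul]
  rw [mul_comm]
  congr 2
  push_cast
  ring

/-- Unit `L¹` norm of the Gaussian mollifier: averaging with it does not enlarge a sup bound, which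
supplies the uniform bound in `differentiableOn_of_invFourier`. -/
theorem integral_gaussian_kernel {c : ℝ} (hc : 0 < c) (v : ℝ) :
    ∫ w : ℝ, ‖((Real.pi * c : ℂ) ^ (Module.finrank ℝ ℝ / 2 : ℂ) *
      cexp (-Real.pi ^ 2 * c * ‖v - w‖ ^ 2))‖ = 1 := by
  have hpc : 0 < Real.pi * c := by positivity
  have h1 : ∀ w : ℝ, ‖((Real.pi * c : ℂ) ^ (Module.finrank ℝ ℝ / 2 : ℂ) *
      cexp (-Real.pi ^ 2 * c * ‖v - w‖ ^ 2))‖ =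
      Real.sqrt (Real.pi * c) * Real.exp (-(Real.pi ^ 2 * c) * (v - w) ^ 2) := by
    intro w
    rw [norm_mul, Module.finrank_self]
    congr 1
    · rw [show (Real.pi * c : ℂ) = ((Real.pi * c : ℝ) : ℂ) by push_cast; rfl,
        norm_cpow_eq_rpow_re_of_pos hpc, Real.sqrt_eq_rpow]
      norm_num
    · rw [show (-Real.pi ^ 2 * c * ‖v - w‖ ^ 2 : ℂ) =
        ((-(Real.pi ^ 2 * c) * (v - w) ^ 2 : ℝ) : ℂ) by
          rw [Real.norm_eq_abs]; norm_cast; rw [sq_abs]; ring_nf, ← ofReal_exp, norm_real,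
        Real.norm_of_nonneg (Real.exp_pos _).le]
  simp_rw [h1]
  rw [integral_const_mul, integral_sub_left_eq_self
    (fun x : ℝ => Real.exp (-(Real.pi ^ 2 * c) * x ^ 2)) volume v, integral_gaussian,
    ← Real.sqrt_mul hpc.le]
  rw [Real.sqrt_eq_one]
  field_simp

open FourierTransform in
/-- If the inverse Fourier transform of `g(·, ε)` is holomorphic in `ε`, then so is `g(m, ε)`. -/
theorem differentiableOn_of_invFourier {g : ℝ → ℂ → ℂ} {b : ℝ → ℝ} {M : ℝ} {U : Set ℂ}
    (hU : IsOpen U) (hb : Integrable b) (hgb : ∀ ε ∈ U, ∀ m, ‖g m ε‖ ≤ b m) (hM : ∀ m, b m ≤ M)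
    (hgc : ∀ ε ∈ U, Continuous fun m => g m ε)
    (hholo : ∀ x : ℝ, DifferentiableOn ℂ (fun ε => invFourier (fun m => g m ε) x) U) (m : ℝ) :
    DifferentiableOn ℂ (fun ε => g m ε) U := by
  have h_int : ∀ ε ∈ U, Integrable fun m => g m ε := fun ε hε =>
    hb.mono' (hgc ε hε).aestronglyMeasurable (Eventually.of_forall (hgb ε hε))
  -- Moving the Fourier transform from the Gaussian onto `g` writes the mollified `g` as an integral
  -- of `𝓕 g`, whose dependence on `ε` is holomorphic by hypothesis.
  have key : ∀ ε ∈ U, ∀ c : ℝ, 0 < c →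
      ∫ w : ℝ, ((Real.pi * c : ℂ) ^ (Module.finrank ℝ ℝ / 2 : ℂ) *
        cexp (-Real.pi ^ 2 * c * ‖m - w‖ ^ 2)) • g w ε =
      ∫ w : ℝ, cexp (-c⁻¹ * ‖w‖ ^ 2 + 2 * Real.pi * I * inner ℝ m w) •
        𝓕 (fun m => g m ε) w := by
    intro ε hε c hc
    have J : Integrable (fun w : ℝ ↦ cexp (- c⁻¹ * ‖w‖ ^ 2 + 2 * Real.pi * I * inner ℝ m w)) :=
      GaussianFourier.integrable_cexp_neg_mul_sq_norm_add (by simpa) _ _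
    have h := (VectorFourier.integral_fourierIntegral_smul_eq_flip (L := innerₗ ℝ)
      Real.continuous_fourierChar continuous_inner J (h_int ε hε))
    have h' : ∫ w : ℝ, 𝓕 (fun w : ℝ ↦ cexp (- c⁻¹ * ‖w‖ ^ 2 + 2 * Real.pi * I * inner ℝ m w)) w •
        g w ε = ∫ w : ℝ, cexp (-c⁻¹ * ‖w‖ ^ 2 + 2 * Real.pi * I * inner ℝ m w) •
        𝓕 (fun m => g m ε) w := by
      simpa using! h
    rw [← h']
    congr with w
    rw [fourier_gaussian_innerProductSpace' (by simpa)]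
    congr 2
    · simp
    · congr 1
      simp only [ofReal_inv, div_inv_eq_mul]
      ring
  have hFb : ∀ ε ∈ U, ∀ w : ℝ, ‖𝓕 (fun m => g m ε) w‖ ≤ ∫ m, b m := by
    intro ε hε w
    rw [Real.fourier_real_eq_integral_exp_smul]
    refine norm_integral_le_of_norm_le hb (Eventually.of_forall fun x => ?_)
    rw [norm_smul, norm_exp_ofReal_mul_I, one_mul]
    exact hgb ε hε x
  have hlim : ∀ ε ∈ U, Tendsto (fun c : ℝ => ∫ w : ℝ,
      ((Real.pi * c : ℂ) ^ (Module.finrank ℝ ℝ / 2 : ℂ) *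
        cexp (-Real.pi ^ 2 * c * ‖m - w‖ ^ 2)) • g w ε) atTop (𝓝 (g m ε)) := fun ε hε =>
    Real.tendsto_integral_gaussian_smul' (h_int ε hε) (hgc ε hε).continuousAt
  -- The mollifications with `c = n + 1` are holomorphic in `ε`, bounded by `M`, and tend to `g m ε`
  -- by continuity at `m`.
  refine differentiableOn_of_tendsto_of_bounded (M := M) hU
    (F := fun n ε => ∫ w : ℝ, ((Real.pi * ((n + 1 : ℕ) : ℝ) : ℂ) ^ (Module.finrank ℝ ℝ / 2 : ℂ) *
        cexp (-Real.pi ^ 2 * ((n + 1 : ℕ) : ℝ) * ‖m - w‖ ^ 2)) • g w ε) ?_ ?_ ?_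
  · intro n
    have hc : (0 : ℝ) < ((n + 1 : ℕ) : ℝ) := by positivity
    generalize ((n + 1 : ℕ) : ℝ) = c at hc
    have J : Integrable (fun w : ℝ ↦ cexp (- c⁻¹ * ‖w‖ ^ 2 + 2 * Real.pi * I * inner ℝ m w)) :=
      GaussianFourier.integrable_cexp_neg_mul_sq_norm_add (by simpa) _ _
    refine DifferentiableOn.congr ?_ (fun ε hε => key ε hε _ hc)
    refine differentiableOn_integral_of_dominated hU (J.norm.mul_const (∫ m, b m)) ?_ ?_ ?_
    · intro ε hε
      refine J.aestronglyMeasurable.smul (Continuous.aestronglyMeasurable ?_)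
      exact VectorFourier.fourierIntegral_continuous Real.continuous_fourierChar
        (L := innerₗ ℝ) continuous_inner (h_int ε hε)
    · refine Eventually.of_forall fun w => ?_
      simp only [fourier_eq_invFourier]
      exact ((hholo _).const_mul _).const_mul _
    · refine Eventually.of_forall fun w ε hε => ?_
      rw [norm_smul]
      gcongr
      exact hFb ε hε w
  · intro n ε hε
    have hc : (0 : ℝ) < ((n + 1 : ℕ) : ℝ) := by positivity
    have hi : Integrable fun w : ℝ => ‖((Real.pi * ((n + 1 : ℕ) : ℝ) : ℂ) ^
        (Module.finrank ℝ ℝ / 2 : ℂ) *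
        cexp (-Real.pi ^ 2 * ((n + 1 : ℕ) : ℝ) * ‖m - w‖ ^ 2))‖ :=
      Integrable.of_integral_ne_zero (by rw [integral_gaussian_kernel hc]; exact one_ne_zero)
    refine (norm_integral_le_of_norm_le (hi.mul_const M) (Eventually.of_forall fun w => ?_)).trans
      (le_of_eq ?_)
    · rw [norm_smul]
      gcongr
      exact (hgb ε hε w).trans (hM w)
    · rw [integral_mul_const, integral_gaussian_kernel hc, one_mul]
  · intro ε hε
    exact (hlim ε hε).comp
      (tendsto_natCast_atTop_atTop.comp (tendsto_add_atTop_nat 1))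

/-! ### Polynomials on the imaginary axis -/

theorem exists_norm_eval_le (p : ℂ[X]) :
    ∃ A > 0, ∀ m : ℝ, ‖p.eval (I * m)‖ ≤ A * (1 + |m|) ^ p.natDegree := by
  refine ⟨1 + ∑ i ∈ Finset.range (p.natDegree + 1), ‖p.coeff i‖,
    add_pos_of_pos_of_nonneg one_pos (by positivity), fun m => ?_⟩
  rw [eval_eq_sum_range]
  have h1 : (1 : ℝ) ≤ 1 + |m| := by linarith [abs_nonneg m]
  calc ‖∑ i ∈ Finset.range (p.natDegree + 1), p.coeff i * (I * m) ^ i‖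
      ≤ ∑ i ∈ Finset.range (p.natDegree + 1), ‖p.coeff i‖ * (1 + |m|) ^ p.natDegree := by
        refine norm_sum_le_of_le _ fun i hi => ?_
        rw [norm_mul, norm_pow, norm_mul, norm_I, one_mul, norm_real, Real.norm_eq_abs]
        gcongr
        calc |m| ^ i ≤ (1 + |m|) ^ i := by gcongr; linarith
          _ ≤ (1 + |m|) ^ p.natDegree :=
            pow_le_pow_right₀ h1 (by rw [Finset.mem_range] at hi; omega)
    _ = (∑ i ∈ Finset.range (p.natDegree + 1), ‖p.coeff i‖) * (1 + |m|) ^ p.natDegree := by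
        rw [Finset.sum_mul]
    _ ≤ _ := by gcongr; linarith

/-- No root lies on the imaginary axis, so each factor `im - q` of `p` dominates both `|Re q| > 0`
and `|m - Im q|`, hence a multiple of `1 + |m|`. -/
theorem exists_le_norm_eval (p : ℂ[X]) (hp : ∀ m : ℝ, p.eval (I * m) ≠ 0) :
    ∃ a > 0, ∀ m : ℝ, a * (1 + |m|) ^ p.natDegree ≤ ‖p.eval (I * m)‖ := by
  have hsplit := IsAlgClosed.splits p
  have hp0 : p ≠ 0 := by rintro rfl; exact hp 0 (by simp)
  have hroot : ∀ q ∈ p.roots, q.re ≠ 0 := by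
    intro q hq h
    refine hp q.im ?_
    have : I * (q.im : ℂ) = q := by
      apply Complex.ext <;> simp [h]
    rw [this]
    exact (mem_roots hp0).1 hq
  have key : ∀ s : Multiset ℂ, (∀ q ∈ s, q.re ≠ 0) →
      ∃ a > 0, ∀ m : ℝ, a * (1 + |m|) ^ s.card ≤ ‖(s.map fun q => I * m - q).prod‖ := by
    intro s
    induction s using Multiset.induction with
    | empty => exact fun _ => ⟨1, one_pos, by simp⟩
    | cons q s ih =>
      intro hs
      obtain ⟨a, ha, h⟩ := ih fun x hx => hs x (Multiset.mem_cons_of_mem hx)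
      have hq : 0 < |q.re| := abs_pos.2 (hs q (Multiset.mem_cons_self q s))
      -- The first summand pays for `1 + |Im q|` out of `|Re q| ≤ ‖im - q‖`, the second for `|m - Im
      -- q|`.
      set A : ℝ := (1 + |q.im|) / |q.re| + 1 with hA
      have hA0 : 0 < A := by positivity
      refine ⟨A⁻¹ * a, by positivity, fun m => ?_⟩
      rw [Multiset.card_cons, Multiset.map_cons, Multiset.prod_cons, norm_mul, pow_succ]
      have h1 : |q.re| ≤ ‖I * m - q‖ := by
        simpa using Complex.abs_re_le_norm (I * m - q)
      have h2 : |m - q.im| ≤ ‖I * m - q‖ := by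
        simpa using Complex.abs_im_le_norm (I * m - q)
      have h3 : A⁻¹ * (1 + |m|) ≤ ‖I * m - q‖ := by
        rw [inv_mul_le_iff₀ hA0, hA, add_mul, one_mul]
        have h4 : 1 + |q.im| ≤ (1 + |q.im|) / |q.re| * ‖I * m - q‖ := by
          rw [div_mul_eq_mul_div, le_div_iff₀ hq]; gcongr
        have h5 : |m| ≤ |m - q.im| + |q.im| := by
          simpa using abs_add_le (m - q.im) q.im
        linarith
      calc A⁻¹ * a * ((1 + |m|) ^ s.card * (1 + |m|))
          = (A⁻¹ * (1 + |m|)) * (a * (1 + |m|) ^ s.card) := by ring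
        _ ≤ _ := by gcongr; exact h m
  obtain ⟨a, ha, h⟩ := key p.roots hroot
  have hl : 0 < ‖p.leadingCoeff‖ := norm_pos_iff.2 (leadingCoeff_ne_zero.2 hp0)
  refine ⟨‖p.leadingCoeff‖ * a, by positivity, fun m => ?_⟩
  rw [hsplit.eval_eq_prod_roots, norm_mul, hsplit.natDegree_eq_card_roots, mul_assoc]
  gcongr
  exact h m

/-- A lower bound for a polynomial away from its roots. -/
theorem leadingCoeff_mul_pow_le_norm_eval (p : ℂ[X]) (hp : p ≠ 0) {τ : ℂ} {c : ℝ} (hc : 0 ≤ c)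
    (h : ∀ q, p.eval q = 0 → c ≤ ‖τ - q‖) :
    ‖p.leadingCoeff‖ * c ^ p.natDegree ≤ ‖p.eval τ‖ := by
  have hsplit := IsAlgClosed.splits p
  have key : ∀ s : Multiset ℂ, (∀ q ∈ s, c ≤ ‖τ - q‖) →
      c ^ s.card ≤ ‖(s.map fun q => τ - q).prod‖ := by
    intro s
    induction s using Multiset.induction with
    | empty => simp
    | cons q s ih =>
      intro hs
      rw [Multiset.card_cons, Multiset.map_cons, Multiset.prod_cons, norm_mul, pow_succ']
      have := ih fun x hx => hs x (Multiset.mem_cons_of_mem hx)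
      have := hs q (Multiset.mem_cons_self q s)
      gcongr
  rw [hsplit.eval_eq_prod_roots, norm_mul, hsplit.natDegree_eq_card_roots]
  gcongr
  exact key _ fun q hq => h q ((mem_roots hp).1 hq)

/-! ### Weights -/

/-- The weight `(1 + |m|)^{-μ} e^{-β|m|}`. -/
noncomputable def weight (μ β m : ℝ) : ℝ := ((1 + |m|) ^ μ * Real.exp (β * |m|))⁻¹

theorem weight_pos (μ β m : ℝ) : 0 < weight μ β m := by unfold weight; positivity

theorem continuous_weight (μ β : ℝ) : Continuous (weight μ β) := by
  unfold weight
  have h : ∀ m : ℝ, 1 + |m| ≠ 0 := fun m => by positivity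
  refine Continuous.inv₀ (Continuous.mul ?_ (by fun_prop)) fun m => by positivity
  exact Continuous.rpow_const (by fun_prop) fun m => Or.inl (h m)

theorem weight_eq (μ β m : ℝ) :
    weight μ β m = (1 + |m|) ^ (-μ) * Real.exp (-(β * |m|)) := by
  rw [weight, mul_inv, Real.rpow_neg (by positivity), Real.exp_neg]

theorem weight_le_exp {μ : ℝ} (hμ : 0 ≤ μ) (β m : ℝ) :
    weight μ β m ≤ Real.exp (-(β * |m|)) := by
  rw [weight_eq]
  refine mul_le_of_le_one_left (Real.exp_pos _).le ?_
  exact Real.rpow_le_one_of_one_le_of_nonpos (by linarith [abs_nonneg m]) (by linarith)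

theorem weight_le_one {μ β : ℝ} (hμ : 0 ≤ μ) (hβ : 0 ≤ β) (m : ℝ) : weight μ β m ≤ 1 :=
  (weight_le_exp hμ β m).trans (Real.exp_le_one_iff.2 (by have := abs_nonneg m; nlinarith))

theorem integrable_one_add_abs_rpow {s : ℝ} (hs : 1 < s) :
    Integrable fun m : ℝ => (1 + |m|) ^ (-s) :=
  integrable_one_add_norm (E := ℝ) (by simpa using hs)

theorem weight_mul_pow_le {μ β : ℝ} (hβ : 0 ≤ β) (d : ℕ) (m : ℝ) :
    weight μ β m * (1 + |m|) ^ d ≤ (1 + |m|) ^ (-(μ - d)) := by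
  have h0 : 0 < 1 + |m| := by positivity
  rw [weight_eq]
  calc (1 + |m|) ^ (-μ) * Real.exp (-(β * |m|)) * (1 + |m|) ^ d
      ≤ (1 + |m|) ^ (-μ) * 1 * (1 + |m|) ^ d := by
        gcongr
        exact Real.exp_le_one_iff.2 (by have := abs_nonneg m; nlinarith)
    _ = _ := by
        rw [mul_one, ← Real.rpow_natCast, ← Real.rpow_add h0]; ring_nf

theorem integrable_weight {μ β : ℝ} (hμ : 1 < μ) (hβ : 0 ≤ β) : Integrable (weight μ β) := by
  refine (integrable_one_add_abs_rpow hμ).mono' (continuous_weight μ β).aestronglyMeasurable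
    (Eventually.of_forall fun m => ?_)
  rw [Real.norm_of_nonneg (weight_pos μ β m).le]
  simpa using weight_mul_pow_le (μ := μ) hβ 0 m

/-- The exponentials combine by the triangle inequality. Moreover one of `1 + |m - m₁|`, `1 + |m₁|`
is at least half of `1 + |m|`; that factor yields the decay in `m`, and the other is left to be
integrated in `m₁`. The loss is the factor `(1 + |m|)^d`, later compensated by `R_D(im)`. -/
theorem weight_mul_weight_le {μ β : ℝ} (hβ : 0 ≤ β) {d : ℕ} (hd : (d : ℝ) < μ) (m m₁ : ℝ) :
    weight μ β (m - m₁) * (weight μ β m₁ * (1 + |m₁|) ^ d) ≤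
      weight μ β m * (1 + |m|) ^ d *
        (2 ^ μ * ((1 + |m - m₁|) ^ (-μ) + (1 + |m₁|) ^ (-(μ - d)))) := by
  have hd0 : (0 : ℝ) ≤ d := Nat.cast_nonneg d
  have htri : |m| ≤ |m - m₁| + |m₁| := by simpa using abs_add_le (m - m₁) m₁
  have hX : 1 ≤ 1 + |m - m₁| := by linarith [abs_nonneg (m - m₁)]
  have hY : 1 ≤ 1 + |m₁| := by linarith [abs_nonneg m₁]
  have hZ : 1 ≤ 1 + |m| := by linarith [abs_nonneg m]
  have hexp : Real.exp (-(β * |m - m₁|)) * Real.exp (-(β * |m₁|)) ≤ Real.exp (-(β * |m|)) := by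
    rw [← Real.exp_add, Real.exp_le_exp]; nlinarith
  have hpow : ∀ x : ℝ, (1 + |x|) ^ (-μ) * (1 + |x|) ^ d = (1 + |x|) ^ (-(μ - d)) := by
    intro x
    rw [← Real.rpow_natCast, ← Real.rpow_add (by positivity)]; ring_nf
  have hmain : (1 + |m - m₁|) ^ (-μ) * (1 + |m₁|) ^ (-(μ - d)) ≤
      (1 + |m|) ^ (-(μ - d)) * (2 ^ μ * ((1 + |m - m₁|) ^ (-μ) + (1 + |m₁|) ^ (-(μ - d)))) := by
    have hXYZ : 1 + |m| ≤ 2 * (1 + |m - m₁|) ∨ 1 + |m| ≤ 2 * (1 + |m₁|) := by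
      by_contra! h
      linarith [h.1, h.2]
    generalize 1 + |m - m₁| = X at *
    generalize 1 + |m₁| = Y at *
    generalize 1 + |m| = Z at *
    have hX0 : 0 ≤ X ^ (-μ) := by positivity
    have hY0 : 0 ≤ Y ^ (-(μ - d)) := by positivity
    -- Needed for `s = 0` (the factor in `m - m₁`) and for `s = d` (the factor in `m₁`).
    have hhalf : ∀ x s : ℝ, Z ≤ 2 * x → s ≤ d → 0 ≤ s →
        x ^ (-(μ - s)) ≤ 2 ^ μ * Z ^ (-(μ - d)) := by
      intro x s hx hsd hs
      have hZ0 : 0 < Z := by linarith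
      calc x ^ (-(μ - s)) ≤ (Z / 2) ^ (-(μ - s)) :=
            Real.rpow_le_rpow_of_nonpos (by positivity) (by linarith) (by linarith)
        _ = 2 ^ (μ - s) * Z ^ (-(μ - s)) := by
            rw [Real.div_rpow hZ0.le (by norm_num), Real.rpow_neg (by norm_num : (0 : ℝ) ≤ 2),
              div_inv_eq_mul, mul_comm]
        _ ≤ 2 ^ μ * Z ^ (-(μ - d)) := by
            gcongr
            · norm_num
            · linarith
    rcases hXYZ with h | h
    · have h1 := hhalf X 0 h hd0 le_rfl
      rw [sub_zero] at h1
      have : 0 ≤ Z ^ (-(μ - d)) * 2 ^ μ * X ^ (-μ) := by positivity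
      nlinarith [mul_le_mul_of_nonneg_right h1 hY0]
    · have h1 := hhalf Y d h le_rfl hd0
      have : 0 ≤ Z ^ (-(μ - d)) * 2 ^ μ * Y ^ (-(μ - d)) := by positivity
      nlinarith [mul_le_mul_of_nonneg_left h1 hX0]
  rw [weight_eq, weight_eq, weight_eq]
  calc _ = ((1 + |m - m₁|) ^ (-μ) * ((1 + |m₁|) ^ (-μ) * (1 + |m₁|) ^ d)) *
        (Real.exp (-(β * |m - m₁|)) * Real.exp (-(β * |m₁|))) := by ring
    _ ≤ ((1 + |m|) ^ (-(μ - d)) *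
        (2 ^ μ * ((1 + |m - m₁|) ^ (-μ) + (1 + |m₁|) ^ (-(μ - d))))) *
        Real.exp (-(β * |m|)) := by
        rw [hpow]
        gcongr
    _ = _ := by rw [← hpow m]; ring

end OuterPDE

/-! ### Estimates for the auxiliary equation and the contraction property -/

namespace OuterPDE

/-- A locally bounded function that is entire in the first variable and continuous in the second is
jointly continuous. -/
theorem continuous_of_entire_of_bound {f : ℂ → ℝ → ℂ} {g : ℝ → ℝ} (hg : MonotoneOn g (Ici 0))
    (hf : ∀ m, Differentiable ℂ fun τ => f τ m) (hc : ∀ τ, Continuous fun m => f τ m)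
    (hb : ∀ τ m, ‖f τ m‖ ≤ g ‖τ‖) : Continuous fun p : ℂ × ℝ => f p.1 p.2 := by
  rw [continuous_iff_continuousAt]
  rintro ⟨τ₀, m₀⟩
  set M := g (‖τ₀‖ + 1)
  have hM : ∀ m, ∀ τ ∈ Metric.ball τ₀ 1, ‖f τ m‖ ≤ M := by
    intro m τ hτ
    refine (hb τ m).trans (hg (norm_nonneg _) (mem_Ici.2 (by positivity)) ?_)
    rw [Metric.mem_ball, dist_eq_norm] at hτ
    have := norm_add_le τ₀ (τ - τ₀)
    rw [add_sub_cancel] at this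
    linarith
  have hlip : ∀ m, ∀ τ ∈ Metric.ball τ₀ (1 / 2), ‖f τ m - f τ₀ m‖ ≤ 4 / 1 * M * ‖τ - τ₀‖ := by
    intro m τ hτ
    refine (convex_ball τ₀ (1 / 2)).norm_image_sub_le_of_norm_fderiv_le (𝕜 := ℂ)
      (fun x _ => hf m x) (fun x hx => ?_) (Metric.mem_ball_self (by norm_num)) hτ
    exact norm_fderiv_le_of_ball one_pos (hf m).differentiableOn (hM m) hx
  rw [ContinuousAt, tendsto_iff_norm_sub_tendsto_zero]
  have h1 : Tendsto (fun p : ℂ × ℝ => 4 / 1 * M * ‖p.1 - τ₀‖ + ‖f τ₀ p.2 - f τ₀ m₀‖)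
      (𝓝 (τ₀, m₀)) (𝓝 0) := by
    have : Continuous fun p : ℂ × ℝ => 4 / 1 * M * ‖p.1 - τ₀‖ + ‖f τ₀ p.2 - f τ₀ m₀‖ := by
      have := (hc τ₀).comp (continuous_snd (X := ℂ))
      simp only [Function.comp_def] at this
      fun_prop
    simpa using this.tendsto (τ₀, m₀)
  refine squeeze_zero' (Eventually.of_forall fun _ => norm_nonneg _) ?_ h1
  have : Metric.ball τ₀ (1 / 2) ×ˢ (univ : Set ℝ) ∈ 𝓝 (τ₀, m₀) :=
    prod_mem_nhds (Metric.ball_mem_nhds _ (by norm_num)) univ_mem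
  filter_upwards [this] with p hp
  calc ‖f p.1 p.2 - f τ₀ m₀‖ = ‖(f p.1 p.2 - f τ₀ p.2) + (f τ₀ p.2 - f τ₀ m₀)‖ := by
        congr 1; ring
    _ ≤ _ := (norm_add_le _ _).trans (by gcongr; exact hlip _ _ hp.1)

namespace Equation

variable (e : Equation)

/-- The points that keep away from all the roots of all the `P_m`, with constant `𝔪`. -/
def goodSet (𝔪 : ℝ) : Set ℂ :=
  {τ | ∀ m : ℝ, ∀ q : ℂ, e.Pm m q = 0 → 𝔪 * (1 + ‖τ‖) ≤ ‖τ - q‖}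

theorem isClosed_goodSet (𝔪 : ℝ) : IsClosed (e.goodSet 𝔪) := by
  simp only [goodSet, Set.ofPred_forall]
  exact isClosed_iInter fun m => isClosed_iInter fun q => isClosed_iInter fun _ =>
    isClosed_le (by fun_prop) (by fun_prop)

-- Separation from the roots is a closed condition, so it passes from the open disc to the closed
-- disc on which the auxiliary equation is posed.
variable {e} in
theorem RootSeparated.subset_goodSet {S : Sector} {ρ 𝔪 : ℝ} (hρ : 0 < ρ)
    (h : e.RootSeparated S ρ 𝔪) :
    S.unbounded ∪ Metric.closedBall (0 : ℂ) ρ ⊆ e.goodSet 𝔪 := by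
  have h' : S.unbounded ∪ Metric.ball (0 : ℂ) ρ ⊆ e.goodSet 𝔪 := fun τ hτ m q hq => h τ hτ m q hq
  refine union_subset (subset_union_left.trans h') ?_
  rw [← closure_ball (0 : ℂ) hρ.ne']
  exact closure_minimal (subset_union_right.trans h') (e.isClosed_goodSet 𝔪)

/-- The growth `r e^{νr^{k'}}`. -/
noncomputable def growth (r : ℝ) : ℝ := r * Real.exp (e.ν * r ^ e.k')

theorem growth_nonneg {r : ℝ} (hr : 0 ≤ r) : 0 ≤ e.growth r := mul_nonneg hr (Real.exp_pos _).le

variable {e}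

theorem Assumptions.k'_pos (he : e.Assumptions) : 0 < e.k' :=
  lt_of_le_of_lt (Nat.cast_nonneg _) he.k₁_lt_k'

theorem Assumptions.k₁_pos (he : e.Assumptions) : 0 < e.k₁ := he.one_le_k₁

theorem Assumptions.k₁_lt_k₂ (he : e.Assumptions) : e.k₁ < e.k₂ := by
  exact_mod_cast he.k₁_lt_k'.trans he.k'_lt_k₂

theorem Assumptions.k₂_pos (he : e.Assumptions) : 0 < e.k₂ := he.k₁_pos.trans he.k₁_lt_k₂

theorem Assumptions.one_lt_μ (he : e.Assumptions) : 1 < e.μ := by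
  have h1 : 1 ∈ Finset.Ico 1 e.D₁ := Finset.mem_Ico.2 ⟨le_rfl, he.two_le_D₁⟩
  have h2 : 1 ∈ Finset.Ico 1 e.D₂ := Finset.mem_Ico.2 ⟨le_rfl, he.two_le_D₂⟩
  have h3 : (0 : ℝ) ≤ (e.R 1 1).natDegree := Nat.cast_nonneg _
  linarith [he.μ_gt 1 h1 1 h2]

theorem monotoneOn_growth (he : e.Assumptions) : MonotoneOn e.growth (Ici 0) := by
  intro a ha b hb hab
  have ha : 0 ≤ a := ha
  have := he.ν_pos
  have := he.k'_pos
  unfold growth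
  gcongr

/-- `C_{ℓ₁ℓ₂}(m, ε)` is bounded by a multiple of the weight. -/
theorem Assumptions.exists_C_le (he : e.Assumptions) {l₁ l₂ : ℕ} (h₁ : l₁ ∈ Finset.Ico 1 e.D₁)
    (h₂ : l₂ ∈ Finset.Ico 1 e.D₂) : ∃ B > 0, ∀ ε ∈ Metric.ball (0 : ℂ) e.ε₀, ∀ m : ℝ,
      ‖e.C l₁ l₂ m ε‖ ≤ B * weight e.μ e.β m := by
  obtain ⟨B, hB, h⟩ := he.C_bound l₁ h₁ l₂ h₂
  refine ⟨B, hB, fun ε hε m => ?_⟩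
  rw [weight, ← div_eq_mul_inv, le_div_iff₀ (by positivity), mul_comm]
  exact h ε hε m

/-- Only the inverse Fourier transform `c_{ℓ₁ℓ₂}` is assumed holomorphic; Fourier inversion, applied
at real points `z = x` of the strip, transfers this to `C_{ℓ₁ℓ₂}(m, ·)`. -/
theorem Assumptions.differentiableOn_C (he : e.Assumptions) {l₁ l₂ : ℕ}
    (h₁ : l₁ ∈ Finset.Ico 1 e.D₁) (h₂ : l₂ ∈ Finset.Ico 1 e.D₂) (m : ℝ) :
    DifferentiableOn ℂ (fun ε => e.C l₁ l₂ m ε) (Metric.ball 0 e.ε₀) := by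
  obtain ⟨B, hB, h⟩ := he.exists_C_le h₁ h₂
  have hμ := he.one_lt_μ
  refine differentiableOn_of_invFourier (g := fun m ε => e.C l₁ l₂ m ε) (M := B) Metric.isOpen_ball
    ((integrable_weight hμ he.β_pos.le).const_mul B) h
    (fun m => mul_le_of_le_one_right hB.le (weight_le_one (by linarith) he.β_pos.le m))
    (he.C_cont l₁ h₁ l₂ h₂) (fun x => ?_) m
  refine (he.c_holo l₁ h₁ l₂ h₂).comp (f := fun ε : ℂ => ((x : ℂ), ε)) (by fun_prop) ?_
  intro ε hε
  exact ⟨by simpa [strip] using he.β_pos, hε⟩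

variable (e)

/-- The convolution `(2π)^{-1/2} ∫ C_{ℓ₁ℓ₂}(m - m₁, ε) R_{ℓ₁ℓ₂}(im₁) f(m₁) dm₁`. -/
noncomputable def conv (l₁ l₂ : ℕ) (ε : ℂ) (f : ℝ → ℂ) (m : ℝ) : ℂ :=
  ((Real.sqrt (2 * Real.pi))⁻¹ : ℝ) *
    ∫ m₁ : ℝ, e.C l₁ l₂ (m - m₁) ε * (e.R l₁ l₂).eval (I * m₁) * f m₁

/-- The coefficient of the convolution term in the auxiliary equation. -/
noncomputable def convCoeff (l₁ l₂ : ℕ) (ε τ : ℂ) : ℂ :=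
  ε ^ (e.Δ l₁ l₂ - e.lam₁ * e.k₁ * e.δ₁ l₁ - e.lam₂ * e.k₂ * e.δ₂ l₂) *
    (e.k₁ * τ ^ e.k₁) ^ e.δ₁ l₁ * (e.k₂ * τ ^ e.k₂) ^ e.δ₂ l₂

/-- The linear operator whose fixed points solve the homogeneous auxiliary equation. -/
noncomputable def borelOp (τ ε : ℂ) (f : ℝ → ℂ) (m : ℝ) : ℂ :=
  (e.Pm m τ)⁻¹ * ∑ l₁ ∈ Finset.Ico 1 e.D₁, ∑ l₂ ∈ Finset.Ico 1 e.D₂,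
    e.convCoeff l₁ l₂ ε τ * e.conv l₁ l₂ ε f m

variable {e}

theorem Assumptions.exists_convIntegrand_le (he : e.Assumptions) {l₁ l₂ : ℕ}
    (h₁ : l₁ ∈ Finset.Ico 1 e.D₁) (h₂ : l₂ ∈ Finset.Ico 1 e.D₂) :
    ∃ B > 0, ∀ ε ∈ Metric.ball (0 : ℂ) e.ε₀, ∀ (m m₁ A : ℝ) (y : ℂ),
      ‖y‖ ≤ A * weight e.μ e.β m₁ →
      ‖e.C l₁ l₂ (m - m₁) ε * (e.R l₁ l₂).eval (I * m₁) * y‖ ≤ B * A *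
        (weight e.μ e.β (m - m₁) * (weight e.μ e.β m₁ * (1 + |m₁|) ^ (e.R l₁ l₂).natDegree)) := by
  obtain ⟨B, hB, hC⟩ := he.exists_C_le h₁ h₂
  obtain ⟨a, ha, hR⟩ := exists_norm_eval_le (e.R l₁ l₂)
  refine ⟨B * a, by positivity, fun ε hε m m₁ A y hy => ?_⟩
  have hw := weight_pos e.μ e.β (m - m₁)
  have hA : 0 ≤ A * weight e.μ e.β m₁ := (norm_nonneg _).trans hy
  rw [norm_mul, norm_mul]
  calc _ ≤ (B * weight e.μ e.β (m - m₁)) * (a * (1 + |m₁|) ^ (e.R l₁ l₂).natDegree) *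
        (A * weight e.μ e.β m₁) := by
        gcongr
        · exact hC ε hε _
        · exact hR m₁
    _ = _ := by ring

/-- A bound of the convolution integrand that does not depend on `m`. -/
theorem Assumptions.exists_convIntegrand_le' (he : e.Assumptions) {l₁ l₂ : ℕ}
    (h₁ : l₁ ∈ Finset.Ico 1 e.D₁) (h₂ : l₂ ∈ Finset.Ico 1 e.D₂) :
    ∃ b : ℝ → ℝ, Integrable b ∧ (∀ m, 0 ≤ b m) ∧ ∀ ε ∈ Metric.ball (0 : ℂ) e.ε₀,
      ∀ (m m₁ A : ℝ) (y : ℂ), ‖y‖ ≤ A * weight e.μ e.β m₁ →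
      ‖e.C l₁ l₂ (m - m₁) ε * (e.R l₁ l₂).eval (I * m₁) * y‖ ≤ A * b m₁ := by
  obtain ⟨B, hB, h⟩ := he.exists_convIntegrand_le h₁ h₂
  have hμd := he.μ_gt l₁ h₁ l₂ h₂
  have hμ := he.one_lt_μ
  refine ⟨fun m₁ => B * (1 + |m₁|) ^ (-(e.μ - (e.R l₁ l₂).natDegree)),
    (integrable_one_add_abs_rpow (by linarith)).const_mul B, fun m => by positivity,
    fun ε hε m m₁ A y hy => ?_⟩
  have hA : 0 ≤ A :=
    nonneg_of_mul_nonneg_left ((norm_nonneg _).trans hy) (weight_pos e.μ e.β m₁)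
  refine (h ε hε m m₁ A y hy).trans ?_
  rw [mul_comm B A, mul_assoc]
  have h1 := weight_mul_pow_le (μ := e.μ) he.β_pos.le (e.R l₁ l₂).natDegree m₁
  have h2 := weight_le_one (μ := e.μ) (by linarith) he.β_pos.le (m - m₁)
  have h3 := weight_pos e.μ e.β m₁
  refine mul_le_mul_of_nonneg_left (mul_le_mul_of_nonneg_left ?_ hB.le) hA
  exact (mul_le_of_le_one_left (by positivity) h2).trans h1

/-- `weight_mul_weight_le` loses a factor `(1 + |m|)^d` with `d = deg R_{ℓ₁ℓ₂}`. Since `d ≤ deg R_D`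
and `R_D` has no zero on the imaginary axis, that factor is at most a multiple of `|R_D(im)|`, which
division by `P_m` removes. -/
theorem Assumptions.exists_conv_le (he : e.Assumptions) {l₁ l₂ : ℕ}
    (h₁ : l₁ ∈ Finset.Ico 1 e.D₁) (h₂ : l₂ ∈ Finset.Ico 1 e.D₂) :
    ∃ K > 0, ∀ ε ∈ Metric.ball (0 : ℂ) e.ε₀, ∀ (A : ℝ) (f : ℝ → ℂ),
      (∀ m, ‖f m‖ ≤ A * weight e.μ e.β m) → ∀ m,
      ‖e.conv l₁ l₂ ε f m‖ ≤ K * A * (‖e.RD.eval (I * m)‖ * weight e.μ e.β m) := by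
  obtain ⟨B, hB, h⟩ := he.exists_convIntegrand_le h₁ h₂
  obtain ⟨a, ha, hRD⟩ := exists_le_norm_eval e.RD he.RD_ne_zero
  have hμd := he.μ_gt l₁ h₁ l₂ h₂
  have hμ := he.one_lt_μ
  set d := (e.R l₁ l₂).natDegree with hd
  have i1 := integrable_one_add_abs_rpow hμ
  have i2 : Integrable fun m : ℝ => (1 + |m|) ^ (-(e.μ - d)) :=
    integrable_one_add_abs_rpow (by linarith)
  set J : ℝ := 2 ^ e.μ * ((∫ m : ℝ, (1 + |m|) ^ (-e.μ)) + ∫ m : ℝ, (1 + |m|) ^ (-(e.μ - d)))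
    with hJ
  have hJ0 : 0 ≤ J := by
    have : 0 ≤ ∫ m : ℝ, (1 + |m|) ^ (-e.μ) := integral_nonneg fun m => by positivity
    have : 0 ≤ ∫ m : ℝ, (1 + |m|) ^ (-(e.μ - d)) := integral_nonneg fun m => by positivity
    positivity
  set s : ℝ := (Real.sqrt (2 * Real.pi))⁻¹ with hs
  have hs0 : 0 ≤ s := by positivity
  -- The summand `1` only makes the constant positive, `J` being known merely to be nonnegative.
  refine ⟨s * (B * a⁻¹ * J) + 1, by positivity, fun ε hε A f hf m => ?_⟩
  have hA : 0 ≤ A :=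
    nonneg_of_mul_nonneg_left ((norm_nonneg _).trans (hf 0)) (weight_pos e.μ e.β 0)
  have hw := weight_pos e.μ e.β m
  have hle : ‖∫ m₁ : ℝ, e.C l₁ l₂ (m - m₁) ε * (e.R l₁ l₂).eval (I * m₁) * f m₁‖ ≤
      B * A * (weight e.μ e.β m * (1 + |m|) ^ d) * J := by
    have hi : Integrable fun m₁ : ℝ => B * A * (weight e.μ e.β m * (1 + |m|) ^ d *
        (2 ^ e.μ * ((1 + |m - m₁|) ^ (-e.μ) + (1 + |m₁|) ^ (-(e.μ - d))))) :=
      (((((i1.comp_sub_left m).add i2).const_mul _)).const_mul _).const_mul _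
    refine (norm_integral_le_of_norm_le hi (Eventually.of_forall fun m₁ => ?_)).trans
      (le_of_eq ?_)
    · refine (h ε hε m m₁ A _ (hf m₁)).trans ?_
      exact mul_le_mul_of_nonneg_left
        (weight_mul_weight_le (d := d) he.β_pos.le (by linarith) m m₁) (by positivity)
    · rw [integral_const_mul, integral_const_mul, integral_const_mul,
        integral_add (i1.comp_sub_left m) i2,
        integral_sub_left_eq_self (fun x : ℝ => (1 + |x|) ^ (-e.μ)) volume m, hJ]
      ring
  have hpow : (1 + |m|) ^ d ≤ a⁻¹ * ‖e.RD.eval (I * m)‖ := by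
    rw [le_inv_mul_iff₀ ha]
    refine le_trans ?_ (hRD m)
    gcongr
    · linarith [abs_nonneg m]
    · exact he.natDegree_le l₁ h₁ l₂ h₂
  rw [conv, norm_mul, norm_real, Real.norm_of_nonneg hs0]
  calc _ ≤ s * (B * A * (weight e.μ e.β m * (a⁻¹ * ‖e.RD.eval (I * m)‖)) * J) := by
        gcongr
        refine hle.trans ?_
        gcongr
    _ = s * (B * a⁻¹ * J) * A * (‖e.RD.eval (I * m)‖ * weight e.μ e.β m) := by ring
    _ ≤ _ := by gcongr; linarith

/-- The total degree in `τ` of the leading term. -/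
def leadDegree (e : Equation) : ℕ := e.k₁ * e.δ₁ e.D₁ + e.k₂ * e.δ₂ e.D₂

/-- As a polynomial in `τ`, `P_m` is a binomial of degree `leadDegree` with leading coefficient a
fixed multiple of `-R_D(im)`. At points of `goodSet` each linear factor is at least `𝔪 (1 + |τ|)`.
-/
theorem Assumptions.exists_le_norm_Pm (he : e.Assumptions) {𝔪 : ℝ} (h𝔪 : 0 < 𝔪) :
    ∃ a > 0, ∀ τ ∈ e.goodSet 𝔪, ∀ m : ℝ,
      a * ‖e.RD.eval (I * m)‖ * (1 + ‖τ‖) ^ e.leadDegree ≤ ‖e.Pm m τ‖ := by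
  set A : ℝ := (e.k₁ : ℝ) ^ e.δ₁ e.D₁ * (e.k₂ : ℝ) ^ e.δ₂ e.D₂ with hA
  have hA0 : 0 < A := by
    have h1 : (0 : ℝ) < e.k₁ := by exact_mod_cast he.k₁_pos
    have h2 : (0 : ℝ) < e.k₂ := by exact_mod_cast he.k₂_pos
    positivity
  refine ⟨A * 𝔪 ^ e.leadDegree, by positivity, fun τ hτ m => ?_⟩
  set q : ℂ := -((A : ℂ) * e.RD.eval (I * m)) with hq
  have hq0 : q ≠ 0 := neg_ne_zero.2 (mul_ne_zero (by exact_mod_cast hA0.ne') (he.RD_ne_zero m))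
  set p : ℂ[X] := Polynomial.C q * X ^ e.leadDegree + Polynomial.C (e.Q.eval (I * m)) with hp
  have heval : ∀ x, p.eval x = e.Pm m x := by
    intro x
    simp only [hp, eval_add, eval_mul, eval_C, eval_pow, eval_X, Pm, hq, hA, leadDegree]
    push_cast
    ring
  -- A positive degree keeps the constant `Q(im)` out of the leading coefficient.
  have hN : 0 < e.leadDegree := he.leading_pos
  have hdeg : p.natDegree = e.leadDegree := by
    rw [hp, natDegree_add_C, natDegree_C_mul_X_pow _ _ hq0]
  have hlead : p.leadingCoeff = q := by
    rw [leadingCoeff, hdeg, hp]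
    simp [coeff_C, hN.ne']
  have hp0 : p ≠ 0 := by
    intro h; rw [h] at hdeg; simp at hdeg; omega
  have := leadingCoeff_mul_pow_le_norm_eval p hp0 (τ := τ) (c := 𝔪 * (1 + ‖τ‖)) (by positivity)
    (fun x hx => hτ m x (by rw [← heval]; exact hx))
  rw [heval, hlead, hdeg, hq, norm_neg, norm_mul, norm_real, Real.norm_of_nonneg hA0.le] at this
  refine le_trans (le_of_eq ?_) this
  rw [mul_pow]; ring

theorem Assumptions.Pm_ne_zero (he : e.Assumptions) {𝔪 : ℝ} (h𝔪 : 0 < 𝔪) {τ : ℂ}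
    (hτ : τ ∈ e.goodSet 𝔪) (m : ℝ) : e.Pm m τ ≠ 0 := by
  obtain ⟨a, ha, h⟩ := he.exists_le_norm_Pm h𝔪
  refine norm_pos_iff.1 (lt_of_lt_of_le ?_ (h τ hτ m))
  have := norm_pos_iff.2 (he.RD_ne_zero m)
  positivity

theorem Assumptions.exists_norm_Pm_inv_le (he : e.Assumptions) {𝔪 : ℝ} (h𝔪 : 0 < 𝔪) :
    ∃ K > 0, ∀ τ ∈ e.goodSet 𝔪, ∀ m : ℝ, ‖(e.Pm m τ)⁻¹‖ ≤ K := by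
  obtain ⟨a, ha, h⟩ := he.exists_le_norm_Pm h𝔪
  obtain ⟨b, hb, hRD⟩ := exists_le_norm_eval e.RD he.RD_ne_zero
  refine ⟨(a * b)⁻¹, by positivity, fun τ hτ m => ?_⟩
  rw [norm_inv]
  refine inv_anti₀ (by positivity) (le_trans ?_ (h τ hτ m))
  have h1 : 1 ≤ (1 + |m|) ^ e.RD.natDegree := one_le_pow₀ (by linarith [abs_nonneg m])
  have h2 : 1 ≤ (1 + ‖τ‖) ^ e.leadDegree := one_le_pow₀ (by linarith [norm_nonneg τ])
  have h3 : b ≤ ‖e.RD.eval (I * m)‖ := le_trans (le_mul_of_one_le_right hb.le h1) (hRD m)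
  calc a * b ≤ a * ‖e.RD.eval (I * m)‖ := by gcongr
    _ ≤ _ := le_mul_of_one_le_right (by positivity) h2

/-- The strict inequality for the integers `Δ` leaves at least one power of `ε`, the source of the
contraction; the inequality for the `δ` keeps the degree in `τ` below that of `P_m`. -/
theorem Assumptions.norm_convCoeff_le (he : e.Assumptions) {l₁ l₂ : ℕ}
    (h₁ : l₁ ∈ Finset.Ico 1 e.D₁) (h₂ : l₂ ∈ Finset.Ico 1 e.D₂) {ε : ℂ} (hε : ‖ε‖ ≤ 1) (τ : ℂ) :
    ‖e.convCoeff l₁ l₂ ε τ‖ ≤ ‖ε‖ * ((e.k₁ : ℝ) ^ e.δ₁ l₁ * (e.k₂ : ℝ) ^ e.δ₂ l₂) *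
      (1 + ‖τ‖) ^ e.leadDegree := by
  have hΔ := he.Δ_lower l₁ h₁ l₂ h₂
  have hδ := he.δ_lower l₁ h₁ l₂ h₂
  have hε' : ‖ε‖ ^ (e.Δ l₁ l₂ - e.lam₁ * e.k₁ * e.δ₁ l₁ - e.lam₂ * e.k₂ * e.δ₂ l₂) ≤ ‖ε‖ :=
    pow_le_of_le_one (norm_nonneg _) hε (by omega)
  have hτ : ‖τ‖ ^ (e.k₁ * e.δ₁ l₁ + e.k₂ * e.δ₂ l₂) ≤ (1 + ‖τ‖) ^ e.leadDegree := by
    calc ‖τ‖ ^ (e.k₁ * e.δ₁ l₁ + e.k₂ * e.δ₂ l₂)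
        ≤ (1 + ‖τ‖) ^ (e.k₁ * e.δ₁ l₁ + e.k₂ * e.δ₂ l₂) := by gcongr; linarith
      _ ≤ _ := pow_le_pow_right₀ (by linarith [norm_nonneg τ]) hδ
  rw [convCoeff]
  simp only [norm_mul, norm_pow, norm_natCast]
  calc _ = ‖ε‖ ^ (e.Δ l₁ l₂ - e.lam₁ * e.k₁ * e.δ₁ l₁ - e.lam₂ * e.k₂ * e.δ₂ l₂) *
        ((e.k₁ : ℝ) ^ e.δ₁ l₁ * (e.k₂ : ℝ) ^ e.δ₂ l₂) *
        ‖τ‖ ^ (e.k₁ * e.δ₁ l₁ + e.k₂ * e.δ₂ l₂) := by ring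
    _ ≤ _ := by gcongr

/-- For small `ε` the operator `borelOp` is a contraction. -/
theorem Assumptions.exists_contraction (he : e.Assumptions) {𝔪 : ℝ} (h𝔪 : 0 < 𝔪) :
    ∃ ε₁ > 0, ε₁ ≤ e.ε₀ ∧ ∀ τ ∈ e.goodSet 𝔪, ∀ ε ∈ Metric.ball (0 : ℂ) ε₁,
      ∀ (A : ℝ) (f : ℝ → ℂ), (∀ m, ‖f m‖ ≤ A * weight e.μ e.β m) →
        ∀ m, ‖e.borelOp τ ε f m‖ ≤ A / 2 * weight e.μ e.β m := by
  obtain ⟨a, ha, hP⟩ := he.exists_le_norm_Pm h𝔪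
  -- Outside the index range `K = 0`, so that `choose` yields a function on all pairs.
  have hK : ∀ l₁ l₂ : ℕ, ∃ K : ℝ, 0 ≤ K ∧ (l₁ ∈ Finset.Ico 1 e.D₁ → l₂ ∈ Finset.Ico 1 e.D₂ →
      ∀ ε ∈ Metric.ball (0 : ℂ) e.ε₀, ∀ (A : ℝ) (f : ℝ → ℂ),
      (∀ m, ‖f m‖ ≤ A * weight e.μ e.β m) → ∀ m,
      ‖e.conv l₁ l₂ ε f m‖ ≤ K * A * (‖e.RD.eval (I * m)‖ * weight e.μ e.β m)) := by
    intro l₁ l₂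
    by_cases h : l₁ ∈ Finset.Ico 1 e.D₁ ∧ l₂ ∈ Finset.Ico 1 e.D₂
    · obtain ⟨K, hK, h'⟩ := he.exists_conv_le h.1 h.2
      exact ⟨K, hK.le, fun _ _ => h'⟩
    · exact ⟨0, le_rfl, fun h₁ h₂ => absurd ⟨h₁, h₂⟩ h⟩
  choose K hK0 hK using hK
  set T : ℝ := ∑ l₁ ∈ Finset.Ico 1 e.D₁, ∑ l₂ ∈ Finset.Ico 1 e.D₂,
    ((e.k₁ : ℝ) ^ e.δ₁ l₁ * (e.k₂ : ℝ) ^ e.δ₂ l₂) * K l₁ l₂ with hT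
  have hT0 : 0 ≤ T := Finset.sum_nonneg fun l₁ _ => Finset.sum_nonneg fun l₂ _ =>
    mul_nonneg (by positivity) (hK0 l₁ l₂)
  have hε₀ := he.ε₀_pos
  -- The operator has norm at most `T |ε| / a`, which this choice makes at most `1/2`; `T + 1`
  -- avoids dividing by zero, and the bound `1` lets higher powers of `ε` be replaced by the first.
  refine ⟨min e.ε₀ (min 1 (a / (2 * (T + 1)))), by positivity, min_le_left _ _, ?_⟩
  intro τ hτ ε hε A f hf m
  rw [mem_ball_zero_iff, lt_min_iff, lt_min_iff] at hε
  obtain ⟨hε0, hε1, hεT⟩ := hε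
  have hA : 0 ≤ A :=
    nonneg_of_mul_nonneg_left ((norm_nonneg _).trans (hf 0)) (weight_pos e.μ e.β 0)
  have hw := weight_pos e.μ e.β m
  have hRD := norm_pos_iff.2 (he.RD_ne_zero m)
  set X : ℝ := ‖e.RD.eval (I * m)‖ * (1 + ‖τ‖) ^ e.leadDegree with hX
  have hX0 : 0 < X := by positivity
  have hsum : ‖∑ l₁ ∈ Finset.Ico 1 e.D₁, ∑ l₂ ∈ Finset.Ico 1 e.D₂,
      e.convCoeff l₁ l₂ ε τ * e.conv l₁ l₂ ε f m‖ ≤ T * (‖ε‖ * A * weight e.μ e.β m * X) := by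
    rw [hT, Finset.sum_mul]
    refine norm_sum_le_of_le _ fun l₁ h₁ => ?_
    rw [Finset.sum_mul]
    refine norm_sum_le_of_le _ fun l₂ h₂ => ?_
    rw [norm_mul]
    calc _ ≤ (‖ε‖ * ((e.k₁ : ℝ) ^ e.δ₁ l₁ * (e.k₂ : ℝ) ^ e.δ₂ l₂) * (1 + ‖τ‖) ^ e.leadDegree) *
          (K l₁ l₂ * A * (‖e.RD.eval (I * m)‖ * weight e.μ e.β m)) := by
          gcongr
          · exact he.norm_convCoeff_le h₁ h₂ hε1.le τ
          · exact hK l₁ l₂ h₁ h₂ ε (by simpa using hε0) A f hf m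
      _ = _ := by rw [hX]; ring
  have hPX : a * X ≤ ‖e.Pm m τ‖ := by
    have := hP τ hτ m
    rwa [mul_assoc] at this
  rw [borelOp, norm_mul, norm_inv, inv_mul_le_iff₀ (lt_of_lt_of_le (by positivity) hPX)]
  refine hsum.trans ?_
  have hTe : T * ‖ε‖ ≤ a / 2 := by
    rw [lt_div_iff₀ (by positivity)] at hεT
    nlinarith [norm_nonneg ε]
  calc T * (‖ε‖ * A * weight e.μ e.β m * X) = (T * ‖ε‖) * (A * weight e.μ e.β m * X) := by ring
    _ ≤ (a / 2) * (A * weight e.μ e.β m * X) := by gcongr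
    _ = (a * X) * (A / 2 * weight e.μ e.β m) := by ring
    _ ≤ _ := by gcongr

end Equation

end OuterPDE

namespace OuterPDE.Equation

variable {e : Equation}

/-! ### The auxiliary equation -/

/-- Regularity and growth of a function `w(τ, m, ε)` on the set of points that keep away from the
roots of the `P_m`. -/
structure IsRegular (e : Equation) (𝔪 ε₁ M : ℝ) (w : ℂ → ℝ → ℂ → ℂ) : Prop where
  cont : ∀ ε ∈ Metric.ball (0 : ℂ) ε₁,
    ContinuousOn (fun p : ℂ × ℝ => w p.1 p.2 ε) (e.goodSet 𝔪 ×ˢ univ)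
  holo : ∀ m : ℝ, ∀ ε ∈ Metric.ball (0 : ℂ) ε₁,
    DifferentiableOn ℂ (fun τ => w τ m ε) (interior (e.goodSet 𝔪))
  holo_param : ∀ τ ∈ e.goodSet 𝔪, ∀ m : ℝ, DifferentiableOn ℂ (w τ m) (Metric.ball (0 : ℂ) ε₁)
  bound : ∀ τ ∈ e.goodSet 𝔪, ∀ m : ℝ, ∀ ε ∈ Metric.ball (0 : ℂ) ε₁,
    ‖w τ m ε‖ ≤ M * e.growth ‖τ‖ * weight e.μ e.β m

theorem continuous_Pm : Continuous fun p : ℂ × ℝ => e.Pm p.2 p.1 := by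
  unfold Pm
  have h : ∀ p : ℂ[X], Continuous fun x : ℂ × ℝ => p.eval (I * x.2) := fun p =>
    p.continuous.comp (by fun_prop)
  have := h e.Q
  have := h e.RD
  fun_prop

theorem differentiable_Pm (m : ℝ) : Differentiable ℂ (e.Pm m) := by
  unfold Pm; fun_prop

/-- This is the start of the Neumann series. Joint continuity of `ψ` in `(τ, m)` is not assumed but
follows from entireness in `τ` and the growth bound. -/
theorem Assumptions.isRegular_forcing (he : e.Assumptions) {𝔪 : ℝ} (h𝔪 : 0 < 𝔪) {ε₁ K Cψ : ℝ}
    (hε₁ : ε₁ ≤ e.ε₀) (hK : ∀ τ ∈ e.goodSet 𝔪, ∀ m : ℝ, ‖(e.Pm m τ)⁻¹‖ ≤ K)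
    {ψ : ℂ → ℝ → ℂ → ℂ} (hψ : e.IsForcingKernel ψ Cψ) :
    e.IsRegular 𝔪 ε₁ (K * Cψ) fun τ m ε => (e.Pm m τ)⁻¹ * ψ τ m ε := by
  have hsub : Metric.ball (0 : ℂ) ε₁ ⊆ Metric.ball 0 e.ε₀ := Metric.ball_subset_ball hε₁
  have hb : ∀ τ : ℂ, ∀ m : ℝ, ∀ ε ∈ Metric.ball (0 : ℂ) e.ε₀,
      ‖ψ τ m ε‖ ≤ Cψ * e.growth ‖τ‖ * weight e.μ e.β m := by
    intro τ m ε hε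
    refine (hψ.bound τ m ε hε).trans (le_of_eq ?_)
    rw [weight, growth, Real.exp_neg, mul_inv]
    ring
  constructor
  · intro ε hε
    refine ContinuousOn.mul ?_ ?_
    · exact continuous_Pm.continuousOn.inv₀ fun p hp => he.Pm_ne_zero h𝔪 hp.1 p.2
    · refine (continuous_of_entire_of_bound (f := fun τ m => ψ τ m ε)
        (g := fun r => Cψ * e.growth r) ?_ (fun m => hψ.entire m ε (hsub hε))
        (fun τ => hψ.cont τ ε (hsub hε)) fun τ m => ?_).continuousOn
      · exact fun a ha b hb hab =>
          mul_le_mul_of_nonneg_left (monotoneOn_growth he ha hb hab) hψ.const_pos.le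
      · refine (hb τ m ε (hsub hε)).trans (mul_le_of_le_one_right ?_ ?_)
        · exact mul_nonneg hψ.const_pos.le (e.growth_nonneg (norm_nonneg _))
        · exact weight_le_one (by linarith [he.one_lt_μ]) he.β_pos.le m
  · intro m ε hε
    refine DifferentiableOn.mul ?_ (hψ.entire m ε (hsub hε)).differentiableOn
    exact (differentiable_Pm m).differentiableOn.inv fun τ hτ =>
      he.Pm_ne_zero h𝔪 (interior_subset hτ) m
  · intro τ _ m
    exact ((hψ.holo τ m).mono hsub).const_mul _
  · intro τ hτ m ε hε
    rw [norm_mul, mul_assoc K, mul_assoc K]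
    have := hK τ hτ m
    have := hb τ m ε (hsub hε)
    gcongr
    exact (norm_nonneg _).trans (hK τ hτ m)

/-- The convolution with `C_{ℓ₁ℓ₂}` preserves regularity. -/
theorem IsRegular.conv_aux (he : e.Assumptions) {𝔪 ε₁ M : ℝ} (hε₁ : ε₁ ≤ e.ε₀)
    {w : ℂ → ℝ → ℂ → ℂ} (hw : e.IsRegular 𝔪 ε₁ M w) {l₁ l₂ : ℕ} (h₁ : l₁ ∈ Finset.Ico 1 e.D₁)
    (h₂ : l₂ ∈ Finset.Ico 1 e.D₂) :
    (∀ ε ∈ Metric.ball (0 : ℂ) ε₁, ContinuousOn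
      (fun p : ℂ × ℝ => e.conv l₁ l₂ ε (fun m => w p.1 m ε) p.2) (e.goodSet 𝔪 ×ˢ univ)) ∧
    (∀ m : ℝ, ∀ ε ∈ Metric.ball (0 : ℂ) ε₁, DifferentiableOn ℂ
      (fun τ => e.conv l₁ l₂ ε (fun m => w τ m ε) m) (interior (e.goodSet 𝔪))) ∧
    (∀ τ ∈ e.goodSet 𝔪, ∀ m : ℝ, DifferentiableOn ℂ
      (fun ε => e.conv l₁ l₂ ε (fun m => w τ m ε) m) (Metric.ball (0 : ℂ) ε₁)) := by
  have hsub : Metric.ball (0 : ℂ) ε₁ ⊆ Metric.ball 0 e.ε₀ := Metric.ball_subset_ball hε₁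
  obtain ⟨b, hbi, hb0, hb⟩ := he.exists_convIntegrand_le' h₁ h₂
  have hcw : ∀ ε ∈ Metric.ball (0 : ℂ) ε₁, ∀ τ ∈ e.goodSet 𝔪, Continuous fun m => w τ m ε :=
    fun ε hε τ hτ => (hw.cont ε hε).comp_continuous (f := fun m : ℝ => (τ, m)) (by fun_prop)
      fun m => ⟨hτ, mem_univ _⟩
  have hRc : Continuous fun m₁ : ℝ => (e.R l₁ l₂).eval (I * m₁) :=
    (e.R l₁ l₂).continuous.comp (by fun_prop)
  have hmeas : ∀ ε ∈ Metric.ball (0 : ℂ) ε₁, ∀ τ ∈ e.goodSet 𝔪, ∀ m : ℝ, Continuous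
      fun m₁ : ℝ => e.C l₁ l₂ (m - m₁) ε * (e.R l₁ l₂).eval (I * m₁) * w τ m₁ ε := by
    intro ε hε τ hτ m
    exact (((he.C_cont l₁ h₁ l₂ h₂ ε (hsub hε)).comp (continuous_sub_left m)).mul hRc).mul
      (hcw ε hε τ hτ)
  -- The growth in `τ` is unbounded but monotone, so domination is uniform only on bounded sets;
  -- below it is used on unit balls around the point considered.
  have hbw : ∀ ε ∈ Metric.ball (0 : ℂ) ε₁, ∀ τ ∈ e.goodSet 𝔪, ∀ m m₁ r : ℝ, ‖τ‖ ≤ r →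
      ‖e.C l₁ l₂ (m - m₁) ε * (e.R l₁ l₂).eval (I * m₁) * w τ m₁ ε‖ ≤
        |M| * e.growth r * b m₁ := by
    intro ε hε τ hτ m m₁ r hr
    refine hb ε (hsub hε) m m₁ _ _ ((hw.bound τ hτ m₁ ε hε).trans ?_)
    have := weight_pos e.μ e.β m₁
    have h2 : e.growth ‖τ‖ ≤ e.growth r :=
      monotoneOn_growth he (norm_nonneg τ) ((norm_nonneg τ).trans hr) hr
    have := e.growth_nonneg (norm_nonneg τ)
    gcongr
    exact le_abs_self M
  have hnear : ∀ τ₀ : ℂ, ∀ τ ∈ Metric.ball τ₀ 1, ‖τ‖ ≤ ‖τ₀‖ + 1 := by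
    intro τ₀ τ hτ
    rw [Metric.mem_ball, dist_eq_norm] at hτ
    have := norm_add_le τ₀ (τ - τ₀)
    rw [add_sub_cancel] at this
    linarith
  refine ⟨fun ε hε => ?_, fun m ε hε => ?_, fun τ hτ m => ?_⟩
  · refine continuousOn_const.mul ?_
    rintro ⟨τ₀, m₀⟩ ⟨hτ₀, -⟩
    have hev : ∀ᶠ p : ℂ × ℝ in 𝓝[e.goodSet 𝔪 ×ˢ univ] (τ₀, m₀),
        p.1 ∈ e.goodSet 𝔪 ∧ p.1 ∈ Metric.ball τ₀ 1 := by
      refine (eventually_mem_nhdsWithin.mono fun p hp => hp.1).and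
        (mem_nhdsWithin_of_mem_nhds ?_)
      exact continuous_fst.continuousAt.preimage_mem_nhds (Metric.ball_mem_nhds τ₀ one_pos)
    refine continuousWithinAt_of_dominated (bound := fun m₁ => |M| * e.growth (‖τ₀‖ + 1) * b m₁)
      ?_ ?_ (hbi.const_mul _) ?_
    · filter_upwards [hev] with p hp using (hmeas ε hε p.1 hp.1 p.2).aestronglyMeasurable
    · filter_upwards [hev] with p hp
      exact Eventually.of_forall fun m₁ => hbw ε hε p.1 hp.1 p.2 m₁ _ (hnear τ₀ p.1 hp.2)
    · refine Eventually.of_forall fun m₁ => ContinuousWithinAt.mul (ContinuousAt.continuousWithinAt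
        (Continuous.continuousAt ?_)) ?_
      · exact ((he.C_cont l₁ h₁ l₂ h₂ ε (hsub hε)).comp (f := fun p : ℂ × ℝ => p.2 - m₁)
          (by fun_prop)).mul continuous_const
      · have hmap : MapsTo (fun p : ℂ × ℝ => (p.1, m₁)) (e.goodSet 𝔪 ×ˢ univ)
            (e.goodSet 𝔪 ×ˢ univ) := fun p hp => ⟨hp.1, mem_univ _⟩
        exact ((hw.cont ε hε).comp (f := fun p : ℂ × ℝ => (p.1, m₁)) (by fun_prop) hmap)
          (τ₀, m₀) ⟨hτ₀, mem_univ _⟩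
  · refine DifferentiableOn.const_mul (fun τ₀ hτ₀ => ?_) _
    refine (differentiableAt_integral_of_dominated (U := interior (e.goodSet 𝔪) ∩ Metric.ball τ₀ 1)
      (inter_mem (isOpen_interior.mem_nhds hτ₀) (Metric.ball_mem_nhds τ₀ one_pos))
      (b := fun m₁ => |M| * e.growth (‖τ₀‖ + 1) * b m₁)
      (hbi.const_mul _) ?_ ?_ ?_).differentiableWithinAt
    · exact fun τ hτ => (hmeas ε hε τ (interior_subset hτ.1) m).aestronglyMeasurable
    · exact Eventually.of_forall fun m₁ =>
        ((hw.holo m₁ ε hε).mono inter_subset_left).const_mul _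
    · exact Eventually.of_forall fun m₁ τ hτ =>
        hbw ε hε τ (interior_subset hτ.1) m m₁ _ (hnear τ₀ τ hτ.2)
  · refine DifferentiableOn.const_mul ?_ _
    refine differentiableOn_integral_of_dominated Metric.isOpen_ball
      (b := fun m₁ => |M| * e.growth ‖τ‖ * b m₁) (hbi.const_mul _) ?_ ?_ ?_
    · exact fun ε hε => (hmeas ε hε τ hτ m).aestronglyMeasurable
    · exact Eventually.of_forall fun m₁ =>
        (((he.differentiableOn_C h₁ h₂ (m - m₁)).mono hsub).mul_const _).mul
          (hw.holo_param τ hτ m₁)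
    · exact Eventually.of_forall fun m₁ ε hε => hbw ε hε τ hτ m m₁ _ le_rfl

/-- `ε₁` is small enough for `borelOp` to be a contraction. -/
def IsContracting (e : Equation) (𝔪 ε₁ : ℝ) : Prop :=
  ∀ τ ∈ e.goodSet 𝔪, ∀ ε ∈ Metric.ball (0 : ℂ) ε₁,
    ∀ (A : ℝ) (f : ℝ → ℂ), (∀ m, ‖f m‖ ≤ A * weight e.μ e.β m) →
      ∀ m, ‖e.borelOp τ ε f m‖ ≤ A / 2 * weight e.μ e.β m

/-- The halved constant is what makes the iterates summable. -/
theorem IsRegular.borelOp (he : e.Assumptions) {𝔪 ε₁ M : ℝ} (h𝔪 : 0 < 𝔪) (hε₁ : ε₁ ≤ e.ε₀)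
    (hcon : e.IsContracting 𝔪 ε₁) {w : ℂ → ℝ → ℂ → ℂ} (hw : e.IsRegular 𝔪 ε₁ M w) :
    e.IsRegular 𝔪 ε₁ (M / 2) fun τ m ε => e.borelOp τ ε (fun m => w τ m ε) m := by
  constructor
  · intro ε hε
    refine ContinuousOn.mul ?_ ?_
    · exact continuous_Pm.continuousOn.inv₀ fun p hp => he.Pm_ne_zero h𝔪 hp.1 p.2
    · refine continuousOn_finsetSum _ fun l₁ h₁ => continuousOn_finsetSum _ fun l₂ h₂ => ?_
      refine ContinuousOn.mul ?_ ((hw.conv_aux he hε₁ h₁ h₂).1 ε hε)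
      unfold convCoeff
      fun_prop
  · intro m ε hε
    refine DifferentiableOn.mul ?_ ?_
    · exact (differentiable_Pm m).differentiableOn.inv fun τ hτ =>
        he.Pm_ne_zero h𝔪 (interior_subset hτ) m
    · refine DifferentiableOn.fun_sum fun l₁ h₁ => DifferentiableOn.fun_sum fun l₂ h₂ => ?_
      refine DifferentiableOn.mul ?_ ((hw.conv_aux he hε₁ h₁ h₂).2.1 m ε hε)
      unfold convCoeff
      fun_prop
  · intro τ hτ m
    refine DifferentiableOn.const_mul ?_ _
    refine DifferentiableOn.fun_sum fun l₁ h₁ => DifferentiableOn.fun_sum fun l₂ h₂ => ?_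
    refine DifferentiableOn.mul ?_ ((hw.conv_aux he hε₁ h₁ h₂).2.2 τ hτ m)
    unfold convCoeff
    fun_prop
  · intro τ hτ m ε hε
    refine (hcon τ hτ ε hε _ _ (fun m => hw.bound τ hτ m ε hε) m).trans (le_of_eq ?_)
    ring

/-- The terms of the Neumann series of the auxiliary equation. -/
noncomputable def neumannTerm (e : Equation) (ψ : ℂ → ℝ → ℂ → ℂ) : ℕ → ℂ → ℝ → ℂ → ℂ
  | 0 => fun τ m ε => (e.Pm m τ)⁻¹ * ψ τ m ε
  | n + 1 => fun τ m ε => e.borelOp τ ε (fun m => neumannTerm e ψ n τ m ε) m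

/-- The solution of the auxiliary equation. -/
noncomputable def borelSolution (e : Equation) (ψ : ℂ → ℝ → ℂ → ℂ) (τ : ℂ) (m : ℝ) (ε : ℂ) : ℂ :=
  ∑' n, e.neumannTerm ψ n τ m ε

section

variable {𝔪 ε₁ K Cψ : ℝ} {ψ : ℂ → ℝ → ℂ → ℂ}

theorem isRegular_neumannTerm (he : e.Assumptions) (h𝔪 : 0 < 𝔪) (hε₁ : ε₁ ≤ e.ε₀)
    (hcon : e.IsContracting 𝔪 ε₁) (hK : ∀ τ ∈ e.goodSet 𝔪, ∀ m : ℝ, ‖(e.Pm m τ)⁻¹‖ ≤ K)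
    (hψ : e.IsForcingKernel ψ Cψ) (n : ℕ) :
    e.IsRegular 𝔪 ε₁ (K * Cψ / 2 ^ n) (e.neumannTerm ψ n) := by
  induction n with
  | zero =>
    rw [pow_zero, div_one]
    exact he.isRegular_forcing h𝔪 hε₁ hK hψ
  | succ n ih =>
    have := ih.borelOp he h𝔪 hε₁ hcon
    rwa [div_div, ← pow_succ] at this

theorem summable_neumann_const (K : ℝ) : Summable fun n : ℕ => K / 2 ^ n := by
  simpa [div_eq_mul_inv] using (summable_geometric_two.mul_left K)

theorem tsum_neumann_const (K : ℝ) : ∑' n : ℕ, K / 2 ^ n = 2 * K := by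
  have : ∀ n : ℕ, K / 2 ^ n = K * (1 / 2) ^ n := fun n => by simp [div_eq_mul_inv]
  simp_rw [this]
  rw [tsum_mul_left, tsum_geometric_two, mul_comm]

/-- The Neumann terms are dominated by a geometric series, locally uniformly in `τ` and uniformly in
`m` and `ε`, so continuity and holomorphy pass to the sum. The factor `2` is `∑ 2^{-n}`. -/
theorem isRegular_borelSolution (he : e.Assumptions) (h𝔪 : 0 < 𝔪) (hε₁ : ε₁ ≤ e.ε₀)
    (hcon : e.IsContracting 𝔪 ε₁) (hK0 : 0 < K)
    (hK : ∀ τ ∈ e.goodSet 𝔪, ∀ m : ℝ, ‖(e.Pm m τ)⁻¹‖ ≤ K) (hψ : e.IsForcingKernel ψ Cψ) :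
    e.IsRegular 𝔪 ε₁ (2 * (K * Cψ)) (e.borelSolution ψ) := by
  have hreg := isRegular_neumannTerm he h𝔪 hε₁ hcon hK hψ
  have hKC : 0 ≤ K * Cψ := mul_nonneg hK0.le hψ.const_pos.le
  have hb : ∀ n, ∀ τ ∈ e.goodSet 𝔪, ∀ m : ℝ, ∀ ε ∈ Metric.ball (0 : ℂ) ε₁, ∀ r, ‖τ‖ ≤ r →
      ‖e.neumannTerm ψ n τ m ε‖ ≤ (K * Cψ * e.growth r) / 2 ^ n := by
    intro n τ hτ m ε hε r hr
    refine ((hreg n).bound τ hτ m ε hε).trans ?_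
    have h2 : e.growth ‖τ‖ ≤ e.growth r :=
      monotoneOn_growth he (norm_nonneg τ) ((norm_nonneg τ).trans hr) hr
    have h3 := e.growth_nonneg (norm_nonneg τ)
    have h4 := weight_le_one (μ := e.μ) (by linarith [he.one_lt_μ]) he.β_pos.le m
    calc K * Cψ / 2 ^ n * e.growth ‖τ‖ * weight e.μ e.β m
        ≤ K * Cψ / 2 ^ n * e.growth ‖τ‖ := mul_le_of_le_one_right (by positivity) h4
      _ ≤ K * Cψ / 2 ^ n * e.growth r := by gcongr
      _ = _ := by ring
  have hnear : ∀ τ₀ : ℂ, ∀ τ ∈ Metric.ball τ₀ 1, ‖τ‖ ≤ ‖τ₀‖ + 1 := by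
    intro τ₀ τ hτ
    rw [Metric.mem_ball, dist_eq_norm] at hτ
    have := norm_add_le τ₀ (τ - τ₀)
    rw [add_sub_cancel] at this
    linarith
  constructor
  · rintro ε hε ⟨τ₀, m₀⟩ ⟨hτ₀, -⟩
    have hc : ContinuousOn (fun p : ℂ × ℝ => e.borelSolution ψ p.1 p.2 ε)
        (e.goodSet 𝔪 ×ˢ univ ∩ Metric.ball τ₀ 1 ×ˢ univ) :=
      continuousOn_tsum (fun n => ((hreg n).cont ε hε).mono inter_subset_left)
        (summable_neumann_const (K * Cψ * e.growth (‖τ₀‖ + 1)))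
        fun n p hp => hb n p.1 hp.1.1 p.2 ε hε _ (hnear τ₀ p.1 hp.2.1)
    refine (continuousWithinAt_inter ?_).1
      (hc (τ₀, m₀) ⟨⟨hτ₀, mem_univ _⟩, Metric.mem_ball_self one_pos, mem_univ _⟩)
    exact prod_mem_nhds (Metric.ball_mem_nhds _ one_pos) univ_mem
  · intro m ε hε τ₀ hτ₀
    have hd : DifferentiableOn ℂ (fun τ => e.borelSolution ψ τ m ε)
        (interior (e.goodSet 𝔪) ∩ Metric.ball τ₀ 1) :=
      differentiableOn_tsum_of_summable_norm
        (summable_neumann_const (K * Cψ * e.growth (‖τ₀‖ + 1)))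
        (fun n => ((hreg n).holo m ε hε).mono inter_subset_left)
        (isOpen_interior.inter Metric.isOpen_ball)
        fun n τ hτ => hb n τ (interior_subset hτ.1) m ε hε _ (hnear τ₀ τ hτ.2)
    exact (hd.differentiableAt ((isOpen_interior.inter Metric.isOpen_ball).mem_nhds
      ⟨hτ₀, Metric.mem_ball_self one_pos⟩)).differentiableWithinAt
  · intro τ hτ m
    exact differentiableOn_tsum_of_summable_norm (summable_neumann_const (K * Cψ * e.growth ‖τ‖))
      (fun n => (hreg n).holo_param τ hτ m) Metric.isOpen_ball
      fun n ε hε => hb n τ hτ m ε hε _ le_rfl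
  · intro τ hτ m ε hε
    have h := (summable_neumann_const (K * Cψ * e.growth ‖τ‖ * weight e.μ e.β m)).hasSum
    rw [tsum_neumann_const] at h
    refine (tsum_of_norm_bounded h fun n => ((hreg n).bound τ hτ m ε hε).trans
      (le_of_eq (by ring))).trans (le_of_eq (by ring))

theorem Assumptions.integrable_convIntegrand (he : e.Assumptions) {l₁ l₂ : ℕ}
    (h₁ : l₁ ∈ Finset.Ico 1 e.D₁) (h₂ : l₂ ∈ Finset.Ico 1 e.D₂) {ε : ℂ}
    (hε : ε ∈ Metric.ball (0 : ℂ) e.ε₀) {A : ℝ} {f : ℝ → ℂ} (hf : Continuous f)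
    (hfb : ∀ m, ‖f m‖ ≤ A * weight e.μ e.β m) (m : ℝ) :
    Integrable fun m₁ : ℝ => e.C l₁ l₂ (m - m₁) ε * (e.R l₁ l₂).eval (I * m₁) * f m₁ := by
  obtain ⟨b, hbi, hb0, hb⟩ := he.exists_convIntegrand_le' h₁ h₂
  refine (hbi.const_mul A).mono' (Continuous.aestronglyMeasurable ?_)
    (Eventually.of_forall fun m₁ => hb ε hε m m₁ A _ (hfb m₁))
  exact (((he.C_cont l₁ h₁ l₂ h₂ ε hε).comp (continuous_sub_left m)).mul
    ((e.R l₁ l₂).continuous.comp (by fun_prop))).mul hf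

/-- Linearity of the integral operator holds only where the convolution integrals converge, hence
the weight bounds. -/
theorem Assumptions.borelOp_sub (he : e.Assumptions) {τ ε : ℂ}
    (hε : ε ∈ Metric.ball (0 : ℂ) e.ε₀) {A B : ℝ} {f g : ℝ → ℂ} (hf : Continuous f)
    (hg : Continuous g) (hfb : ∀ m, ‖f m‖ ≤ A * weight e.μ e.β m)
    (hgb : ∀ m, ‖g m‖ ≤ B * weight e.μ e.β m) (m : ℝ) :
    e.borelOp τ ε (f - g) m = e.borelOp τ ε f m - e.borelOp τ ε g m := by
  simp only [borelOp]
  rw [← mul_sub, ← Finset.sum_sub_distrib]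
  congr 1
  refine Finset.sum_congr rfl fun l₁ h₁ => ?_
  rw [← Finset.sum_sub_distrib]
  refine Finset.sum_congr rfl fun l₂ h₂ => ?_
  rw [← mul_sub]
  congr 1
  simp only [conv]
  rw [← mul_sub, ← integral_sub (he.integrable_convIntegrand h₁ h₂ hε hf hfb m)
    (he.integrable_convIntegrand h₁ h₂ hε hg hgb m)]
  congr 2
  ext m₁
  simp only [Pi.sub_apply]
  ring

/-- A fixed point of a contraction vanishes. -/
theorem eq_zero_of_borelOp_eq (hcon : e.IsContracting 𝔪 ε₁) {τ ε : ℂ} (hτ : τ ∈ e.goodSet 𝔪)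
    (hε : ε ∈ Metric.ball (0 : ℂ) ε₁) {A : ℝ} {f : ℝ → ℂ}
    (hfb : ∀ m, ‖f m‖ ≤ A * weight e.μ e.β m) (hfix : ∀ m, e.borelOp τ ε f m = f m) (m : ℝ) :
    f m = 0 := by
  have h : ∀ n : ℕ, ∀ m, ‖f m‖ ≤ A / 2 ^ n * weight e.μ e.β m := by
    intro n
    induction n with
    | zero => simpa using hfb
    | succ n ih =>
      intro m
      have := hcon τ hτ ε hε _ f ih m
      rwa [hfix, div_div, ← pow_succ] at this
  have hlim : Tendsto (fun n : ℕ => A / 2 ^ n * weight e.μ e.β m) atTop (𝓝 0) := by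
    simpa using (summable_neumann_const A).tendsto_atTop_zero.mul_const (weight e.μ e.β m)
  exact norm_le_zero_iff.1 (ge_of_tendsto hlim (Eventually.of_forall fun n => h n m))

/-- Geometric decay allows the sum to be exchanged with the convolution integral, so the operator
shifts the series by one term and only the zeroth term is left over. -/
theorem borelOp_borelSolution (he : e.Assumptions) (h𝔪 : 0 < 𝔪) (hε₁ : ε₁ ≤ e.ε₀)
    (hcon : e.IsContracting 𝔪 ε₁) (hK : ∀ τ ∈ e.goodSet 𝔪, ∀ m : ℝ, ‖(e.Pm m τ)⁻¹‖ ≤ K)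
    (hψ : e.IsForcingKernel ψ Cψ) {τ ε : ℂ} (hτ : τ ∈ e.goodSet 𝔪)
    (hε : ε ∈ Metric.ball (0 : ℂ) ε₁) (m : ℝ) :
    e.borelSolution ψ τ m ε = (e.Pm m τ)⁻¹ * ψ τ m ε +
      e.borelOp τ ε (fun m => e.borelSolution ψ τ m ε) m := by
  have hreg := isRegular_neumannTerm he h𝔪 hε₁ hcon hK hψ
  have hε' : ε ∈ Metric.ball (0 : ℂ) e.ε₀ := Metric.ball_subset_ball hε₁ hε
  set A : ℝ := K * Cψ * e.growth ‖τ‖ with hA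
  have hb : ∀ n m, ‖e.neumannTerm ψ n τ m ε‖ ≤ A / 2 ^ n * weight e.μ e.β m := fun n m =>
    ((hreg n).bound τ hτ m ε hε).trans (le_of_eq (by rw [hA]; ring))
  have hc : ∀ n, Continuous fun m => e.neumannTerm ψ n τ m ε := fun n =>
    ((hreg n).cont ε hε).comp_continuous (f := fun m : ℝ => (τ, m)) (by fun_prop)
      fun m => ⟨hτ, mem_univ _⟩
  have hsum : Summable fun n => e.neumannTerm ψ n τ m ε :=
    Summable.of_norm_bounded ((summable_neumann_const A).mul_right (weight e.μ e.β m))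
      fun n => hb n m
  have hconv : ∀ l₁ ∈ Finset.Ico 1 e.D₁, ∀ l₂ ∈ Finset.Ico 1 e.D₂,
      HasSum (fun n => e.conv l₁ l₂ ε (fun m => e.neumannTerm ψ n τ m ε) m)
        (e.conv l₁ l₂ ε (fun m => e.borelSolution ψ τ m ε) m) := by
    intro l₁ h₁ l₂ h₂
    obtain ⟨b, hbi, hb0, hb'⟩ := he.exists_convIntegrand_le' h₁ h₂
    refine HasSum.mul_left _ ?_
    have h := hasSum_integral_of_summable_integral_norm (μ := volume)
      (F := fun n (m₁ : ℝ) => e.C l₁ l₂ (m - m₁) ε * (e.R l₁ l₂).eval (I * m₁) *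
        e.neumannTerm ψ n τ m₁ ε)
      (fun n => he.integrable_convIntegrand h₁ h₂ hε' (hc n) (hb n) m) ?_
    · simpa only [borelSolution, tsum_mul_left] using h
    · refine Summable.of_nonneg_of_le (fun n => integral_nonneg fun _ => norm_nonneg _)
        (fun n => ?_) (summable_neumann_const (A * ∫ m, b m))
      calc _ ≤ ∫ m₁, A / 2 ^ n * b m₁ :=
            integral_mono (he.integrable_convIntegrand h₁ h₂ hε' (hc n) (hb n) m).norm
              (hbi.const_mul _) fun m₁ => hb' ε hε' m m₁ _ _ (hb n m₁)
        _ = _ := by rw [integral_const_mul]; ring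
  have hop : HasSum (fun n => e.neumannTerm ψ (n + 1) τ m ε)
      (e.borelOp τ ε (fun m => e.borelSolution ψ τ m ε) m) :=
    HasSum.mul_left _ (hasSum_sum fun l₁ h₁ => hasSum_sum fun l₂ h₂ =>
      (hconv l₁ h₁ l₂ h₂).mul_left _)
  rw [borelSolution, hsum.tsum_eq_zero_add, hop.tsum_eq]
  rfl

theorem solvesBorel_iff (he : e.Assumptions) (h𝔪 : 0 < 𝔪) {S : Sector} {ρ : ℝ}
    (hS : S.unbounded ∪ Metric.closedBall (0 : ℂ) ρ ⊆ e.goodSet 𝔪) {ε : ℂ} {w : ℂ → ℝ → ℂ} :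
    e.SolvesBorel S ρ ψ ε w ↔ ∀ τ ∈ S.unbounded ∪ Metric.closedBall (0 : ℂ) ρ, ∀ m : ℝ,
      w τ m = (e.Pm m τ)⁻¹ * ψ τ m ε + e.borelOp τ ε (w τ) m := by
  refine forall₂_congr fun τ hτ => forall_congr' fun m => ?_
  have hP := he.Pm_ne_zero h𝔪 (hS hτ) m
  rw [borelOp, ← mul_add, eq_inv_mul_iff_mul_eq₀ hP, add_comm]
  rfl

theorem MemExp.norm_le {S : Sector} {ρ B : ℝ} {w : ℂ → ℝ → ℂ} (hw : e.MemExp S ρ B w) {τ : ℂ}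
    (hτ : τ ∈ S.unbounded ∪ Metric.closedBall (0 : ℂ) ρ) (m : ℝ) :
    ‖w τ m‖ ≤ B * e.growth ‖τ‖ * weight e.μ e.β m := by
  have h := hw.bound τ hτ m
  rw [Real.exp_neg] at h
  rw [weight, ← div_eq_mul_inv, le_div_iff₀ (by positivity), growth]
  calc ‖w τ m‖ * ((1 + |m|) ^ e.μ * Real.exp (e.β * |m|))
      = ((1 + |m|) ^ e.μ * Real.exp (e.β * |m|) * (Real.exp (e.ν * ‖τ‖ ^ e.k'))⁻¹ * ‖w τ m‖) *
        Real.exp (e.ν * ‖τ‖ ^ e.k') := by field_simp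
    _ ≤ (B * ‖τ‖) * Real.exp (e.ν * ‖τ‖ ^ e.k') := by gcongr
    _ = _ := by ring

/-- The same function is restricted to each `S h ∪ D(0, ρ)`. Uniqueness is checked one `τ` at a
time: the difference of two solutions, as a function of `m`, is a fixed point of the contraction
with a finite weighted bound. -/
theorem isBorelSolution (he : e.Assumptions) (h𝔪 : 0 < 𝔪) (hε₁ : ε₁ ≤ e.ε₀)
    (hcon : e.IsContracting 𝔪 ε₁) (hK0 : 0 < K)
    (hK : ∀ τ ∈ e.goodSet 𝔪, ∀ m : ℝ, ‖(e.Pm m τ)⁻¹‖ ≤ K)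
    (hψ : e.IsForcingKernel ψ Cψ) {ι : ℕ} {S : Fin ι → Sector} {ρ : ℝ} (hρ : 0 < ρ)
    (hS : ∀ h, e.RootSeparated (S h) ρ 𝔪) (hSo : ∀ h, IsOpen (S h).unbounded) :
    e.IsBorelSolution S ρ ψ ε₁ (2 * K * Cψ) fun _ => e.borelSolution ψ := by
  have hreg := isRegular_borelSolution he h𝔪 hε₁ hcon hK0 hK hψ
  have hsub : ∀ h, (S h).unbounded ∪ Metric.closedBall (0 : ℂ) ρ ⊆ e.goodSet 𝔪 :=
    fun h => (hS h).subset_goodSet hρ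
  have hM : ∀ h, ∀ ε ∈ Metric.ball (0 : ℂ) ε₁,
      e.MemExp (S h) ρ (2 * K * Cψ) fun τ m => e.borelSolution ψ τ m ε := by
    intro h ε hε
    refine ⟨(hreg.cont ε hε).mono (prod_mono (hsub h) le_rfl), fun m => ?_, fun τ hτ m => ?_⟩
    · refine (hreg.holo m ε hε).mono (interior_maximal ?_ ((hSo h).union Metric.isOpen_ball))
      exact (union_subset_union_right _ Metric.ball_subset_closedBall).trans (hsub h)
    · have h := hreg.bound τ (hsub h hτ) m ε hε
      rw [weight, ← div_eq_mul_inv, le_div_iff₀ (by positivity), growth] at h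
      rw [Real.exp_neg]
      calc (1 + |m|) ^ e.μ * Real.exp (e.β * |m|) * (Real.exp (e.ν * ‖τ‖ ^ e.k'))⁻¹ *
            ‖e.borelSolution ψ τ m ε‖
          = (‖e.borelSolution ψ τ m ε‖ * ((1 + |m|) ^ e.μ * Real.exp (e.β * |m|))) *
            (Real.exp (e.ν * ‖τ‖ ^ e.k'))⁻¹ := by ring
        _ ≤ (2 * (K * Cψ) * (‖τ‖ * Real.exp (e.ν * ‖τ‖ ^ e.k'))) *
            (Real.exp (e.ν * ‖τ‖ ^ e.k'))⁻¹ := by gcongr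
        _ = _ := by field_simp
  have hsol : ∀ h, ∀ ε ∈ Metric.ball (0 : ℂ) ε₁,
      e.SolvesBorel (S h) ρ ψ ε fun τ m => e.borelSolution ψ τ m ε := fun h ε hε =>
    (solvesBorel_iff he h𝔪 (hsub h)).2 fun τ hτ m =>
      borelOp_borelSolution he h𝔪 hε₁ hcon hK hψ (hsub h hτ) hε m
  refine ⟨hM, hsol, fun h ε hε B' w hw hws τ hτ m => ?_, fun h τ hτ m =>
    hreg.holo_param τ (hsub h hτ) m⟩
  have hε' : ε ∈ Metric.ball (0 : ℂ) e.ε₀ := Metric.ball_subset_ball hε₁ hε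
  have hcw : Continuous (w τ) :=
    hw.cont.comp_continuous (f := fun m : ℝ => (τ, m)) (by fun_prop) fun m => ⟨hτ, mem_univ _⟩
  have hcs : Continuous fun m => e.borelSolution ψ τ m ε :=
    (hM h ε hε).cont.comp_continuous (f := fun m : ℝ => (τ, m)) (by fun_prop)
      fun m => ⟨hτ, mem_univ _⟩
  have hbw := hw.norm_le hτ
  have hbs := (hM h ε hε).norm_le hτ
  have h0 := eq_zero_of_borelOp_eq hcon (hsub h hτ) hε
    (f := w τ - fun m => e.borelSolution ψ τ m ε)
    (A := B' * e.growth ‖τ‖ + 2 * K * Cψ * e.growth ‖τ‖) (fun m => ?_) (fun m => ?_) m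
  · exact sub_eq_zero.1 h0
  · rw [add_mul]
    exact (norm_sub_le _ _).trans (add_le_add (hbw m) (hbs m))
  · rw [he.borelOp_sub hε' hcw hcs hbw hbs, Pi.sub_apply,
      (solvesBorel_iff he h𝔪 (hsub h)).1 hws τ hτ m,
      (solvesBorel_iff he h𝔪 (hsub h)).1 (hsol h ε hε) τ hτ m]
    ring

end

end OuterPDE.Equation

namespace OuterPDE

/-! ### Laplace–Fourier integrals -/

theorem one_add_abs_pow_le (d : ℕ) {a : ℝ} (ha : 0 < a) :
    ∃ B > 0, ∀ m : ℝ, (1 + |m|) ^ d ≤ B * Real.exp (a * |m|) := by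
  refine ⟨d.factorial * Real.exp a / a ^ d, by positivity, fun m => ?_⟩
  have h := Real.pow_div_factorial_le_exp (a * (1 + |m|)) (by positivity) d
  rw [div_le_iff₀ (by positivity), mul_pow, mul_add, mul_one, Real.exp_add] at h
  rw [div_mul_eq_mul_div, le_div_iff₀ (by positivity)]
  linarith

theorem integrable_exp_neg_mul_abs {a : ℝ} (ha : 0 < a) :
    Integrable fun m : ℝ => Real.exp (-(a * |m|)) := by
  obtain ⟨B, hB, h⟩ := one_add_abs_pow_le 2 ha
  refine ((integrable_one_add_abs_rpow (s := 2) (by norm_num)).const_mul B).mono'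
    (by fun_prop) (Eventually.of_forall fun m => ?_)
  have h0 : 0 < 1 + |m| := by positivity
  rw [Real.norm_of_nonneg (Real.exp_pos _).le, Real.exp_neg, Real.rpow_neg h0.le,
    ← div_eq_mul_inv, le_div_iff₀ (by positivity), inv_mul_le_iff₀ (Real.exp_pos _)]
  have := h m
  rw [show (2 : ℝ) = ((2 : ℕ) : ℝ) by norm_num, Real.rpow_natCast]
  linarith

/-- The measure `dm dr` on `ℝ × (0, ∞)`. -/
noncomputable abbrev stripMeasure : Measure (ℝ × ℝ) := volume.prod (volume.restrict (Ioi 0))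

theorem stripMeasure_eq : stripMeasure = (volume : Measure (ℝ × ℝ)).restrict (univ ×ˢ Ioi 0) := by
  rw [stripMeasure, Measure.volume_eq_prod, ← Measure.prod_restrict, Measure.restrict_univ]

theorem ae_stripMeasure : ∀ᵐ p ∂stripMeasure, 0 < p.2 := by
  rw [stripMeasure_eq]
  filter_upwards [ae_restrict_mem (MeasurableSet.univ.prod measurableSet_Ioi)] with p hp using hp.2

theorem aestronglyMeasurable_stripMeasure {f : ℝ × ℝ → ℂ} (hf : ContinuousOn f (univ ×ˢ Ioi 0)) :
    AEStronglyMeasurable f stripMeasure := by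
  rw [stripMeasure_eq]
  exact hf.aestronglyMeasurable (MeasurableSet.univ.prod measurableSet_Ioi)

theorem integrable_stripMeasure_exp {a : ℝ} (ha : 0 < a) :
    Integrable (fun p : ℝ × ℝ => Real.exp (-(a * |p.1|)) * Real.exp (-p.2)) stripMeasure :=
  (integrable_exp_neg_mul_abs ha).mul_prod (integrableOn_exp_neg_Ioi 0)

/-- Functions `G(r, m)` with decay of order `β` in `m` and exponential growth of order `k'` in
`r`. -/
structure IsKernel (β k' : ℝ) (G : ℝ → ℝ → ℂ) : Prop where
  cont : ContinuousOn (fun p : ℝ × ℝ => G p.2 p.1) (univ ×ˢ Ioi 0)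
  bound : ∀ b, 0 ≤ b → b < β → ∃ B A : ℝ, 0 ≤ B ∧ 0 ≤ A ∧ ∀ r m : ℝ, 0 < r →
    ‖G r m‖ ≤ B * Real.exp (-(b * |m|)) * (r * Real.exp (A * r ^ k'))

/-- The integrand of the Laplace–Fourier integral. -/
noncomputable def laplaceIntegrand (k₁ k₂ : ℕ) (G : ℝ → ℝ → ℂ) (s₁ s₂ z : ℂ) (p : ℝ × ℝ) : ℂ :=
  G p.2 p.1 * (p.2 : ℂ)⁻¹ * exp (-((p.2 : ℂ) ^ k₁ * s₁) - (p.2 : ℂ) ^ k₂ * s₂ + I * z * p.1)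

/-- The Laplace–Fourier integral
`(2π)^{-1/2} ∫_ℝ ∫_0^∞ G(r, m) exp(-r^{k₁} s₁ - r^{k₂} s₂ + izm) dr/r dm`. -/
noncomputable def laplace (k₁ k₂ : ℕ) (G : ℝ → ℝ → ℂ) (s₁ s₂ z : ℂ) : ℂ :=
  ((Real.sqrt (2 * Real.pi))⁻¹ : ℝ) * ∫ p, laplaceIntegrand k₁ k₂ G s₁ s₂ z p ∂stripMeasure

theorem norm_exp_laplace_le (k₁ k₂ : ℕ) {r m M c b : ℝ} {s₁ s₂ z : ℂ} (hr : 0 < r)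
    (h₁ : -M ≤ s₁.re) (h₂ : c ≤ s₂.re) (hz : |z.im| ≤ b) :
    ‖exp (-((r : ℂ) ^ k₁ * s₁) - (r : ℂ) ^ k₂ * s₂ + I * z * m)‖ ≤
      Real.exp (M * r ^ k₁ - c * r ^ k₂) * Real.exp (b * |m|) := by
  rw [norm_exp, ← Real.exp_add, Real.exp_le_exp]
  have e1 : ((r : ℂ) ^ k₁ * s₁).re = r ^ k₁ * s₁.re := by
    rw [← ofReal_pow, re_ofReal_mul]
  have e2 : ((r : ℂ) ^ k₂ * s₂).re = r ^ k₂ * s₂.re := by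
    rw [← ofReal_pow, re_ofReal_mul]
  have e3 : (I * z * m).re = -(z.im * m) := by simp
  rw [add_re, sub_re, neg_re, e1, e2, e3]
  have h3 : -(z.im * m) ≤ b * |m| := by
    calc -(z.im * m) ≤ |z.im * m| := neg_le_abs _
      _ = |z.im| * |m| := abs_mul _ _
      _ ≤ _ := by gcongr
  have h4 : r ^ k₁ * (-M) ≤ r ^ k₁ * s₁.re := by gcongr
  have h5 : r ^ k₂ * c ≤ r ^ k₂ * s₂.re := by gcongr
  linarith

section

variable {k₁ k₂ : ℕ} {β k' : ℝ}

/-- The exponents satisfy `1 ≤ k₁ < k' < k₂`. -/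
structure Exponents (k₁ k₂ : ℕ) (k' : ℝ) : Prop where
  one_le : 1 ≤ k₁
  lt₁ : (k₁ : ℝ) < k'
  lt : k' < k₂

theorem Exponents.one_lt (hk : Exponents k₁ k₂ k') : 1 < k' :=
  lt_of_le_of_lt (by exact_mod_cast hk.one_le) hk.lt₁

theorem Exponents.nonneg (hk : Exponents k₁ k₂ k') : 0 ≤ k' := by linarith [hk.one_lt]

theorem Equation.Assumptions.exponents {e : Equation} (he : e.Assumptions) :
    Exponents e.k₁ e.k₂ e.k' := ⟨he.one_le_k₁, he.k₁_lt_k', he.k'_lt_k₂⟩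

/-- `A r^{k'} + M r^{k₁} - c r^{k₂} + r` is bounded above. -/
theorem exists_exponent_le (hk : Exponents k₁ k₂ k') (A M : ℝ) {c : ℝ} (hc : 0 < c) :
    ∃ N : ℝ, 0 ≤ N ∧ ∀ r : ℝ, 0 ≤ r → A * r ^ k' + M * r ^ k₁ - c * r ^ k₂ ≤ N - r := by
  -- A third of `c r^{k₂}` absorbs each of the three lower powers: `k'`, `k₁`, and the linear term,
  -- for which `k₂ > 1`.
  obtain ⟨N₁, h₁, H₁⟩ := exists_mul_rpow_le A (c := c / 3) (by positivity) hk.nonneg hk.lt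
  obtain ⟨N₂, h₂, H₂⟩ := exists_mul_rpow_le M (c := c / 3) (by positivity) (Nat.cast_nonneg k₁)
    (hk.lt₁.trans hk.lt)
  obtain ⟨N₃, h₃, H₃⟩ := exists_mul_rpow_le 1 (c := c / 3) (by positivity) zero_le_one
    (hk.one_lt.trans hk.lt)
  refine ⟨N₁ + N₂ + N₃, by positivity, fun r hr => ?_⟩
  have := H₁ r hr
  have h2 := H₂ r hr
  have h3 := H₃ r hr
  rw [Real.rpow_one] at h3
  rw [Real.rpow_natCast] at this h2 h3
  rw [Real.rpow_natCast] at h2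
  linarith

/-- The dominating function for Laplace–Fourier integrals. -/
theorem exists_laplaceIntegrand_le (hk : Exponents k₁ k₂ k') (A M b' b : ℝ) {c : ℝ} (hc : 0 < c) :
    ∃ N : ℝ, 0 ≤ N ∧ ∀ (B r m : ℝ) (y s₁ s₂ z : ℂ), 0 < r →
      ‖y‖ ≤ B * Real.exp (-(b * |m|)) * (r * Real.exp (A * r ^ k')) →
      -M ≤ s₁.re → c ≤ s₂.re → |z.im| ≤ b' →
      ‖y * (r : ℂ)⁻¹ * exp (-((r : ℂ) ^ k₁ * s₁) - (r : ℂ) ^ k₂ * s₂ + I * z * m)‖ ≤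
        B * N * (Real.exp (-((b - b') * |m|)) * Real.exp (-r)) := by
  obtain ⟨N, hN, H⟩ := exists_exponent_le hk A M hc
  refine ⟨Real.exp N, (Real.exp_pos _).le, fun B r m y s₁ s₂ z hr hy h₁ h₂ hz => ?_⟩
  have hB : 0 ≤ B := by
    have := (norm_nonneg y).trans hy
    rw [mul_assoc] at this
    exact nonneg_of_mul_nonneg_left this (by positivity)
  rw [norm_mul, norm_mul, norm_inv, norm_real, Real.norm_of_nonneg hr.le]
  calc _ ≤ (B * Real.exp (-(b * |m|)) * (r * Real.exp (A * r ^ k'))) * r⁻¹ *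
        (Real.exp (M * r ^ k₁ - c * r ^ k₂) * Real.exp (b' * |m|)) := by
        gcongr
        exact norm_exp_laplace_le k₁ k₂ hr h₁ h₂ hz
    _ = B * (Real.exp (-(b * |m|)) * Real.exp (b' * |m|)) *
        (Real.exp (A * r ^ k') * Real.exp (M * r ^ k₁ - c * r ^ k₂)) := by field_simp
    _ = B * Real.exp (-((b - b') * |m|)) *
        Real.exp (A * r ^ k' + M * r ^ k₁ - c * r ^ k₂) := by
        rw [← Real.exp_add, ← Real.exp_add]; ring_nf
    _ ≤ B * Real.exp (-((b - b') * |m|)) * Real.exp (N - r) := by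
        have := Real.exp_le_exp.2 (H r hr.le)
        gcongr B * Real.exp (-((b - b') * |m|)) * ?_
    _ = _ := by rw [sub_eq_add_neg N, Real.exp_add]; ring

theorem IsKernel.continuousOn_laplaceIntegrand {G : ℝ → ℝ → ℂ} (hG : IsKernel β k' G)
    (s₁ s₂ z : ℂ) : ContinuousOn (laplaceIntegrand k₁ k₂ G s₁ s₂ z) (univ ×ˢ Ioi 0) := by
  refine (hG.cont.mul (ContinuousOn.inv₀ (by fun_prop) fun p hp => ?_)).mul (by fun_prop)
  have : 0 < p.2 := hp.2
  exact_mod_cast this.ne'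

/-- Uniform domination of the integrand by an integrable function. -/
theorem IsKernel.exists_dominating (hk : Exponents k₁ k₂ k') {G : ℝ → ℝ → ℂ} (hG : IsKernel β k' G) (M : ℝ) {b' c : ℝ} (hc : 0 < c)
    (hb'0 : 0 ≤ b') (hb' : b' < β) :
    ∃ g : ℝ × ℝ → ℝ, Integrable g stripMeasure ∧ ∀ s₁ s₂ z : ℂ, ∀ p : ℝ × ℝ, 0 < p.2 →
      -M ≤ s₁.re → c ≤ s₂.re → |z.im| ≤ b' → ‖laplaceIntegrand k₁ k₂ G s₁ s₂ z p‖ ≤ g p := by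
  obtain ⟨b, hb1, hb2⟩ := exists_between hb'
  obtain ⟨B, A, hB, hA, h⟩ := hG.bound b (hb'0.trans hb1.le) hb2
  obtain ⟨N, hN, H⟩ := exists_laplaceIntegrand_le hk A M b' b hc
  refine ⟨_, (integrable_stripMeasure_exp (sub_pos.2 hb1)).const_mul (B * N), ?_⟩
  intro s₁ s₂ z p hp h₁ h₂ hz
  exact H B p.2 p.1 _ s₁ s₂ z hp (h p.2 p.1 hp) h₁ h₂ hz

theorem IsKernel.integrable (hk : Exponents k₁ k₂ k') {G : ℝ → ℝ → ℂ} (hG : IsKernel β k' G) {s₁ s₂ z : ℂ} (hs₂ : 0 < s₂.re)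
    (hz : |z.im| < β) : Integrable (laplaceIntegrand k₁ k₂ G s₁ s₂ z) stripMeasure := by
  obtain ⟨g, hg, H⟩ := hG.exists_dominating hk (-s₁.re) hs₂ (abs_nonneg _) hz
  refine hg.mono' (aestronglyMeasurable_stripMeasure (hG.continuousOn_laplaceIntegrand _ _ _)) ?_
  filter_upwards [ae_stripMeasure] with p hp using H s₁ s₂ z p hp (by simp) le_rfl le_rfl

theorem IsKernel.const_mul {G : ℝ → ℝ → ℂ} (hG : IsKernel β k' G) (a : ℂ) :
    IsKernel β k' fun r m => a * G r m := by
  refine ⟨continuousOn_const.mul hG.cont, fun b hb0 hb => ?_⟩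
  obtain ⟨B, A, hB, hA, h⟩ := hG.bound b hb0 hb
  refine ⟨‖a‖ * B, A, by positivity, hA, fun r m hr => ?_⟩
  rw [norm_mul, mul_assoc, mul_assoc, ← mul_assoc B]
  gcongr
  exact h r m hr

/-- As `k' > 1`, `r^n ≤ n! e^r` is absorbed by an extra `e^{r^{k'}}`. The rate `A` rises by one,
which is harmless because `IsKernel` does not fix it. -/
theorem IsKernel.pow_mul (hk'1 : 1 < k') {G : ℝ → ℝ → ℂ} (hG : IsKernel β k' G) (n : ℕ) :
    IsKernel β k' fun r m => (r : ℂ) ^ n * G r m := by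
  refine ⟨ContinuousOn.mul (by fun_prop) hG.cont, fun b hb0 hb => ?_⟩
  obtain ⟨B, A, hB, hA, h⟩ := hG.bound b hb0 hb
  obtain ⟨N, hN, H⟩ := exists_mul_rpow_le 1 (c := 1) one_pos zero_le_one hk'1
  refine ⟨n.factorial * Real.exp N * B, A + 1, by positivity, by positivity, fun r m hr => ?_⟩
  have h1 : r ^ n ≤ n.factorial * Real.exp r := by
    have := Real.pow_div_factorial_le_exp r hr.le n
    rw [div_le_iff₀ (by positivity)] at this
    linarith
  have h2 : Real.exp r ≤ Real.exp N * Real.exp (r ^ k') := by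
    rw [← Real.exp_add, Real.exp_le_exp]
    have := H r hr.le
    rw [Real.rpow_one] at this
    linarith
  rw [norm_mul, norm_pow, norm_real, Real.norm_of_nonneg hr.le, add_mul, Real.exp_add, one_mul]
  calc r ^ n * ‖G r m‖ ≤ (n.factorial * (Real.exp N * Real.exp (r ^ k'))) *
        (B * Real.exp (-(b * |m|)) * (r * Real.exp (A * r ^ k'))) := by
        gcongr
        · exact h1.trans (by gcongr)
        · exact h r m hr
    _ = _ := by ring

/-- The polynomial in `m` is absorbed by the gap between `b` and a rate `b₂ ∈ (b, β)`. This
stability is why `IsKernel` asks for decay at every rate below `β` rather than at `β`. -/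
theorem IsKernel.eval_mul {G : ℝ → ℝ → ℂ} (hG : IsKernel β k' G) (P : ℂ[X]) :
    IsKernel β k' fun r m => P.eval (I * m) * G r m := by
  refine ⟨ContinuousOn.mul (P.continuous.comp (by fun_prop)).continuousOn hG.cont,
    fun b hb0 hb => ?_⟩
  obtain ⟨b₂, hb1, hb2⟩ := exists_between hb
  obtain ⟨B, A, hB, hA, h⟩ := hG.bound b₂ (hb0.trans hb1.le) hb2
  obtain ⟨a, ha, hP⟩ := exists_norm_eval_le P
  obtain ⟨B', hB', h'⟩ := one_add_abs_pow_le P.natDegree (sub_pos.2 hb1)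
  refine ⟨a * B' * B, A, by positivity, hA, fun r m hr => ?_⟩
  rw [norm_mul]
  calc _ ≤ (a * (B' * Real.exp ((b₂ - b) * |m|))) *
        (B * Real.exp (-(b₂ * |m|)) * (r * Real.exp (A * r ^ k'))) := by
        gcongr
        · exact (hP m).trans (by gcongr; exact h' m)
        · exact h r m hr
    _ = a * B' * B * (Real.exp ((b₂ - b) * |m|) * Real.exp (-(b₂ * |m|))) *
        (r * Real.exp (A * r ^ k')) := by ring
    _ = _ := by rw [← Real.exp_add]; ring_nf

/-- Differentiation of an integral of exponentials. -/
theorem hasDerivAt_integral_mul_exp {α : Type*} [MeasurableSpace α] {μ : Measure α}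
    {f : ℂ → α → ℂ} {L : α → ℂ} {x₀ : ℂ} {U : Set ℂ} {g : α → ℝ} (hU : U ∈ 𝓝 x₀)
    (hf : ∀ᶠ x in 𝓝 x₀, AEStronglyMeasurable (f x) μ) (hi : Integrable (f x₀) μ)
    (hL : AEStronglyMeasurable (fun a => L a * f x₀ a) μ) (hg : Integrable g μ)
    (hb : ∀ᵐ a ∂μ, ∀ x ∈ U, ‖L a * f x a‖ ≤ g a)
    (hd : ∀ᵐ a ∂μ, ∀ x, HasDerivAt (fun x => f x a) (L a * f x a) x) :
    HasDerivAt (fun x => ∫ a, f x a ∂μ) (∫ a, L a * f x₀ a ∂μ) x₀ :=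
  (hasDerivAt_integral_of_dominated_loc_of_deriv_le (F' := fun x a => L a * f x a) hU hf hi hL hb hg
    (hd.mono fun _ ha x _ => ha x)).2

/-- Differentiation brings down `-r^{k₁}`. The real part of `s₁` may have any sign because the
exponential in `s₂` has higher order, so the half-plane one unit to the left of `s₁` is a valid
neighbourhood for domination. -/
theorem IsKernel.hasDerivAt_laplace_fst (hk : Exponents k₁ k₂ k') {G : ℝ → ℝ → ℂ}
    (hG : IsKernel β k' G) {s₁ s₂ z : ℂ} (hs₂ : 0 < s₂.re) (hz : |z.im| < β) :
    HasDerivAt (fun s => laplace k₁ k₂ G s s₂ z)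
      (-laplace k₁ k₂ (fun r m => (r : ℂ) ^ k₁ * G r m) s₁ s₂ z) s₁ := by
  have hG' := hG.pow_mul hk.one_lt k₁
  obtain ⟨g, hg, H⟩ := hG'.exists_dominating hk (-s₁.re + 1) hs₂ (abs_nonneg _) hz
  have e : ∀ s p, -(p.2 : ℂ) ^ k₁ * laplaceIntegrand k₁ k₂ G s s₂ z p =
      -laplaceIntegrand k₁ k₂ (fun r m => (r : ℂ) ^ k₁ * G r m) s s₂ z p := by
    intro s p; simp only [laplaceIntegrand]; ring
  have h := hasDerivAt_integral_mul_exp (μ := stripMeasure)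
    (f := fun s p => laplaceIntegrand k₁ k₂ G s s₂ z p) (L := fun p => -(p.2 : ℂ) ^ k₁)
    (x₀ := s₁) (U := {s | s₁.re - 1 < s.re}) (g := g)
    ((isOpen_lt continuous_const continuous_re).mem_nhds (by simp))
    (Eventually.of_forall fun s =>
      aestronglyMeasurable_stripMeasure (hG.continuousOn_laplaceIntegrand s s₂ z))
    (hG.integrable hk hs₂ hz)
    (aestronglyMeasurable_stripMeasure
      (ContinuousOn.mul (by fun_prop) (hG.continuousOn_laplaceIntegrand s₁ s₂ z))) hg
    (by
      filter_upwards [ae_stripMeasure] with p hp s hs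
      rw [e, norm_neg]
      exact H s s₂ z p hp (by have : s₁.re - 1 < s.re := hs; linarith) le_rfl le_rfl)
    (Eventually.of_forall fun p s => by
      unfold laplaceIntegrand
      have h1 : HasDerivAt (fun s : ℂ => -((p.2 : ℂ) ^ k₁ * s) - (p.2 : ℂ) ^ k₂ * s₂ + I * z * p.1)
          (-((p.2 : ℂ) ^ k₁ * 1)) s :=
        ((((hasDerivAt_id s).const_mul _).neg).sub_const _).add_const _
      exact (h1.cexp.const_mul _).congr_deriv (by ring))
  have h2 := h.const_mul (((Real.sqrt (2 * Real.pi))⁻¹ : ℝ) : ℂ)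
  refine h2.congr_deriv ?_
  simp only [e, laplace]
  rw [integral_neg]
  ring

/-- Here `Re s` must stay positive near `s₂`, whence domination on `Re s > Re s₂ / 2`. -/
theorem IsKernel.hasDerivAt_laplace_snd (hk : Exponents k₁ k₂ k') {G : ℝ → ℝ → ℂ}
    (hG : IsKernel β k' G) {s₁ s₂ z : ℂ} (hs₂ : 0 < s₂.re) (hz : |z.im| < β) :
    HasDerivAt (fun s => laplace k₁ k₂ G s₁ s z)
      (-laplace k₁ k₂ (fun r m => (r : ℂ) ^ k₂ * G r m) s₁ s₂ z) s₂ := by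
  have hG' := hG.pow_mul hk.one_lt k₂
  obtain ⟨g, hg, H⟩ := hG'.exists_dominating hk (-s₁.re) (half_pos hs₂)
    (abs_nonneg _) hz
  have e : ∀ s p, -(p.2 : ℂ) ^ k₂ * laplaceIntegrand k₁ k₂ G s₁ s z p =
      -laplaceIntegrand k₁ k₂ (fun r m => (r : ℂ) ^ k₂ * G r m) s₁ s z p := by
    intro s p; simp only [laplaceIntegrand]; ring
  have h := hasDerivAt_integral_mul_exp (μ := stripMeasure)
    (f := fun s p => laplaceIntegrand k₁ k₂ G s₁ s z p) (L := fun p => -(p.2 : ℂ) ^ k₂)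
    (x₀ := s₂) (U := {s | s₂.re / 2 < s.re}) (g := g)
    ((isOpen_lt continuous_const continuous_re).mem_nhds (by simpa using hs₂))
    (Eventually.of_forall fun s =>
      aestronglyMeasurable_stripMeasure (hG.continuousOn_laplaceIntegrand s₁ s z))
    (hG.integrable hk hs₂ hz)
    (aestronglyMeasurable_stripMeasure
      (ContinuousOn.mul (by fun_prop) (hG.continuousOn_laplaceIntegrand s₁ s₂ z))) hg
    (by
      filter_upwards [ae_stripMeasure] with p hp s hs
      rw [e, norm_neg]
      exact H s₁ s z p hp (by simp) (le_of_lt hs) le_rfl)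
    (Eventually.of_forall fun p s => by
      unfold laplaceIntegrand
      have h1 : HasDerivAt (fun s : ℂ => -((p.2 : ℂ) ^ k₁ * s₁) - (p.2 : ℂ) ^ k₂ * s + I * z * p.1)
          (-((p.2 : ℂ) ^ k₂ * 1)) s :=
        (((hasDerivAt_id s).const_mul _).const_sub _).add_const _
      exact (h1.cexp.const_mul _).congr_deriv (by ring))
  have h2 := h.const_mul (((Real.sqrt (2 * Real.pi))⁻¹ : ℝ) : ℂ)
  refine h2.congr_deriv ?_
  simp only [e, laplace]
  rw [integral_neg]
  ring

theorem IsKernel.hasDerivAt_laplace_space (hk : Exponents k₁ k₂ k') {G : ℝ → ℝ → ℂ}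
    (hG : IsKernel β k' G) {s₁ s₂ z : ℂ} (hs₂ : 0 < s₂.re) (hz : |z.im| < β) :
    HasDerivAt (fun w => laplace k₁ k₂ G s₁ s₂ w)
      (laplace k₁ k₂ (fun r m => (I * m) * G r m) s₁ s₂ z) z := by
  have hG' : IsKernel β k' fun r m => (I * m) * G r m := by simpa using hG.eval_mul X
  obtain ⟨b, hb1, hb2⟩ := exists_between hz
  obtain ⟨g, hg, H⟩ := hG'.exists_dominating hk (-s₁.re) hs₂
    ((abs_nonneg _).trans hb1.le) hb2
  have e : ∀ w p, (I * (p.1 : ℂ)) * laplaceIntegrand k₁ k₂ G s₁ s₂ w p =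
      laplaceIntegrand k₁ k₂ (fun r m => (I * m) * G r m) s₁ s₂ w p := by
    intro s p; simp only [laplaceIntegrand]; ring
  have h := hasDerivAt_integral_mul_exp (μ := stripMeasure)
    (f := fun w p => laplaceIntegrand k₁ k₂ G s₁ s₂ w p) (L := fun p => I * (p.1 : ℂ))
    (x₀ := z) (U := {w | |w.im| < b}) (g := g)
    ((isOpen_lt continuous_im.abs continuous_const).mem_nhds hb1)
    (Eventually.of_forall fun w =>
      aestronglyMeasurable_stripMeasure (hG.continuousOn_laplaceIntegrand s₁ s₂ w))
    (hG.integrable hk hs₂ hz)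
    (aestronglyMeasurable_stripMeasure
      (ContinuousOn.mul (by fun_prop) (hG.continuousOn_laplaceIntegrand s₁ s₂ z))) hg
    (by
      filter_upwards [ae_stripMeasure] with p hp w hw
      rw [e]
      exact H s₁ s₂ w p hp (by simp) le_rfl (le_of_lt hw))
    (Eventually.of_forall fun p w => by
      unfold laplaceIntegrand
      have h1 : HasDerivAt (fun w : ℂ => -((p.2 : ℂ) ^ k₁ * s₁) - (p.2 : ℂ) ^ k₂ * s₂ + I * w * p.1)
          (I * 1 * p.1) w :=
        (((hasDerivAt_id w).const_mul I).mul_const _).const_add _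
      exact (h1.cexp.const_mul _).congr_deriv (by ring))
  have h2 := h.const_mul (((Real.sqrt (2 * Real.pi))⁻¹ : ℝ) : ℂ)
  refine h2.congr_deriv ?_
  simp only [e, laplace]

end

end OuterPDE

namespace OuterPDE

/-! ### Linearity of the Laplace–Fourier integral -/

section Linearity

variable {k₁ k₂ : ℕ} {β k' : ℝ}

theorem laplace_const_mul (a : ℂ) (G : ℝ → ℝ → ℂ) (s₁ s₂ z : ℂ) :
    laplace k₁ k₂ (fun r m => a * G r m) s₁ s₂ z = a * laplace k₁ k₂ G s₁ s₂ z := by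
  simp only [laplace, laplaceIntegrand, mul_assoc a]
  rw [integral_const_mul]
  ring

theorem laplace_congr {G H : ℝ → ℝ → ℂ} (h : ∀ r m : ℝ, 0 < r → G r m = H r m) (s₁ s₂ z : ℂ) :
    laplace k₁ k₂ G s₁ s₂ z = laplace k₁ k₂ H s₁ s₂ z := by
  rw [laplace, laplace]
  congr 1
  refine integral_congr_ae ?_
  filter_upwards [ae_stripMeasure] with p hp
  simp only [laplaceIntegrand, h p.2 p.1 hp]

theorem laplace_add (hk : Exponents k₁ k₂ k') {G H : ℝ → ℝ → ℂ} (hG : IsKernel β k' G)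
    (hH : IsKernel β k' H) {s₁ s₂ z : ℂ} (hs₂ : 0 < s₂.re) (hz : |z.im| < β) :
    laplace k₁ k₂ (fun r m => G r m + H r m) s₁ s₂ z =
      laplace k₁ k₂ G s₁ s₂ z + laplace k₁ k₂ H s₁ s₂ z := by
  simp only [laplace]
  rw [← mul_add, ← integral_add (hG.integrable hk hs₂ hz) (hH.integrable hk hs₂ hz)]
  congr 2
  ext p
  simp only [laplaceIntegrand]
  ring

theorem laplace_sum (hk : Exponents k₁ k₂ k') {κ : Type*} (s : Finset κ) {G : κ → ℝ → ℝ → ℂ}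
    (hG : ∀ i ∈ s, IsKernel β k' (G i)) {s₁ s₂ z : ℂ} (hs₂ : 0 < s₂.re) (hz : |z.im| < β) :
    laplace k₁ k₂ (fun r m => ∑ i ∈ s, G i r m) s₁ s₂ z =
      ∑ i ∈ s, laplace k₁ k₂ (G i) s₁ s₂ z := by
  simp only [laplace]
  rw [← Finset.mul_sum, ← integral_finsetSum s fun i hi => (hG i hi).integrable hk hs₂ hz]
  congr 2
  ext p
  simp only [laplaceIntegrand, Finset.sum_mul]

theorem IsKernel.add {G H : ℝ → ℝ → ℂ} (hG : IsKernel β k' G) (hH : IsKernel β k' H) :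
    IsKernel β k' fun r m => G r m + H r m := by
  refine ⟨hG.cont.add hH.cont, fun b hb0 hb => ?_⟩
  obtain ⟨B, A, hB, hA, h⟩ := hG.bound b hb0 hb
  obtain ⟨B', A', hB', hA', h'⟩ := hH.bound b hb0 hb
  refine ⟨B + B', A + A', by positivity, by positivity, fun r m hr => ?_⟩
  have hrk : 0 ≤ r ^ k' := by positivity
  rw [add_mul, add_mul]
  refine norm_add_le_of_le ((h r m hr).trans ?_) ((h' r m hr).trans ?_)
  · gcongr; linarith
  · gcongr; linarith

theorem IsKernel.zero : IsKernel β k' fun _ _ => 0 :=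
  ⟨continuousOn_const, fun _ _ _ => ⟨0, 0, le_rfl, le_rfl, by simp⟩⟩

theorem IsKernel.sum {κ : Type*} (s : Finset κ) {G : κ → ℝ → ℝ → ℂ}
    (hG : ∀ i ∈ s, IsKernel β k' (G i)) : IsKernel β k' fun r m => ∑ i ∈ s, G i r m := by
  classical
  induction s using Finset.induction_on with
  | empty => simpa using IsKernel.zero
  | insert i s hi ih =>
    simp only [Finset.sum_insert hi]
    exact (hG i (Finset.mem_insert_self i s)).add
      (ih fun j hj => hG j (Finset.mem_insert_of_mem hj))

end Linearity

namespace Equation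

variable {e : Equation}

/-! ### Multiplication by the coefficients -/

/-- The convolution of a kernel with `C_{ℓ₁ℓ₂}`. -/
noncomputable def convKernel (e : Equation) (l₁ l₂ : ℕ) (ε : ℂ) (G : ℝ → ℝ → ℂ) (r m : ℝ) : ℂ :=
  ((Real.sqrt (2 * Real.pi))⁻¹ : ℝ) * ∫ m₁ : ℝ, e.C l₁ l₂ (m - m₁) ε * G r m₁

/-- For `b < β`, `e^{-β|m-m₁|} e^{-b|m₁|} ≤ e^{-b|m|}`, so the decay rate survives, and the factor
`(1+|m-m₁|)^{-μ}` with `μ > 1` makes the integral finite. -/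
theorem isKernel_convKernel (he : e.Assumptions) {l₁ l₂ : ℕ} (h₁ : l₁ ∈ Finset.Ico 1 e.D₁)
    (h₂ : l₂ ∈ Finset.Ico 1 e.D₂) {ε : ℂ} (hε : ε ∈ Metric.ball (0 : ℂ) e.ε₀) {G : ℝ → ℝ → ℂ}
    (hG : IsKernel e.β e.k' G) : IsKernel e.β e.k' (e.convKernel l₁ l₂ ε G) := by
  obtain ⟨Bc, hBc, hC⟩ := he.exists_C_le h₁ h₂
  have hCc := he.C_cont l₁ h₁ l₂ h₂ ε hε
  have hβ := he.β_pos
  have hμ := he.one_lt_μ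
  have hk' := he.k'_pos
  have hGc : ∀ r : ℝ, 0 < r → Continuous (G r) := fun r hr =>
    hG.cont.comp_continuous (f := fun m : ℝ => (m, r)) (by fun_prop) fun m => ⟨mem_univ _, hr⟩
  constructor
  · refine continuousOn_const.mul ?_
    rintro ⟨m₀, r₀⟩ ⟨-, hr₀⟩
    have hr₀ : 0 < r₀ := hr₀
    -- Continuity needs only some integrable majorant in `m₁`, so any fixed rate in `(0, β)` will
    -- do.
    obtain ⟨B, A, hB, hA, h⟩ := hG.bound (e.β / 2) (by positivity) (by linarith)
    have hev : ∀ᶠ p : ℝ × ℝ in 𝓝[univ ×ˢ Ioi 0] (m₀, r₀), 0 < p.2 ∧ p.2 < r₀ + 1 := by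
      refine (eventually_mem_nhdsWithin.mono fun p hp => hp.2).and (mem_nhdsWithin_of_mem_nhds ?_)
      exact (isOpen_lt continuous_snd continuous_const).mem_nhds (by simp)
    refine continuousWithinAt_of_dominated (bound := fun m₁ => Bc *
      (B * Real.exp (-(e.β / 2 * |m₁|)) * ((r₀ + 1) * Real.exp (A * (r₀ + 1) ^ e.k')))) ?_ ?_
      ((((integrable_exp_neg_mul_abs (half_pos hβ)).const_mul B).mul_const _).const_mul Bc) ?_
    · filter_upwards [hev] with p hp
      exact ((hCc.comp (continuous_sub_left p.1)).mul (hGc p.2 hp.1)).aestronglyMeasurable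
    · filter_upwards [hev] with p hp
      refine Eventually.of_forall fun m₁ => ?_
      rw [norm_mul]
      have hp1 := hp.1
      gcongr
      · refine (hC ε hε _).trans (mul_le_of_le_one_right hBc.le ?_)
        exact weight_le_one (by linarith) hβ.le _
      · refine (h p.2 m₁ hp.1).trans ?_
        have := hp.2.le
        gcongr
    · refine Eventually.of_forall fun m₁ => ContinuousWithinAt.mul (ContinuousAt.continuousWithinAt
        (Continuous.continuousAt ?_)) ?_
      · exact hCc.comp (f := fun p : ℝ × ℝ => p.1 - m₁) (by fun_prop)
      · have hmap : MapsTo (fun p : ℝ × ℝ => (m₁, p.2)) (univ ×ˢ Ioi 0) (univ ×ˢ Ioi 0) :=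
          fun p hp => ⟨mem_univ _, hp.2⟩
        exact (hG.cont.comp (f := fun p : ℝ × ℝ => (m₁, p.2)) (by fun_prop) hmap)
          (m₀, r₀) ⟨mem_univ _, hr₀⟩
  · intro b hb0 hb
    obtain ⟨B, A, hB, hA, h⟩ := hG.bound b hb0 hb
    have i1 := integrable_one_add_abs_rpow hμ
    set J : ℝ := ∫ m : ℝ, (1 + |m|) ^ (-e.μ) with hJ
    have hJ0 : 0 ≤ J := integral_nonneg fun m => by positivity
    set s : ℝ := (Real.sqrt (2 * Real.pi))⁻¹ with hs
    have hs0 : 0 ≤ s := by positivity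
    refine ⟨s * (Bc * B * J), A, by positivity, hA, fun r m hr => ?_⟩
    rw [convKernel, norm_mul, norm_real, Real.norm_of_nonneg hs0]
    have hle : ‖∫ m₁ : ℝ, e.C l₁ l₂ (m - m₁) ε * G r m₁‖ ≤
        Bc * B * Real.exp (-(b * |m|)) * (r * Real.exp (A * r ^ e.k')) * J := by
      refine (norm_integral_le_of_norm_le ((i1.comp_sub_left m).const_mul
        (Bc * B * Real.exp (-(b * |m|)) * (r * Real.exp (A * r ^ e.k'))))
        (Eventually.of_forall fun m₁ => ?_)).trans (le_of_eq ?_)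
      · rw [norm_mul]
        have hexp : Real.exp (-(e.β * |m - m₁|)) * Real.exp (-(b * |m₁|)) ≤
            Real.exp (-(b * |m|)) := by
          rw [← Real.exp_add, Real.exp_le_exp]
          have htri : |m| ≤ |m - m₁| + |m₁| := by simpa using abs_add_le (m - m₁) m₁
          have := abs_nonneg (m - m₁)
          nlinarith
        have hC' := hC ε hε (m - m₁)
        rw [weight_eq] at hC'
        calc _ ≤ (Bc * ((1 + |m - m₁|) ^ (-e.μ) * Real.exp (-(e.β * |m - m₁|)))) *
              (B * Real.exp (-(b * |m₁|)) * (r * Real.exp (A * r ^ e.k'))) := by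
              gcongr
              exact h r m₁ hr
          _ = Bc * B * (Real.exp (-(e.β * |m - m₁|)) * Real.exp (-(b * |m₁|))) *
              (r * Real.exp (A * r ^ e.k')) * (1 + |m - m₁|) ^ (-e.μ) := by ring
          _ ≤ _ := by gcongr
      · rw [integral_const_mul,
          integral_sub_left_eq_self (fun x : ℝ => (1 + |x|) ^ (-e.μ)) volume m]
    calc _ ≤ s * (Bc * B * Real.exp (-(b * |m|)) * (r * Real.exp (A * r ^ e.k')) * J) := by gcongr
      _ = _ := by ring

theorem integrable_C_mul_exp (he : e.Assumptions) {l₁ l₂ : ℕ} (h₁ : l₁ ∈ Finset.Ico 1 e.D₁)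
    (h₂ : l₂ ∈ Finset.Ico 1 e.D₂) {ε z : ℂ} (hε : ε ∈ Metric.ball (0 : ℂ) e.ε₀)
    (hz : |z.im| < e.β) : Integrable fun m : ℝ => e.C l₁ l₂ m ε * exp (I * z * m) := by
  obtain ⟨B, hB, hC⟩ := he.exists_C_le h₁ h₂
  have hCc := he.C_cont l₁ h₁ l₂ h₂ ε hε
  refine ((integrable_exp_neg_mul_abs (sub_pos.2 hz)).const_mul B).mono'
    (hCc.mul (by fun_prop)).aestronglyMeasurable (Eventually.of_forall fun m => ?_)
  have h1 : ‖exp (I * z * m)‖ ≤ Real.exp (|z.im| * |m|) := by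
    rw [norm_exp, Real.exp_le_exp, ← abs_mul]
    have : (I * z * m).re = -(z.im * m) := by simp
    rw [this]
    exact neg_le_abs _
  rw [norm_mul]
  calc _ ≤ B * Real.exp (-(e.β * |m|)) * Real.exp (|z.im| * |m|) := by
        gcongr
        refine (hC ε hε m).trans ?_
        gcongr
        exact weight_le_exp (by linarith [he.one_lt_μ]) _ _
    _ = _ := by rw [mul_assoc, ← Real.exp_add]; ring_nf

-- The Fourier transform turns products into convolutions. For almost every `r` the kernel times
-- `e^{izm}` is integrable in `m`, and `e^{izm} = e^{izm₁} e^{iz(m-m₁)}` exhibits the integrand as a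
-- convolution.
open scoped Convolution in
theorem c_mul_laplace (he : e.Assumptions) {l₁ l₂ : ℕ} (h₁ : l₁ ∈ Finset.Ico 1 e.D₁)
    (h₂ : l₂ ∈ Finset.Ico 1 e.D₂) {ε : ℂ} (hε : ε ∈ Metric.ball (0 : ℂ) e.ε₀) {G : ℝ → ℝ → ℂ}
    (hG : IsKernel e.β e.k' G) {s₁ s₂ z : ℂ} (hs₂ : 0 < s₂.re) (hz : |z.im| < e.β) :
    e.c l₁ l₂ z ε * laplace e.k₁ e.k₂ G s₁ s₂ z =
      laplace e.k₁ e.k₂ (e.convKernel l₁ l₂ ε G) s₁ s₂ z := by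
  have hi := hG.integrable he.exponents (s₁ := s₁) hs₂ hz
  have hi' := (isKernel_convKernel he h₁ h₂ hε hG).integrable he.exponents (s₁ := s₁) hs₂ hz
  have hC := integrable_C_mul_exp he h₁ h₂ hε hz
  simp only [laplace, c, invFourier]
  rw [integral_prod_symm _ hi, integral_prod_symm _ hi']
  set κ : ℂ := (((Real.sqrt (2 * Real.pi))⁻¹ : ℝ) : ℂ)
  have key : ∀ᵐ r ∂(volume.restrict (Ioi (0 : ℝ))),
      ∫ m, laplaceIntegrand e.k₁ e.k₂ (e.convKernel l₁ l₂ ε G) s₁ s₂ z (m, r) =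
        κ * ((∫ m : ℝ, e.C l₁ l₂ m ε * exp (I * z * m)) *
          ∫ m, laplaceIntegrand e.k₁ e.k₂ G s₁ s₂ z (m, r)) := by
    filter_upwards [hi.prod_left_ae] with r hr
    have h := integral_convolution (ContinuousLinearMap.mul ℂ ℂ) hr hC
    simp only [ContinuousLinearMap.mul_apply'] at h
    rw [mul_comm (∫ m : ℝ, e.C l₁ l₂ m ε * exp (I * z * m)), ← h, ← integral_const_mul]
    refine integral_congr_ae (Eventually.of_forall fun m => ?_)
    simp only [laplaceIntegrand, convKernel, convolution_def, ContinuousLinearMap.mul_apply']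
    rw [mul_assoc, mul_assoc κ]
    congr 1
    rw [← integral_mul_const]
    refine integral_congr_ae (Eventually.of_forall fun m₁ => ?_)
    simp only
    have hexp : exp (-((r : ℂ) ^ e.k₁ * s₁) - (r : ℂ) ^ e.k₂ * s₂ + I * z * m) =
        exp (-((r : ℂ) ^ e.k₁ * s₁) - (r : ℂ) ^ e.k₂ * s₂ + I * z * m₁) *
          exp (I * z * ((m - m₁ : ℝ) : ℂ)) := by
      rw [← exp_add]; congr 1; push_cast; ring
    rw [hexp]
    ring
  rw [integral_congr_ae key, integral_const_mul, integral_const_mul]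
  ring

end Equation

end OuterPDE

namespace OuterPDE

theorem isOpen_strip (β : ℝ) : IsOpen (strip β) :=
  isOpen_lt continuous_im.abs continuous_const

namespace Equation

variable {e : Equation}

/-! ### The differential operators on Laplace–Fourier integrals -/

/-- Open sets of times on which the Laplace–Fourier integrals with
`s₁ = a₁ / t₁^{k₁}`, `s₂ = a₂ / t₂^{k₂}` converge. -/
structure IsTimeDomain (e : Equation) (a₂ : ℂ) (V₁ V₂ : Set ℂ) : Prop where
  isOpen₁ : IsOpen V₁
  isOpen₂ : IsOpen V₂
  ne_zero₁ : ∀ t ∈ V₁, t ≠ 0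
  ne_zero₂ : ∀ t ∈ V₂, t ≠ 0
  re_pos : ∀ t ∈ V₂, 0 < (a₂ / t ^ e.k₂).re

/-- `u(·, ε)` is, on `V₁ × V₂ × H_β`, the product of `χ(z)` and a Laplace–Fourier integral. -/
def IsLaplace (e : Equation) (ε a₁ a₂ : ℂ) (V₁ V₂ : Set ℂ) (χ : ℂ → ℂ) (G : ℝ → ℝ → ℂ)
    (u : ℂ → ℂ → ℂ → ℂ → ℂ) : Prop :=
  ∀ t₁ ∈ V₁, ∀ t₂ ∈ V₂, ∀ z ∈ strip e.β,
    u t₁ t₂ z ε = χ z * laplace e.k₁ e.k₂ G (a₁ / t₁ ^ e.k₁) (a₂ / t₂ ^ e.k₂) z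

theorem hasDerivAt_div_pow {k : ℕ} (hk : 0 < k) (a : ℂ) {t : ℂ} (ht : t ≠ 0) :
    HasDerivAt (fun s => a / s ^ k) (-(k * a / t ^ (k + 1))) t := by
  obtain ⟨j, rfl⟩ : ∃ j, k = j + 1 := ⟨k - 1, by omega⟩
  have h := (((hasDerivAt_pow (j + 1) t).inv (pow_ne_zero _ ht)).const_mul a)
  simp only [div_eq_mul_inv]
  refine h.congr_deriv ?_
  simp only [Nat.add_sub_cancel]
  field_simp
  ring

section

variable {ε a₁ a₂ : ℂ} {V₁ V₂ : Set ℂ} {χ : ℂ → ℂ} {G : ℝ → ℝ → ℂ} {u : ℂ → ℂ → ℂ → ℂ → ℂ}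

/-- By the chain rule, `t^{k+1}` times the derivative of `a / t^k` is the constant `-k a`, and its
sign cancels that of the derivative in `s₁`. The factor `χ(z)` is inert; it is there to let the
operator act on `c(z) R(∂_z) u`. -/
theorem IsLaplace.timeOp₁ (he : e.Assumptions) (hV : e.IsTimeDomain a₂ V₁ V₂)
    (hG : IsKernel e.β e.k' G) (hu : e.IsLaplace ε a₁ a₂ V₁ V₂ χ G u) :
    e.IsLaplace ε a₁ a₂ V₁ V₂ χ (fun r m => (e.k₁ * a₁) * ((r : ℂ) ^ e.k₁ * G r m))
      (timeOp₁ e.k₁ u) := by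
  intro t₁ ht₁ t₂ ht₂ z hz
  have h0 := hV.ne_zero₁ t₁ ht₁
  have h1 := (hG.hasDerivAt_laplace_fst he.exponents (s₁ := a₁ / t₁ ^ e.k₁) (hV.re_pos t₂ ht₂) hz)
  have h2 := (h1.comp t₁ (hasDerivAt_div_pow he.k₁_pos a₁ h0)).const_mul (χ z)
  have h3 : (fun s => u s t₂ z ε) =ᶠ[𝓝 t₁] fun s => χ z *
      ((fun s => laplace e.k₁ e.k₂ G s (a₂ / t₂ ^ e.k₂) z) ∘ fun s => a₁ / s ^ e.k₁) s := by
    filter_upwards [hV.isOpen₁.mem_nhds ht₁] with s hs using hu s hs t₂ ht₂ z hz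
  rw [Equation.timeOp₁, h3.deriv_eq, h2.deriv, laplace_const_mul]
  field_simp

theorem IsLaplace.timeOp₂ (he : e.Assumptions) (hV : e.IsTimeDomain a₂ V₁ V₂)
    (hG : IsKernel e.β e.k' G) (hu : e.IsLaplace ε a₁ a₂ V₁ V₂ χ G u) :
    e.IsLaplace ε a₁ a₂ V₁ V₂ χ (fun r m => (e.k₂ * a₂) * ((r : ℂ) ^ e.k₂ * G r m))
      (timeOp₂ e.k₂ u) := by
  intro t₁ ht₁ t₂ ht₂ z hz
  have h0 := hV.ne_zero₂ t₂ ht₂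
  have h1 := (hG.hasDerivAt_laplace_snd he.exponents (s₁ := a₁ / t₁ ^ e.k₁) (hV.re_pos t₂ ht₂) hz)
  have h2 := (h1.comp t₂ (hasDerivAt_div_pow he.k₂_pos a₂ h0)).const_mul (χ z)
  have h3 : (fun s => u t₁ s z ε) =ᶠ[𝓝 t₂] fun s => χ z *
      ((fun s => laplace e.k₁ e.k₂ G (a₁ / t₁ ^ e.k₁) s z) ∘ fun s => a₂ / s ^ e.k₂) s := by
    filter_upwards [hV.isOpen₂.mem_nhds ht₂] with s hs using hu t₁ ht₁ s hs z hz
  rw [Equation.timeOp₂, h3.deriv_eq, h2.deriv, laplace_const_mul]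
  field_simp

theorem isKernel_pow_mul (he : e.Assumptions) (hG : IsKernel e.β e.k' G) (a : ℂ) (k n : ℕ) :
    IsKernel e.β e.k' fun r m => (a * (r : ℂ) ^ k) ^ n * G r m := by
  have := (hG.pow_mul he.exponents.one_lt (k * n)).const_mul (a ^ n)
  simpa only [mul_pow, ← pow_mul, mul_assoc] using this

theorem IsLaplace.iterate_timeOp₁ (he : e.Assumptions) (hV : e.IsTimeDomain a₂ V₁ V₂)
    (hG : IsKernel e.β e.k' G) (hu : e.IsLaplace ε a₁ a₂ V₁ V₂ χ G u) (n : ℕ) :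
    e.IsLaplace ε a₁ a₂ V₁ V₂ χ (fun r m => (e.k₁ * a₁ * (r : ℂ) ^ e.k₁) ^ n * G r m)
      ((Equation.timeOp₁ e.k₁)^[n] u) := by
  induction n with
  | zero => simpa using hu
  | succ n ih =>
    rw [Function.iterate_succ_apply']
    have := ih.timeOp₁ he hV (isKernel_pow_mul he hG _ _ n)
    simpa only [pow_succ', mul_assoc] using this

theorem IsLaplace.iterate_timeOp₂ (he : e.Assumptions) (hV : e.IsTimeDomain a₂ V₁ V₂)
    (hG : IsKernel e.β e.k' G) (hu : e.IsLaplace ε a₁ a₂ V₁ V₂ χ G u) (n : ℕ) :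
    e.IsLaplace ε a₁ a₂ V₁ V₂ χ (fun r m => (e.k₂ * a₂ * (r : ℂ) ^ e.k₂) ^ n * G r m)
      ((Equation.timeOp₂ e.k₂)^[n] u) := by
  induction n with
  | zero => simpa using hu
  | succ n ih =>
    rw [Function.iterate_succ_apply']
    have := ih.timeOp₂ he hV (isKernel_pow_mul he hG _ _ n)
    simpa only [pow_succ', mul_assoc] using this

theorem IsLaplace.spaceOp (he : e.Assumptions) (hV : e.IsTimeDomain a₂ V₁ V₂)
    (hG : IsKernel e.β e.k' G) (hu : e.IsLaplace ε a₁ a₂ V₁ V₂ 1 G u) (P : ℂ[X]) :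
    e.IsLaplace ε a₁ a₂ V₁ V₂ 1 (fun r m => P.eval (I * m) * G r m) (Equation.spaceOp P u) := by
  intro t₁ ht₁ t₂ ht₂ z hz
  have hs₂ := hV.re_pos t₂ ht₂
  have hK : ∀ n : ℕ, IsKernel e.β e.k' fun r m => (I * m) ^ n * G r m := fun n => by
    simpa using hG.eval_mul (X ^ n)
  have key : ∀ n : ℕ, ∀ z ∈ strip e.β, iteratedDeriv n (fun w => u t₁ t₂ w ε) z =
      laplace e.k₁ e.k₂ (fun r m => (I * m) ^ n * G r m) (a₁ / t₁ ^ e.k₁) (a₂ / t₂ ^ e.k₂) z := by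
    intro n
    induction n with
    | zero =>
      intro z hz
      simpa using hu t₁ ht₁ t₂ ht₂ z hz
    | succ n ih =>
      intro z hz
      have h3 : iteratedDeriv n (fun w => u t₁ t₂ w ε) =ᶠ[𝓝 z] fun z =>
          laplace e.k₁ e.k₂ (fun r m => (I * m) ^ n * G r m) (a₁ / t₁ ^ e.k₁)
            (a₂ / t₂ ^ e.k₂) z := by
        filter_upwards [(isOpen_strip e.β).mem_nhds hz] with w hw using ih w hw
      rw [iteratedDeriv_succ, h3.deriv_eq,
        ((hK n).hasDerivAt_laplace_space he.exponents hs₂ hz).deriv]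
      simp only [pow_succ', mul_assoc]
  rw [Equation.spaceOp, Polynomial.sum_def]
  simp only [key _ z hz, Pi.one_apply, one_mul]
  simp_rw [← laplace_const_mul]
  rw [← laplace_sum he.exponents _ (fun n _ => (hK n).const_mul _) hs₂ hz]
  congr 1
  ext r m
  rw [eval_eq_sum, Polynomial.sum_def, Finset.sum_mul]
  simp only [mul_assoc]

/-- A Laplace–Fourier integral of a solution of the auxiliary equation solves the main equation. -/
theorem solvesAt_of_isLaplace (he : e.Assumptions) (hε : ε ∈ Metric.ball (0 : ℂ) e.ε₀)
    (hε0 : ε ≠ 0) {ξ : ℝ} (ha₁ : a₁ = (exp (ξ * I) / ε ^ e.lam₁) ^ e.k₁)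
    (ha₂ : a₂ = (exp (ξ * I) / ε ^ e.lam₂) ^ e.k₂) (hV : e.IsTimeDomain a₂ V₁ V₂)
    {ω : ℂ → ℝ → ℂ} (hω : IsKernel e.β e.k' fun r m => ω (r * exp (ξ * I)) m)
    (hu : e.IsLaplace ε a₁ a₂ V₁ V₂ 1 (fun r m => ω (r * exp (ξ * I)) m) u)
    {ψ : ℂ → ℝ → ℂ → ℂ} (hψ : IsKernel e.β e.k' fun r m => ψ (r * exp (ξ * I)) m ε)
    (heq : ∀ r : ℝ, 0 < r → ∀ m : ℝ, e.Pm m (r * exp (ξ * I)) * ω (r * exp (ξ * I)) m =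
      ∑ l₁ ∈ Finset.Ico 1 e.D₁, ∑ l₂ ∈ Finset.Ico 1 e.D₂,
        e.convCoeff l₁ l₂ ε (r * exp (ξ * I)) * e.conv l₁ l₂ ε (ω (r * exp (ξ * I))) m +
      ψ (r * exp (ξ * I)) m ε)
    {t₁ t₂ z : ℂ} (ht₁ : t₁ ∈ V₁) (ht₂ : t₂ ∈ V₂) (hz : z ∈ strip e.β)
    (hf : e.forcing ψ t₁ t₂ z ε = laplace e.k₁ e.k₂ (fun r m => ψ (r * exp (ξ * I)) m ε)
      (a₁ / t₁ ^ e.k₁) (a₂ / t₂ ^ e.k₂) z) :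
    e.SolvesAt ψ u t₁ t₂ z ε := by
  have hs₂ := hV.re_pos t₂ ht₂
  have hR : ∀ (P : ℂ[X]) (χ : ℂ → ℂ) (v : ℂ → ℂ → ℂ → ℂ → ℂ) (n₁ n₂ : ℕ),
      e.IsLaplace ε a₁ a₂ V₁ V₂ χ (fun r m => P.eval (I * m) * ω (r * exp (ξ * I)) m) v →
      ((Equation.timeOp₁ e.k₁)^[n₁] ((Equation.timeOp₂ e.k₂)^[n₂] v)) t₁ t₂ z ε =
        χ z * laplace e.k₁ e.k₂ (fun r m => (e.k₁ * a₁ * (r : ℂ) ^ e.k₁) ^ n₁ *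
          ((e.k₂ * a₂ * (r : ℂ) ^ e.k₂) ^ n₂ * (P.eval (I * m) * ω (r * exp (ξ * I)) m)))
          (a₁ / t₁ ^ e.k₁) (a₂ / t₂ ^ e.k₂) z := fun P χ v n₁ n₂ hv =>
    (hv.iterate_timeOp₂ he hV (hω.eval_mul P) n₂).iterate_timeOp₁ he hV
      (isKernel_pow_mul he (hω.eval_mul P) _ _ n₂) n₁ t₁ ht₁ t₂ ht₂ z hz
  -- The `ε^{-λ_j k_j}` contained in `a_j` are cancelled by `ε^n`; the surplus power is the one in
  -- the auxiliary equation, and for the leading term it is zero.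
  have hscale : ∀ (n : ℕ) (n₁ n₂ : ℕ) (r : ℝ), e.lam₁ * e.k₁ * n₁ + e.lam₂ * e.k₂ * n₂ ≤ n →
      ε ^ n * ((e.k₁ * a₁ * (r : ℂ) ^ e.k₁) ^ n₁ * (e.k₂ * a₂ * (r : ℂ) ^ e.k₂) ^ n₂) =
      ε ^ (n - e.lam₁ * e.k₁ * n₁ - e.lam₂ * e.k₂ * n₂) *
        ((e.k₁ * (r * exp (ξ * I)) ^ e.k₁) ^ n₁ * (e.k₂ * (r * exp (ξ * I)) ^ e.k₂) ^ n₂) := by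
    intro n n₁ n₂ r hn
    obtain ⟨j, rfl⟩ : ∃ j, n = j + (e.lam₁ * e.k₁ * n₁ + e.lam₂ * e.k₂ * n₂) :=
      ⟨n - (e.lam₁ * e.k₁ * n₁ + e.lam₂ * e.k₂ * n₂), by omega⟩
    have : j + (e.lam₁ * e.k₁ * n₁ + e.lam₂ * e.k₂ * n₂) - e.lam₁ * e.k₁ * n₁ -
        e.lam₂ * e.k₂ * n₂ = j := by omega
    rw [this, ha₁, ha₂]
    simp only [div_pow, mul_pow, ← pow_mul, pow_add]
    field_simp
  have hlow : ∀ l₁ ∈ Finset.Ico 1 e.D₁, ∀ l₂ ∈ Finset.Ico 1 e.D₂,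
      IsKernel e.β e.k' (fun r m => e.convCoeff l₁ l₂ ε (r * exp (ξ * I)) *
        e.conv l₁ l₂ ε (ω (r * exp (ξ * I))) m) ∧
      ε ^ e.Δ l₁ l₂ * ((Equation.timeOp₁ e.k₁)^[e.δ₁ l₁] ((Equation.timeOp₂ e.k₂)^[e.δ₂ l₂]
        (fun s₁ s₂ w η => e.c l₁ l₂ w η * Equation.spaceOp (e.R l₁ l₂) u s₁ s₂ w η))) t₁ t₂ z ε =
      laplace e.k₁ e.k₂ (fun r m => e.convCoeff l₁ l₂ ε (r * exp (ξ * I)) *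
        e.conv l₁ l₂ ε (ω (r * exp (ξ * I))) m) (a₁ / t₁ ^ e.k₁) (a₂ / t₂ ^ e.k₂) z := by
    intro l₁ h₁ l₂ h₂
    have hK := isKernel_pow_mul he (isKernel_pow_mul he (hω.eval_mul (e.R l₁ l₂)) (e.k₂ * a₂)
      e.k₂ (e.δ₂ l₂)) (e.k₁ * a₁) e.k₁ (e.δ₁ l₁)
    -- The factors in `r` do not depend on `m₁` and leave the convolution integral.
    have hpt : ∀ r m : ℝ, ε ^ e.Δ l₁ l₂ * e.convKernel l₁ l₂ ε (fun r m =>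
        (e.k₁ * a₁ * (r : ℂ) ^ e.k₁) ^ e.δ₁ l₁ * ((e.k₂ * a₂ * (r : ℂ) ^ e.k₂) ^ e.δ₂ l₂ *
          ((e.R l₁ l₂).eval (I * m) * ω (r * exp (ξ * I)) m))) r m =
        e.convCoeff l₁ l₂ ε (r * exp (ξ * I)) * e.conv l₁ l₂ ε (ω (r * exp (ξ * I))) m := by
      intro r m
      have hpull : ∀ m₁ : ℝ, e.C l₁ l₂ (m - m₁) ε * ((e.k₁ * a₁ * (r : ℂ) ^ e.k₁) ^ e.δ₁ l₁ *
          ((e.k₂ * a₂ * (r : ℂ) ^ e.k₂) ^ e.δ₂ l₂ *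
            ((e.R l₁ l₂).eval (I * m₁) * ω (r * exp (ξ * I)) m₁))) =
          ((e.k₁ * a₁ * (r : ℂ) ^ e.k₁) ^ e.δ₁ l₁ * (e.k₂ * a₂ * (r : ℂ) ^ e.k₂) ^ e.δ₂ l₂) *
          (e.C l₁ l₂ (m - m₁) ε * (e.R l₁ l₂).eval (I * m₁) * ω (r * exp (ξ * I)) m₁) :=
        fun m₁ => by ring
      simp only [convKernel, conv, convCoeff, hpull]
      rw [integral_const_mul, mul_left_comm, ← mul_assoc (ε ^ e.Δ l₁ l₂),
        hscale _ _ _ r (he.Δ_lower l₁ h₁ l₂ h₂).le]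
      ring
    have hK' := (isKernel_convKernel he h₁ h₂ hε hK).const_mul (ε ^ e.Δ l₁ l₂)
    simp only [hpt] at hK'
    refine ⟨hK', ?_⟩
    have hv : e.IsLaplace ε a₁ a₂ V₁ V₂ (fun w => e.c l₁ l₂ w ε)
        (fun r m => (e.R l₁ l₂).eval (I * m) * ω (r * exp (ξ * I)) m)
        (fun s₁ s₂ w η => e.c l₁ l₂ w η * Equation.spaceOp (e.R l₁ l₂) u s₁ s₂ w η) := by
      intro s₁ hs₁ s₂ hs₂ w hw
      have := hu.spaceOp he hV hω (e.R l₁ l₂) s₁ hs₁ s₂ hs₂ w hw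
      simp only [Pi.one_apply, one_mul] at this
      simp only [this]
    rw [hR _ _ _ _ _ hv, c_mul_laplace he h₁ h₂ hε hK hs₂ hz, ← laplace_const_mul]
    exact laplace_congr (fun r m _ => hpt r m) _ _ _
  have hlead : ε ^ e.Δ e.D₁ e.D₂ * ((Equation.timeOp₁ e.k₁)^[e.δ₁ e.D₁]
      ((Equation.timeOp₂ e.k₂)^[e.δ₂ e.D₂] (Equation.spaceOp e.RD u))) t₁ t₂ z ε =
      laplace e.k₁ e.k₂ (fun r m => (e.k₁ * (r * exp (ξ * I)) ^ e.k₁) ^ e.δ₁ e.D₁ *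
        (e.k₂ * (r * exp (ξ * I)) ^ e.k₂) ^ e.δ₂ e.D₂ * e.RD.eval (I * m) *
          ω (r * exp (ξ * I)) m) (a₁ / t₁ ^ e.k₁) (a₂ / t₂ ^ e.k₂) z := by
    rw [hR _ _ _ _ _ (hu.spaceOp he hV hω e.RD), Pi.one_apply, one_mul, ← laplace_const_mul]
    refine laplace_congr (fun r m _ => ?_) _ _ _
    have h := hscale (e.Δ e.D₁ e.D₂) (e.δ₁ e.D₁) (e.δ₂ e.D₂) r he.Δ_leading.ge
    rw [he.Δ_leading, Nat.add_sub_cancel_left, Nat.sub_self, pow_zero, one_mul,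
      ← he.Δ_leading] at h
    linear_combination (e.RD.eval (I * m) * ω (r * exp (ξ * I)) m) * h
  have hleadK : IsKernel e.β e.k' fun r m => (e.k₁ * (r * exp (ξ * I)) ^ e.k₁) ^ e.δ₁ e.D₁ *
        (e.k₂ * (r * exp (ξ * I)) ^ e.k₂) ^ e.δ₂ e.D₂ * e.RD.eval (I * m) *
          ω (r * exp (ξ * I)) m := by
    have := isKernel_pow_mul he (isKernel_pow_mul he (hω.eval_mul e.RD)
      (e.k₂ * exp (ξ * I) ^ e.k₂) e.k₂ (e.δ₂ e.D₂)) (e.k₁ * exp (ξ * I) ^ e.k₁) e.k₁ (e.δ₁ e.D₁)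
    convert this using 3
    ring
  rw [SolvesAt, hlead, hf,
    Finset.sum_congr rfl fun l₁ h₁ => Finset.sum_congr rfl fun l₂ h₂ => (hlow l₁ h₁ l₂ h₂).2,
    Finset.sum_congr rfl fun l₁ h₁ => (laplace_sum he.exponents _
      (fun l₂ h₂ => (hlow l₁ h₁ l₂ h₂).1) hs₂ hz).symm,
    ← laplace_sum he.exponents _ (fun l₁ h₁ => IsKernel.sum _ fun l₂ h₂ => (hlow l₁ h₁ l₂ h₂).1)
      hs₂ hz,
    ← laplace_add he.exponents hleadK
      (IsKernel.sum _ fun l₁ h₁ => IsKernel.sum _ fun l₂ h₂ => (hlow l₁ h₁ l₂ h₂).1) hs₂ hz,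
    ← laplace_add he.exponents (hleadK.add
      (IsKernel.sum _ fun l₁ h₁ => IsKernel.sum _ fun l₂ h₂ => (hlow l₁ h₁ l₂ h₂).1)) hψ hs₂ hz,
    hu.spaceOp he hV hω e.Q t₁ ht₁ t₂ ht₂ z hz, Pi.one_apply, one_mul]
  -- Both sides are now single Laplace–Fourier integrals, and their kernels agree by the auxiliary
  -- equation on the ray.
  refine laplace_congr (fun r m hr => ?_) _ _ _
  have := heq r hr m
  rw [Pm] at this
  linear_combination this

end

end Equation

end OuterPDE

namespace OuterPDE

/-! ### Sectors and arguments -/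

theorem norm_ofReal_mul_exp {x : ℝ} (hx : 0 ≤ x) (φ : ℝ) : ‖(x : ℂ) * exp (φ * I)‖ = x := by
  rw [norm_mul, norm_exp_ofReal_mul_I, mul_one, norm_real, Real.norm_of_nonneg hx]

/-- The argument of a point near `x₀ e^{iφ₀}` can be chosen near `φ₀`. -/
theorem eventually_exists_angle {x₀ φ₀ : ℝ} (hx₀ : 0 < x₀) {N : Set ℝ} (hN : N ∈ 𝓝 φ₀) :
    ∀ᶠ t in 𝓝 ((x₀ : ℂ) * exp (φ₀ * I)), t ≠ 0 ∧ ∃ φ ∈ N, t = ‖t‖ * exp (φ * I) := by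
  set t₀ : ℂ := x₀ * exp (φ₀ * I) with ht₀
  have h0 : t₀ ≠ 0 := mul_ne_zero (by exact_mod_cast hx₀.ne') (exp_ne_zero _)
  have hc : Tendsto (fun t : ℂ => φ₀ + arg (t / t₀)) (𝓝 t₀) (𝓝 φ₀) := by
    have h1 : ContinuousAt (fun t : ℂ => φ₀ + arg (t / t₀)) t₀ := by
      refine continuousAt_const.add (ContinuousAt.comp (g := arg) ?_ (by fun_prop))
      rw [div_self h0]
      exact continuousAt_arg one_mem_slitPlane
    have h2 : φ₀ + arg (t₀ / t₀) = φ₀ := by rw [div_self h0]; simp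
    rw [ContinuousAt, h2] at h1
    exact h1
  filter_upwards [hc hN, isOpen_ne.mem_nhds h0] with t ht hne
  refine ⟨hne, _, ht, ?_⟩
  have h3 : (‖t / t₀‖ : ℂ) * exp (arg (t / t₀) * I) = t / t₀ := norm_mul_exp_arg_mul_I _
  have hn : ‖t₀‖ = x₀ := norm_ofReal_mul_exp hx₀.le φ₀
  rw [norm_div, hn] at h3
  push_cast at h3 ⊢
  rw [add_mul, exp_add]
  have hx : (x₀ : ℂ) ≠ 0 := by exact_mod_cast hx₀.ne'
  calc t = t / t₀ * t₀ := by field_simp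
    _ = ‖t‖ / x₀ * exp (arg (t / t₀) * I) * (x₀ * exp (φ₀ * I)) := by rw [h3]
    _ = _ := by field_simp

theorem Sector.isOpen_angles (S : Sector) : IsOpen S.angles := isOpen_Ioo

theorem Sector.isOpen_unbounded (S : Sector) : IsOpen S.unbounded := by
  rw [isOpen_iff_mem_nhds]
  rintro _ ⟨r, hr, φ, hφ, rfl⟩
  filter_upwards [eventually_exists_angle hr (S.isOpen_angles.mem_nhds hφ)] with t ht
  obtain ⟨h0, φ', hφ', h⟩ := ht
  exact ⟨‖t‖, norm_pos_iff.2 h0, φ', hφ', h⟩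

/-- `φ` is the argument of the point `t` of the sector `S`. -/
structure Sector.HasAngle (S : Sector) (t : ℂ) (φ : ℝ) : Prop where
  ne_zero : t ≠ 0
  mem : φ ∈ S.angles
  eq : t = ‖t‖ * exp (φ * I)

theorem Sector.HasAngle.norm_pos {S : Sector} {t : ℂ} {φ : ℝ} (h : S.HasAngle t φ) : 0 < ‖t‖ :=
  norm_pos_iff.2 h.ne_zero

theorem Sector.hasAngle_mul_exp {S : Sector} {x φ : ℝ} (hx : 0 < x) (hφ : φ ∈ S.angles) :
    S.HasAngle (x * exp (φ * I)) φ :=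
  ⟨mul_ne_zero (by exact_mod_cast hx.ne') (exp_ne_zero _), hφ, by
    rw [norm_ofReal_mul_exp hx.le]⟩

theorem Sector.exists_hasAngle_of_unbounded {S : Sector} {t : ℂ} (h : t ∈ S.unbounded) :
    ∃ φ, S.HasAngle t φ := by
  obtain ⟨r, hr, φ, hφ, rfl⟩ := h
  exact ⟨φ, Sector.hasAngle_mul_exp hr hφ⟩

theorem Sector.mem_bounded_iff {S : Sector} {t : ℂ} {R : ℝ} :
    t ∈ S.bounded R ↔ ‖t‖ < R ∧ ∃ φ, S.HasAngle t φ := by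
  constructor
  · rintro ⟨r, hr, hR, φ, hφ, rfl⟩
    exact ⟨by rwa [norm_ofReal_mul_exp hr.le], φ, Sector.hasAngle_mul_exp hr hφ⟩
  · rintro ⟨h, φ, hφ⟩
    exact ⟨‖t‖, hφ.norm_pos, h, φ, hφ.mem, hφ.eq⟩

theorem exists_int_of_exp_eq {φ φ' : ℝ} (h : exp (φ * I) = exp (φ' * I)) :
    ∃ n : ℤ, φ = φ' + n * (2 * Real.pi) := by
  obtain ⟨n, hn⟩ := exp_eq_exp_iff_exists_int.1 h
  refine ⟨n, ?_⟩
  have h2 : ((φ : ℂ) : ℂ) * I = ((φ' + n * (2 * Real.pi) : ℝ) : ℂ) * I := by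
    rw [hn]; push_cast; ring
  exact_mod_cast mul_right_cancel₀ I_ne_zero h2

theorem exp_eq_of_polar {t : ℂ} (ht : t ≠ 0) {φ φ' : ℝ} (h : t = ‖t‖ * exp (φ * I))
    (h' : t = ‖t‖ * exp (φ' * I)) : exp (φ * I) = exp (φ' * I) := by
  have h0 : (‖t‖ : ℂ) ≠ 0 := by exact_mod_cast (norm_pos_iff.2 ht).ne'
  exact mul_left_cancel₀ h0 (h.symm.trans h')

/-- Two arguments of one point differ by a multiple of `2π`, and an open interval of length at most
`2π` contains at most one of them. -/
theorem Sector.HasAngle.unique {S : Sector} {t : ℂ} {φ φ' : ℝ} (h : S.HasAngle t φ)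
    (h' : S.HasAngle t φ') : φ = φ' := by
  obtain ⟨n, hn⟩ := exists_int_of_exp_eq (exp_eq_of_polar h.ne_zero h.eq h'.eq)
  have hp := Real.pi_pos
  have hS := S.opening_le
  have h1 := h.mem
  have h2 := h'.mem
  simp only [Sector.angles, mem_Ioo] at h1 h2
  have hn0 : n = 0 := by
    have ha : (n : ℝ) * (2 * Real.pi) < 1 * (2 * Real.pi) := by linarith
    have hb : (-1 : ℝ) * (2 * Real.pi) < (n : ℝ) * (2 * Real.pi) := by linarith
    have ha' : (n : ℝ) < 1 := lt_of_mul_lt_mul_right ha (by positivity)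
    have hb' : (-1 : ℝ) < n := lt_of_mul_lt_mul_right hb (by positivity)
    have : n < 1 := by exact_mod_cast ha'
    have : -1 < n := by exact_mod_cast hb'
    omega
  rw [hn, hn0]; simp

theorem polar_pow_mul {ε t : ℂ} {η φ : ℝ} (hε : ε = ‖ε‖ * exp (η * I)) (ht : t = ‖t‖ * exp (φ * I))
    (lam : ℕ) : ε ^ lam * t = ‖ε ^ lam * t‖ * exp (((lam * η + φ : ℝ) : ℂ) * I) := by
  have h1 : ε ^ lam = (‖ε‖ : ℂ) ^ lam * exp (lam * (η * I)) := by
    conv_lhs => rw [hε]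
    rw [mul_pow, ← exp_nat_mul]
  rw [norm_mul, norm_pow]
  conv_lhs => rw [h1, ht]
  push_cast
  rw [add_mul, exp_add, mul_assoc (lam : ℂ)]
  ring

/-- The real part of `(e^{iξ} / T)^k` for `arg T = θ`. -/
theorem re_exp_div_pow {T : ℂ} {θ : ℝ} (hT : T = ‖T‖ * exp (θ * I)) (ξ : ℝ) (k : ℕ) :
    ((exp (ξ * I) / T) ^ k).re = Real.cos (k * ξ - k * θ) / ‖T‖ ^ k := by
  have h : (exp (ξ * I) / T) ^ k =
      (((‖T‖ ^ k)⁻¹ : ℝ) : ℂ) * exp (((k * ξ - k * θ : ℝ) : ℂ) * I) := by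
    conv_lhs => rw [hT]
    rw [div_mul_eq_div_div_swap, ← exp_sub, div_pow, ← exp_nat_mul, div_eq_inv_mul]
    push_cast
    congr 2
    ring
  rw [h, re_ofReal_mul, exp_ofReal_mul_I_re, div_eq_inv_mul]

/-- The margin `δ` in the direction condition gives the uniform decay constant `sin δ = cos(π/2 -
δ)`. -/
theorem sin_le_cos_of_mem {θ δ : ℝ} (hδ : 0 < δ)
    (h : θ ∈ Ioo (-(Real.pi / 2) + δ) (Real.pi / 2 - δ)) : Real.sin δ ≤ Real.cos θ := by
  rw [← Real.cos_pi_div_two_sub, ← Real.cos_abs θ]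
  have hp := Real.pi_pos
  exact Real.cos_le_cos_of_nonneg_of_le_pi (abs_nonneg _) (by linarith)
    (abs_le.2 ⟨by linarith [h.1], h.2.le⟩)

/-- An element of the interval forces `δ < π/2`. -/
theorem sin_pos_of_mem {θ δ : ℝ} (hδ : 0 < δ)
    (h : θ ∈ Ioo (-(Real.pi / 2) + δ) (Real.pi / 2 - δ)) : 0 < Real.sin δ := by
  have h1 := h.1
  have h2 := h.2
  exact Real.sin_pos_of_pos_of_lt_pi hδ (by linarith [Real.pi_pos])

/-! ### Ray integrals -/

theorem rayIntegrand_eq (k₁ k₂ : ℕ) (g : ℂ → ℂ) (γ : ℝ) (T₁ T₂ : ℂ) (r : ℝ) :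
    rayIntegrand k₁ k₂ g γ T₁ T₂ r = g (r * exp (γ * I)) * (r : ℂ)⁻¹ *
      exp (-((r : ℂ) ^ k₁ * (exp (γ * I) / T₁) ^ k₁) -
        (r : ℂ) ^ k₂ * (exp (γ * I) / T₂) ^ k₂) := by
  rw [rayIntegrand, mul_div_assoc, mul_div_assoc, mul_pow, mul_pow]
  ring

theorem rayIntegrand_mul_exp (k₁ k₂ : ℕ) (ω : ℂ → ℝ → ℂ) (γ : ℝ) (T₁ T₂ z : ℂ) (p : ℝ × ℝ) :
    rayIntegrand k₁ k₂ (fun τ => ω τ p.1) γ T₁ T₂ p.2 * exp (I * z * p.1) =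
      laplaceIntegrand k₁ k₂ (fun r m => ω (r * exp (γ * I)) m) ((exp (γ * I) / T₁) ^ k₁)
        ((exp (γ * I) / T₂) ^ k₂) z p := by
  rw [rayIntegrand_eq, laplaceIntegrand, exp_add]
  ring

theorem invFourier_rayIntegral (k₁ k₂ : ℕ) (ω : ℂ → ℝ → ℂ) (γ : ℝ) (T₁ T₂ z : ℂ)
    (hi : Integrable (laplaceIntegrand k₁ k₂ (fun r m => ω (r * exp (γ * I)) m)
      ((exp (γ * I) / T₁) ^ k₁) ((exp (γ * I) / T₂) ^ k₂) z) stripMeasure) :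
    invFourier (fun m => rayIntegral k₁ k₂ (fun τ => ω τ m) γ T₁ T₂) z =
      laplace k₁ k₂ (fun r m => ω (r * exp (γ * I)) m) ((exp (γ * I) / T₁) ^ k₁)
        ((exp (γ * I) / T₂) ^ k₂) z := by
  rw [invFourier, laplace, integral_prod _ hi]
  congr 2
  ext m
  rw [rayIntegral, ← integral_mul_const]
  congr 1
  ext r
  exact rayIntegrand_mul_exp k₁ k₂ ω γ T₁ T₂ z (m, r)

theorem rayIntegral_congr_direction {γ γ' : ℝ} (h : exp (γ * I) = exp (γ' * I)) (k₁ k₂ : ℕ)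
    (g : ℂ → ℂ) (T₁ T₂ : ℂ) :
    rayIntegral k₁ k₂ g γ T₁ T₂ = rayIntegral k₁ k₂ g γ' T₁ T₂ := by
  simp only [rayIntegral, rayIntegrand, h]

/-- The function `g(u) exp(-(u/T₁)^{k₁} - (u/T₂)^{k₂})` on the half-line of direction `y`. -/
theorem norm_mul_exp_ray_le {k₁ k₂ : ℕ} {g : ℂ → ℂ} {y r M c X : ℝ} {T₁ T₂ : ℂ} (hr : 0 < r)
    (h₁ : -M ≤ ((exp (y * I) / T₁) ^ k₁).re) (h₂ : c ≤ ((exp (y * I) / T₂) ^ k₂).re)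
    (hg : ‖g (r * exp (y * I))‖ ≤ X) :
    ‖g (r * exp (y * I)) * exp (-(r * exp (y * I) / T₁) ^ k₁ - (r * exp (y * I) / T₂) ^ k₂)‖ ≤
      X * Real.exp (M * r ^ k₁ - c * r ^ k₂) := by
  have h := norm_exp_laplace_le k₁ k₂ (m := 0) (b := 0) (z := 0) hr h₁ h₂ (by simp)
  simp only [mul_zero, ofReal_zero, add_zero, abs_zero, Real.exp_zero, mul_one] at h
  rw [norm_mul, mul_div_assoc, mul_div_assoc, mul_pow, mul_pow]
  have := (norm_nonneg _).trans hg
  gcongr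

/-- Rotation of the half-line in a ray integral. -/
theorem rayIntegral_eq_of_rotation {k₁ k₂ : ℕ} {k' : ℝ} (hk : Exponents k₁ k₂ k') {g : ℂ → ℂ}
    {a b B A M c : ℝ} {T₁ T₂ : ℂ} (hc : 0 < c)
    (hg : ∀ r : ℝ, 0 < r → ∀ y ∈ uIcc a b, DifferentiableAt ℂ g (r * exp (y * I)))
    (hB : ∀ r : ℝ, 0 < r → ∀ y ∈ uIcc a b,
      ‖g (r * exp (y * I))‖ ≤ B * (r * Real.exp (A * r ^ k')))
    (h₁ : ∀ y ∈ uIcc a b, -M ≤ ((exp (y * I) / T₁) ^ k₁).re)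
    (h₂ : ∀ y ∈ uIcc a b, c ≤ ((exp (y * I) / T₂) ^ k₂).re) :
    rayIntegral k₁ k₂ g a T₁ T₂ = rayIntegral k₁ k₂ g b T₁ T₂ := by
  obtain ⟨N, hN, H⟩ := exists_exponent_le hk A M hc
  have hB0 : 0 ≤ B := nonneg_of_mul_nonneg_left
    ((norm_nonneg _).trans (hB 1 one_pos a left_mem_uIcc)) (by positivity)
  refine integral_ray_eq_integral_ray (B := B * Real.exp N)
    (G := fun u => g u * exp (-(u / T₁) ^ k₁ - (u / T₂) ^ k₂)) (fun r hr y hy => ?_)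
    (fun r hr y hy => ?_)
  · exact (hg r hr y hy).mul (by fun_prop)
  · refine (norm_mul_exp_ray_le hr (h₁ y hy) (h₂ y hy) (hB r hr y hy)).trans ?_
    calc B * (r * Real.exp (A * r ^ k')) * Real.exp (M * r ^ k₁ - c * r ^ k₂)
        = B * r * Real.exp (A * r ^ k' + M * r ^ k₁ - c * r ^ k₂) := by
          rw [mul_assoc, mul_assoc r, ← Real.exp_add]; ring_nf
      _ ≤ B * r * Real.exp (N - r) := by
          have := Real.exp_le_exp.2 (H r hr.le)
          gcongr B * r * ?_
      _ = _ := by rw [sub_eq_add_neg, Real.exp_add]; ring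

end OuterPDE

namespace OuterPDE

/-! ### Norm estimates -/

theorem integrableOn_exp_neg_sub {k₁ k₂ : ℕ} {c₁ c₂ : ℝ} (hc₁ : 0 ≤ c₁) (hc₂ : 0 ≤ c₂) :
    IntegrableOn (fun r : ℝ => Real.exp (-r - (c₁ * r ^ k₁ + c₂ * r ^ k₂))) (Ioi 0) := by
  refine (integrableOn_exp_neg_Ioi 0).mono' (Continuous.aestronglyMeasurable (by fun_prop)) ?_
  filter_upwards [ae_restrict_mem measurableSet_Ioi] with r hr
  have hr : 0 < r := hr
  rw [Real.norm_of_nonneg (Real.exp_pos _).le, Real.exp_le_exp]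
  have : 0 ≤ c₁ * r ^ k₁ + c₂ * r ^ k₂ := by positivity
  linarith

/-- Of the decay in `s₂`, the fixed part `c` pays for the growth `e^{A r^{k'}}` and still leaves
`e^{-r}`. The surplus `c₁`, `c₂` stays visible under the integral: with `c₁ = c₂ = 0` this is
boundedness, and letting one of them tend to infinity gives the vanishing initial data. -/
theorem exists_norm_laplace_le {k₁ k₂ : ℕ} {k' β β' c : ℝ} (hk : Exponents k₁ k₂ k') (A : ℝ)
    (hβ : β' < β) (hc : 0 < c) :
    ∃ D : ℝ, 0 ≤ D ∧ ∀ (B : ℝ) (G : ℝ → ℝ → ℂ),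
      (∀ r m : ℝ, 0 < r → ‖G r m‖ ≤ B * Real.exp (-(β * |m|)) * (r * Real.exp (A * r ^ k'))) →
      ∀ (c₁ c₂ : ℝ) (s₁ s₂ z : ℂ), 0 ≤ c₁ → 0 ≤ c₂ → c₁ ≤ s₁.re → c + c₂ ≤ s₂.re → |z.im| ≤ β' →
      ‖laplace k₁ k₂ G s₁ s₂ z‖ ≤
        B * D * ∫ r in Ioi (0 : ℝ), Real.exp (-r - (c₁ * r ^ k₁ + c₂ * r ^ k₂)) := by
  obtain ⟨N, hN, H⟩ := exists_exponent_le hk A 0 hc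
  set J : ℝ := ∫ m : ℝ, Real.exp (-((β - β') * |m|)) with hJ
  have hJ0 : 0 ≤ J := integral_nonneg fun m => (Real.exp_pos _).le
  set s : ℝ := (Real.sqrt (2 * Real.pi))⁻¹ with hs
  have hs0 : 0 ≤ s := by positivity
  refine ⟨s * Real.exp N * J, by positivity, fun B G hG c₁ c₂ s₁ s₂ z hc₁ hc₂ h₁ h₂ hz => ?_⟩
  have hB : 0 ≤ B := by
    have := (norm_nonneg _).trans (hG 1 0 one_pos)
    rw [mul_assoc] at this
    exact nonneg_of_mul_nonneg_left this (by positivity)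
  rw [laplace, norm_mul, norm_real, Real.norm_of_nonneg hs0]
  have hi := ((integrable_exp_neg_mul_abs (sub_pos.2 hβ)).mul_prod
    (integrableOn_exp_neg_sub (k₁ := k₁) (k₂ := k₂) hc₁ hc₂)).const_mul (B * Real.exp N)
  have hle : ‖∫ p, laplaceIntegrand k₁ k₂ G s₁ s₂ z p ∂stripMeasure‖ ≤ B * Real.exp N *
      (J * ∫ r in Ioi (0 : ℝ), Real.exp (-r - (c₁ * r ^ k₁ + c₂ * r ^ k₂))) := by
    refine (norm_integral_le_of_norm_le hi ?_).trans (le_of_eq ?_)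
    · filter_upwards [ae_stripMeasure] with p hp
      obtain ⟨m, r⟩ := p
      simp only at hp ⊢
      rw [laplaceIntegrand, norm_mul, norm_mul, norm_inv, norm_real, Real.norm_of_nonneg hp.le]
      calc _ ≤ (B * Real.exp (-(β * |m|)) * (r * Real.exp (A * r ^ k'))) * r⁻¹ *
            (Real.exp (-c₁ * r ^ k₁ - (c + c₂) * r ^ k₂) * Real.exp (β' * |m|)) := by
            gcongr
            · exact hG r m hp
            · exact norm_exp_laplace_le k₁ k₂ hp (by linarith) h₂ hz
        _ = B * (Real.exp (-(β * |m|)) * Real.exp (β' * |m|)) *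
            (Real.exp (A * r ^ k') * Real.exp (-c₁ * r ^ k₁ - (c + c₂) * r ^ k₂)) := by
            field_simp
        _ = B * Real.exp (-((β - β') * |m|)) *
            Real.exp ((A * r ^ k' + 0 * r ^ k₁ - c * r ^ k₂) - (c₁ * r ^ k₁ + c₂ * r ^ k₂)) := by
            rw [← Real.exp_add, ← Real.exp_add]; ring_nf
        _ ≤ B * Real.exp (-((β - β') * |m|)) *
            Real.exp ((N - r) - (c₁ * r ^ k₁ + c₂ * r ^ k₂)) := by
            have := Real.exp_le_exp.2 (sub_le_sub_right (H r hp.le) (c₁ * r ^ k₁ + c₂ * r ^ k₂))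
            gcongr B * Real.exp (-((β - β') * |m|)) * ?_
        _ = _ := by
            rw [show (N - r) - (c₁ * r ^ k₁ + c₂ * r ^ k₂) =
              N + (-r - (c₁ * r ^ k₁ + c₂ * r ^ k₂)) by ring, Real.exp_add]
            ring
    · rw [integral_const_mul]
      congr 1
      exact integral_prod_mul (fun m : ℝ => Real.exp (-((β - β') * |m|)))
        (fun r : ℝ => Real.exp (-r - (c₁ * r ^ k₁ + c₂ * r ^ k₂)))
  calc _ ≤ s * (B * Real.exp N *
        (J * ∫ r in Ioi (0 : ℝ), Real.exp (-r - (c₁ * r ^ k₁ + c₂ * r ^ k₂)))) := by gcongr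
    _ = _ := by ring

theorem integral_exp_neg_sub_le {k₁ k₂ : ℕ} {c₁ c₂ : ℝ} (hc₁ : 0 ≤ c₁) (hc₂ : 0 ≤ c₂) :
    ∫ r in Ioi (0 : ℝ), Real.exp (-r - (c₁ * r ^ k₁ + c₂ * r ^ k₂)) ≤ 1 := by
  rw [← integral_exp_neg_Ioi_zero]
  refine setIntegral_mono_on (integrableOn_exp_neg_sub hc₁ hc₂) (integrableOn_exp_neg_Ioi 0)
    measurableSet_Ioi fun r hr => ?_
  have hr : 0 < r := hr
  rw [Real.exp_le_exp]
  have : 0 ≤ c₁ * r ^ k₁ + c₂ * r ^ k₂ := by positivity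
  linarith

/-- Dominated convergence with majorant `e^{-r}`. -/
theorem tendsto_integral_exp_neg_sub {f : ℝ → ℝ → ℝ} (hf : ∀ c, Continuous (f c))
    (hf0 : ∀ c, 0 ≤ c → ∀ r, 0 < r → 0 ≤ f c r)
    (hlim : ∀ r, 0 < r → Tendsto (fun c => f c r) atTop atTop) :
    Tendsto (fun c => ∫ r in Ioi (0 : ℝ), Real.exp (-r - f c r)) atTop (𝓝 0) := by
  have h : Tendsto (fun c => ∫ r in Ioi (0 : ℝ), Real.exp (-r - f c r)) atTop
      (𝓝 (∫ r in Ioi (0 : ℝ), (0 : ℝ))) := by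
    refine tendsto_integral_filter_of_dominated_convergence (fun r => Real.exp (-r)) ?_ ?_
      (integrableOn_exp_neg_Ioi 0) ?_
    · refine Eventually.of_forall fun c => Continuous.aestronglyMeasurable ?_
      have := hf c
      fun_prop
    · filter_upwards [eventually_ge_atTop 0] with c hc
      filter_upwards [ae_restrict_mem measurableSet_Ioi] with r hr
      rw [Real.norm_of_nonneg (Real.exp_pos _).le, Real.exp_le_exp]
      linarith [hf0 c hc r hr]
    · filter_upwards [ae_restrict_mem measurableSet_Ioi] with r hr
      refine Real.tendsto_exp_atBot.comp ?_
      exact tendsto_atBot_add_const_left _ (-r) (tendsto_neg_atTop_atBot.comp (hlim r hr))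
  simpa using h

namespace Equation

variable {e : Equation}

/-! ### The outer solutions -/

section Direction

variable {T₁ T₂ E S : Sector} {δ φ₁ φ₂ η ξ ξ' : ℝ} {t₁ t₂ ε : ℂ}

theorem GoodDirection.sin_pos (hδ : 0 < δ) (h : e.GoodDirection S δ φ₁ φ₂ η ξ) :
    0 < Real.sin δ := sin_pos_of_mem hδ h.2.1

theorem mul_sub_mem_Ioo_of_mem_uIcc {y : ℝ} (hy : y ∈ uIcc ξ ξ') (k : ℕ) {c a b : ℝ}
    (h1 : k * ξ - c ∈ Ioo a b) (h2 : k * ξ' - c ∈ Ioo a b) : k * y - c ∈ Ioo a b := by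
  have hk : (0 : ℝ) ≤ k := Nat.cast_nonneg k
  rcases mem_uIcc.1 hy with ⟨ha, hb⟩ | ⟨ha, hb⟩
  · have := mul_le_mul_of_nonneg_left ha hk
    have := mul_le_mul_of_nonneg_left hb hk
    exact ⟨by linarith [h1.1], by linarith [h2.2]⟩
  · have := mul_le_mul_of_nonneg_left ha hk
    have := mul_le_mul_of_nonneg_left hb hk
    exact ⟨by linarith [h2.1], by linarith [h1.2]⟩

theorem GoodDirection.of_mem_uIcc (h : e.GoodDirection S δ φ₁ φ₂ η ξ)
    (h' : e.GoodDirection S δ φ₁ φ₂ η ξ') {y : ℝ} (hy : y ∈ uIcc ξ ξ') :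
    e.GoodDirection S δ φ₁ φ₂ η y := by
  refine ⟨?_, mul_sub_mem_Ioo_of_mem_uIcc hy _ h.2.1 h'.2.1,
    mul_sub_mem_Ioo_of_mem_uIcc hy _ h.2.2 h'.2.2⟩
  have := mul_sub_mem_Ioo_of_mem_uIcc hy 1 (c := 0) (a := S.dir - S.opening / 2)
    (b := S.dir + S.opening / 2)
    (by simpa [Sector.angles] using h.1) (by simpa [Sector.angles] using h'.1)
  simpa [Sector.angles] using this

theorem le_re_exp_div_pow {t ε : ℂ} {η φ ξ : ℝ} {k lam : ℕ} (hδ : 0 < δ)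
    (hε : ε = ‖ε‖ * exp (η * I)) (ht : t = ‖t‖ * exp (φ * I))
    (h : k * ξ - k * (lam * η + φ) ∈ Ioo (-(Real.pi / 2) + δ) (Real.pi / 2 - δ)) :
    Real.sin δ / ‖ε ^ lam * t‖ ^ k ≤ ((exp (ξ * I) / (ε ^ lam * t)) ^ k).re := by
  rw [re_exp_div_pow (polar_pow_mul hε ht lam)]
  gcongr
  exact sin_le_cos_of_mem hδ h

theorem GoodDirection.le_re₁ (hδ : 0 < δ) (h : e.GoodDirection S δ φ₁ φ₂ η ξ)
    (h₁ : T₁.HasAngle t₁ φ₁) (hε : E.HasAngle ε η) :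
    Real.sin δ / ‖ε ^ e.lam₁ * t₁‖ ^ e.k₁ ≤ ((exp (ξ * I) / (ε ^ e.lam₁ * t₁)) ^ e.k₁).re :=
  le_re_exp_div_pow hδ hε.eq h₁.eq h.2.1

theorem GoodDirection.le_re₂ (hδ : 0 < δ) (h : e.GoodDirection S δ φ₁ φ₂ η ξ)
    (h₂ : T₂.HasAngle t₂ φ₂) (hε : E.HasAngle ε η) :
    Real.sin δ / ‖ε ^ e.lam₂ * t₂‖ ^ e.k₂ ≤ ((exp (ξ * I) / (ε ^ e.lam₂ * t₂)) ^ e.k₂).re :=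
  le_re_exp_div_pow hδ hε.eq h₂.eq h.2.2

theorem norm_pow_mul_pos (hε : ε ≠ 0) (ht : t₁ ≠ 0) (lam k : ℕ) : 0 < ‖ε ^ lam * t₁‖ ^ k :=
  pow_pos (norm_pos_iff.2 (mul_ne_zero (pow_ne_zero _ hε) ht)) _

theorem GoodDirection.re₁_nonneg (hδ : 0 < δ) (h : e.GoodDirection S δ φ₁ φ₂ η ξ)
    (h₁ : T₁.HasAngle t₁ φ₁) (hε : E.HasAngle ε η) :
    0 ≤ ((exp (ξ * I) / (ε ^ e.lam₁ * t₁)) ^ e.k₁).re := by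
  refine le_trans ?_ (h.le_re₁ hδ h₁ hε)
  have := h.sin_pos hδ
  positivity

theorem GoodDirection.re₂_pos (hδ : 0 < δ) (h : e.GoodDirection S δ φ₁ φ₂ η ξ)
    (h₂ : T₂.HasAngle t₂ φ₂) (hε : E.HasAngle ε η) :
    0 < ((exp (ξ * I) / (ε ^ e.lam₂ * t₂)) ^ e.k₂).re :=
  lt_of_lt_of_le (div_pos (h.sin_pos hδ) (norm_pow_mul_pos hε.ne_zero h₂.ne_zero _ _))
    (h.le_re₂ hδ h₂ hε)

/-- A direction allowed at a point is allowed at all points nearby. -/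
theorem GoodDirection.exists_open (h : e.GoodDirection S δ φ₁ φ₂ η ξ) (h₁ : T₁.HasAngle t₁ φ₁)
    (h₂ : T₂.HasAngle t₂ φ₂) (hε : E.HasAngle ε η) :
    ∃ V₁ V₂ V : Set ℂ, IsOpen V₁ ∧ IsOpen V₂ ∧ IsOpen V ∧ t₁ ∈ V₁ ∧ t₂ ∈ V₂ ∧ ε ∈ V ∧
      ∀ s₁ ∈ V₁, ∀ s₂ ∈ V₂, ∀ ε' ∈ V, ∃ φ₁' φ₂' η' : ℝ, T₁.HasAngle s₁ φ₁' ∧ T₂.HasAngle s₂ φ₂' ∧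
        E.HasAngle ε' η' ∧ e.GoodDirection S δ φ₁' φ₂' η' ξ := by
  have hopen : IsOpen {p : ℝ × ℝ × ℝ | e.k₁ * ξ - e.k₁ * (e.lam₁ * p.2.2 + p.1) ∈
      Ioo (-(Real.pi / 2) + δ) (Real.pi / 2 - δ) ∧ e.k₂ * ξ - e.k₂ * (e.lam₂ * p.2.2 + p.2.1) ∈
      Ioo (-(Real.pi / 2) + δ) (Real.pi / 2 - δ)} :=
    (isOpen_Ioo.preimage (by fun_prop)).inter (isOpen_Ioo.preimage (by fun_prop))
  have hmem := hopen.mem_nhds (show (φ₁, φ₂, η) ∈ _ from h.2)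
  obtain ⟨N₁, hN₁, N', hN', hsub⟩ := mem_nhds_prod_iff.1 hmem
  obtain ⟨N₂, hN₂, N₃, hN₃, hsub'⟩ := mem_nhds_prod_iff.1 hN'
  -- The argument depends continuously on the point, so the open conditions on angles persist with
  -- `ξ` fixed.
  have key : ∀ {T : Sector} {t : ℂ} {φ : ℝ} {N : Set ℝ}, T.HasAngle t φ → N ∈ 𝓝 φ →
      ∃ V : Set ℂ, IsOpen V ∧ t ∈ V ∧ ∀ s ∈ V, ∃ φ' ∈ N, T.HasAngle s φ' := by
    intro T t φ N hT hN
    have hev := eventually_exists_angle hT.norm_pos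
      (inter_mem hN (T.isOpen_angles.mem_nhds hT.mem))
    rw [← hT.eq] at hev
    obtain ⟨V, hV, hVo, htV⟩ := eventually_nhds_iff.1 hev
    refine ⟨V, hVo, htV, fun s hs => ?_⟩
    obtain ⟨h0, φ', hφ', he⟩ := hV s hs
    exact ⟨φ', hφ'.1, h0, hφ'.2, he⟩
  obtain ⟨V₁, hV₁, htV₁, H₁⟩ := key h₁ hN₁
  obtain ⟨V₂, hV₂, htV₂, H₂⟩ := key h₂ hN₂
  obtain ⟨V, hV, htV, H⟩ := key hε hN₃
  refine ⟨V₁, V₂, V, hV₁, hV₂, hV, htV₁, htV₂, htV, fun s₁ hs₁ s₂ hs₂ ε' hε' => ?_⟩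
  obtain ⟨a₁, ha₁, A₁⟩ := H₁ s₁ hs₁
  obtain ⟨a₂, ha₂, A₂⟩ := H₂ s₂ hs₂
  obtain ⟨a, ha, A⟩ := H ε' hε'
  exact ⟨a₁, a₂, a, A₁, A₂, A, h.1, hsub (mk_mem_prod ha₁ (hsub' (mk_mem_prod ha₂ ha)))⟩

end Direction

theorem MemExp.norm_ray_le (he : e.Assumptions) {S : Sector} {ρ B : ℝ} {w : ℂ → ℝ → ℂ}
    (hw : e.MemExp S ρ B w) {r ξ : ℝ} (hr : 0 < r)
    (hτ : (r : ℂ) * exp (ξ * I) ∈ S.unbounded ∪ Metric.closedBall (0 : ℂ) ρ) (m : ℝ) :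
    ‖w (r * exp (ξ * I)) m‖ ≤
      |B| * Real.exp (-(e.β * |m|)) * (r * Real.exp (e.ν * r ^ e.k')) := by
  have h := hw.norm_le hτ m
  rw [norm_ofReal_mul_exp hr.le, growth] at h
  refine h.trans ?_
  have h1 := weight_le_exp (by linarith [he.one_lt_μ] : 0 ≤ e.μ) e.β m
  have h2 := weight_pos e.μ e.β m
  calc B * (r * Real.exp (e.ν * r ^ e.k')) * weight e.μ e.β m
      ≤ |B| * (r * Real.exp (e.ν * r ^ e.k')) * Real.exp (-(e.β * |m|)) := by
        gcongr; exact le_abs_self B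
    _ = _ := by ring

theorem mem_unbounded_ray {S : Sector} {ξ : ℝ} (hξ : ξ ∈ S.angles) {r : ℝ} (hr : 0 < r) :
    (r : ℂ) * exp (ξ * I) ∈ S.unbounded := ⟨r, hr, ξ, hξ, rfl⟩

theorem isKernel_of_bound {β k' ν B : ℝ} {G : ℝ → ℝ → ℂ} (hν : 0 ≤ ν) (hB : 0 ≤ B)
    (hc : ContinuousOn (fun p : ℝ × ℝ => G p.2 p.1) (univ ×ˢ Ioi 0))
    (hb : ∀ r m : ℝ, 0 < r →
      ‖G r m‖ ≤ B * Real.exp (-(β * |m|)) * (r * Real.exp (ν * r ^ k'))) : IsKernel β k' G := by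
  refine ⟨hc, fun b _ hbβ => ⟨B, ν, hB, hν, fun r m hr => (hb r m hr).trans ?_⟩⟩
  have : b * |m| ≤ β * |m| := by gcongr
  gcongr

theorem MemExp.isKernel (he : e.Assumptions) {S : Sector} {ρ B : ℝ} {w : ℂ → ℝ → ℂ}
    (hw : e.MemExp S ρ B w) {ξ : ℝ} (hξ : ξ ∈ S.angles) :
    IsKernel e.β e.k' fun r m => w (r * exp (ξ * I)) m := by
  refine isKernel_of_bound he.ν_pos.le (abs_nonneg B) ?_ fun r m hr =>
    hw.norm_ray_le he hr (Or.inl (mem_unbounded_ray hξ hr)) m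
  refine hw.cont.comp (f := fun p : ℝ × ℝ => ((p.2 : ℂ) * exp (ξ * I), p.1)) (by fun_prop) ?_
  exact fun p hp => ⟨Or.inl (mem_unbounded_ray hξ hp.2), mem_univ _⟩

theorem IsForcingKernel.norm_ray_le (he : e.Assumptions) {ψ : ℂ → ℝ → ℂ → ℂ} {Cψ : ℝ}
    (hψ : e.IsForcingKernel ψ Cψ) {ε : ℂ} (hε : ε ∈ Metric.ball (0 : ℂ) e.ε₀) {r : ℝ} (hr : 0 < r)
    (ξ m : ℝ) : ‖ψ (r * exp (ξ * I)) m ε‖ ≤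
      Cψ * Real.exp (-(e.β * |m|)) * (r * Real.exp (e.ν * r ^ e.k')) := by
  have h := hψ.bound (r * exp (ξ * I)) m ε hε
  rw [norm_ofReal_mul_exp hr.le] at h
  refine h.trans ?_
  have h1 : 1 ≤ (1 + |m|) ^ e.μ :=
    Real.one_le_rpow (by linarith [abs_nonneg m]) (by linarith [he.one_lt_μ])
  have h2 : Cψ / (1 + |m|) ^ e.μ ≤ Cψ := div_le_self hψ.const_pos.le h1
  calc _ ≤ Cψ * Real.exp (-(e.β * |m|)) * Real.exp (e.ν * r ^ e.k') * r := by gcongr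
    _ = _ := by ring

theorem IsForcingKernel.isKernel (he : e.Assumptions) {ψ : ℂ → ℝ → ℂ → ℂ} {Cψ : ℝ}
    (hψ : e.IsForcingKernel ψ Cψ) {ε : ℂ} (hε : ε ∈ Metric.ball (0 : ℂ) e.ε₀) (ξ : ℝ) :
    IsKernel e.β e.k' fun r m => ψ (r * exp (ξ * I)) m ε := by
  refine isKernel_of_bound he.ν_pos.le hψ.const_pos.le ?_ fun r m hr =>
    hψ.norm_ray_le he hε hr ξ m
  have hb : ∀ τ m, ‖ψ τ m ε‖ ≤ Cψ * e.growth ‖τ‖ := by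
    intro τ m
    refine (hψ.bound τ m ε hε).trans ?_
    have h1 : 1 ≤ (1 + |m|) ^ e.μ :=
      Real.one_le_rpow (by linarith [abs_nonneg m]) (by linarith [he.one_lt_μ])
    have h2 : Cψ / (1 + |m|) ^ e.μ ≤ Cψ := div_le_self hψ.const_pos.le h1
    have h3 : Real.exp (-(e.β * |m|)) ≤ 1 :=
      Real.exp_le_one_iff.2 (by have := mul_nonneg he.β_pos.le (abs_nonneg m); linarith)
    have := hψ.const_pos
    calc _ ≤ Cψ * 1 * Real.exp (e.ν * ‖τ‖ ^ e.k') * ‖τ‖ := by gcongr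
      _ = _ := by rw [growth]; ring
  refine ((continuous_of_entire_of_bound (f := fun τ m => ψ τ m ε)
    (g := fun r => Cψ * e.growth r) ?_ (fun m => hψ.entire m ε hε)
    (fun τ => hψ.cont τ ε hε) hb).comp
    (f := fun p : ℝ × ℝ => ((p.2 : ℂ) * exp (ξ * I), p.1)) (by fun_prop)).continuousOn
  exact fun a ha b hb hab =>
    mul_le_mul_of_nonneg_left (monotoneOn_growth he ha hb hab) hψ.const_pos.le

section Outer

variable {T₁ T₂ E S : Sector} {δ φ₁ φ₂ η ξ ξ' : ℝ} {t₁ t₂ ε : ℂ} {ρ B : ℝ}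

/-- The allowed directions at a point form an interval inside the sector, so the half-line can be
rotated from one to another while `w` stays holomorphic and both exponentials are controlled. -/
theorem rayIntegral_eq_of_goodDirection (he : e.Assumptions) (hδ : 0 < δ) {w : ℂ → ℝ → ℂ}
    (hw : e.MemExp S ρ B w) (h₁ : T₁.HasAngle t₁ φ₁) (h₂ : T₂.HasAngle t₂ φ₂)
    (hε : E.HasAngle ε η) (h : e.GoodDirection S δ φ₁ φ₂ η ξ)
    (h' : e.GoodDirection S δ φ₁ φ₂ η ξ') (m : ℝ) :
    rayIntegral e.k₁ e.k₂ (fun τ => w τ m) ξ (ε ^ e.lam₁ * t₁) (ε ^ e.lam₂ * t₂) =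
      rayIntegral e.k₁ e.k₂ (fun τ => w τ m) ξ' (ε ^ e.lam₁ * t₁) (ε ^ e.lam₂ * t₂) := by
  have hgood := fun y hy => h.of_mem_uIcc h' (y := y) hy
  refine rayIntegral_eq_of_rotation he.exponents (M := 0) (A := e.ν)
    (B := |B| * Real.exp (-(e.β * |m|)))
    (div_pos (h.sin_pos hδ) (norm_pow_mul_pos hε.ne_zero h₂.ne_zero e.lam₂ e.k₂))
    (fun r hr y hy => ?_) (fun r hr y hy => ?_) (fun y hy => ?_) (fun y hy => ?_)
  · exact (hw.holo m).differentiableAt ((S.isOpen_unbounded.union Metric.isOpen_ball).mem_nhds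
      (Or.inl (mem_unbounded_ray (hgood y hy).1 hr)))
  · exact hw.norm_ray_le he hr (Or.inl (mem_unbounded_ray (hgood y hy).1 hr)) m
  · rw [neg_zero]
    exact (hgood y hy).re₁_nonneg hδ h₁ hε
  · exact (hgood y hy).le_re₂ hδ h₂ hε

/-- The forcing term as a Laplace–Fourier integral in an allowed direction. -/
theorem forcing_eq_laplace (he : e.Assumptions) (hδ : 0 < δ) {ψ : ℂ → ℝ → ℂ → ℂ} {Cψ : ℝ}
    (hψ : e.IsForcingKernel ψ Cψ) (hεb : ε ∈ Metric.ball (0 : ℂ) e.ε₀)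
    (h₂ : T₂.HasAngle t₂ φ₂) (hε : E.HasAngle ε η) (h : e.GoodDirection S δ φ₁ φ₂ η ξ) {z : ℂ}
    (hz : z ∈ strip e.β) :
    e.forcing ψ t₁ t₂ z ε = laplace e.k₁ e.k₂ (fun r m => ψ (r * exp (ξ * I)) m ε)
      ((exp (ξ * I) / (ε ^ e.lam₁ * t₁)) ^ e.k₁) ((exp (ξ * I) / (ε ^ e.lam₂ * t₂)) ^ e.k₂) z := by
  set θ : ℝ := e.lam₂ * η + φ₂ with hθ
  set T : ℂ := ε ^ e.lam₂ * t₂ with hT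
  have hT0 : T ≠ 0 := mul_ne_zero (pow_ne_zero _ hε.ne_zero) h₂.ne_zero
  have hpol : T = ‖T‖ * exp (θ * I) := polar_pow_mul hε.eq h₂.eq e.lam₂
  have harg : exp (arg T * I) = exp (θ * I) :=
    exp_eq_of_polar hT0 (norm_mul_exp_arg_mul_I T).symm hpol
  have hs := h.sin_pos hδ
  -- Between `θ` and `ξ` the `k₁`-exponential may grow, but at most like `exp(M r^{k₁})` with `M =
  -- |T₁|^{-k₁}`, which the `k₂`-exponential absorbs. The latter decays throughout because `θ` is
  -- the centre of its interval.
  have hrot : ∀ m, rayIntegral e.k₁ e.k₂ (fun τ => ψ τ m ε) θ (ε ^ e.lam₁ * t₁) T =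
      rayIntegral e.k₁ e.k₂ (fun τ => ψ τ m ε) ξ (ε ^ e.lam₁ * t₁) T := by
    intro m
    refine rayIntegral_eq_of_rotation he.exponents (A := e.ν)
      (B := Cψ * Real.exp (-(e.β * |m|))) (M := (1 / ‖ε ^ e.lam₁ * t₁‖) ^ e.k₁)
      (div_pos hs (norm_pow_mul_pos hε.ne_zero h₂.ne_zero e.lam₂ e.k₂))
      (fun r hr y hy => ?_) (fun r hr y hy => ?_) (fun y hy => ?_) (fun y hy => ?_)
    · exact hψ.entire m ε hεb _
    · exact hψ.norm_ray_le he hεb hr y m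
    · have h3 := (abs_le.1 (abs_re_le_norm ((exp (y * I) / (ε ^ e.lam₁ * t₁)) ^ e.k₁))).1
      rwa [norm_pow, norm_div, norm_exp_ofReal_mul_I] at h3
    · refine le_re_exp_div_pow hδ hε.eq h₂.eq ?_
      have h4 := h.2.2
      have hk : (0 : ℝ) ≤ e.k₂ := Nat.cast_nonneg _
      rw [← hθ] at h4 ⊢
      have hδ2 : δ < Real.pi / 2 := by linarith [h4.1, h4.2]
      rcases mem_uIcc.1 hy with ⟨ha, hb⟩ | ⟨ha, hb⟩
      · have := mul_le_mul_of_nonneg_left ha hk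
        have := mul_le_mul_of_nonneg_left hb hk
        exact ⟨by linarith, by linarith [h4.2]⟩
      · have := mul_le_mul_of_nonneg_left ha hk
        have := mul_le_mul_of_nonneg_left hb hk
        exact ⟨by linarith [h4.1], by linarith⟩
  have hfun : (fun m => e.forcingF ψ (ε ^ e.lam₁ * t₁) T m ε) =
      fun m => rayIntegral e.k₁ e.k₂ (fun τ => ψ τ m ε) ξ (ε ^ e.lam₁ * t₁) T := by
    ext m
    rw [forcingF, rayIntegral_congr_direction harg, hrot]
  rw [forcing, hfun]
  exact invFourier_rayIntegral e.k₁ e.k₂ (fun τ m => ψ τ m ε) ξ _ _ z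
    ((hψ.isKernel he hεb ξ).integrable he.exponents (h.re₂_pos hδ h₂ hε) hz)

open Classical in
/-- The outer solution: the Laplace–Fourier integral of `ω` in an allowed direction. -/
noncomputable def outerSolution (e : Equation) (δ : ℝ) (T₁ T₂ E S : Sector) (ω : ℂ → ℝ → ℂ → ℂ)
    (t₁ t₂ z ε : ℂ) : ℂ :=
  if h : ∃ ξ φ₁ φ₂ η : ℝ, T₁.HasAngle t₁ φ₁ ∧ T₂.HasAngle t₂ φ₂ ∧ E.HasAngle ε η ∧
      e.GoodDirection S δ φ₁ φ₂ η ξ then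
    invFourier (fun m => rayIntegral e.k₁ e.k₂ (fun τ => ω τ m ε) h.choose (ε ^ e.lam₁ * t₁)
      (ε ^ e.lam₂ * t₂)) z
  else 0

/-- The angles chosen in `outerSolution` are the given ones by uniqueness of arguments, and the
choice of direction does not affect the ray integrals. -/
theorem outerSolution_eq (he : e.Assumptions) (hδ : 0 < δ) {ω : ℂ → ℝ → ℂ → ℂ}
    (hw : e.MemExp S ρ B fun τ m => ω τ m ε) (h₁ : T₁.HasAngle t₁ φ₁) (h₂ : T₂.HasAngle t₂ φ₂)
    (hε : E.HasAngle ε η) (h : e.GoodDirection S δ φ₁ φ₂ η ξ) (z : ℂ) :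
    e.outerSolution δ T₁ T₂ E S ω t₁ t₂ z ε = invFourier (fun m =>
      rayIntegral e.k₁ e.k₂ (fun τ => ω τ m ε) ξ (ε ^ e.lam₁ * t₁) (ε ^ e.lam₂ * t₂)) z := by
  have hex : ∃ ξ φ₁ φ₂ η : ℝ, T₁.HasAngle t₁ φ₁ ∧ T₂.HasAngle t₂ φ₂ ∧ E.HasAngle ε η ∧
      e.GoodDirection S δ φ₁ φ₂ η ξ := ⟨ξ, φ₁, φ₂, η, h₁, h₂, hε, h⟩
  rw [outerSolution, dif_pos hex]
  obtain ⟨φ₁', φ₂', η', h₁', h₂', hε', h'⟩ := hex.choose_spec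
  rw [h₁'.unique h₁, h₂'.unique h₂, hε'.unique hε] at h'
  congr 1
  ext m
  exact rayIntegral_eq_of_goodDirection he hδ hw h₁ h₂ hε h' h m

theorem outerSolution_eq_laplace (he : e.Assumptions) (hδ : 0 < δ) {ω : ℂ → ℝ → ℂ → ℂ}
    (hw : e.MemExp S ρ B fun τ m => ω τ m ε) (h₁ : T₁.HasAngle t₁ φ₁) (h₂ : T₂.HasAngle t₂ φ₂)
    (hε : E.HasAngle ε η) (h : e.GoodDirection S δ φ₁ φ₂ η ξ) {z : ℂ} (hz : z ∈ strip e.β) :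
    e.outerSolution δ T₁ T₂ E S ω t₁ t₂ z ε =
      laplace e.k₁ e.k₂ (fun r m => ω (r * exp (ξ * I)) m ε)
      ((exp (ξ * I) / (ε ^ e.lam₁ * t₁)) ^ e.k₁) ((exp (ξ * I) / (ε ^ e.lam₂ * t₂)) ^ e.k₂) z := by
  rw [outerSolution_eq he hδ hw h₁ h₂ hε h]
  exact invFourier_rayIntegral e.k₁ e.k₂ (fun τ m => ω τ m ε) ξ _ _ z
    ((hw.isKernel he h.1).integrable he.exponents (h.re₂_pos hδ h₂ hε) hz)

theorem exp_div_mul_pow (ξ : ℝ) (ε t : ℂ) (lam k : ℕ) :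
    (exp (ξ * I) / (ε ^ lam * t)) ^ k = (exp (ξ * I) / ε ^ lam) ^ k / t ^ k := by
  rw [← div_div, div_pow]

/-- The outer solution solves the main equation. -/
theorem solvesAt_outerSolution (he : e.Assumptions) (hδ : 0 < δ) {ω : ℂ → ℝ → ℂ → ℂ}
    (hw : e.MemExp S ρ B fun τ m => ω τ m ε) {ψ : ℂ → ℝ → ℂ → ℂ} {Cψ : ℝ}
    (hψ : e.IsForcingKernel ψ Cψ) (hεb : ε ∈ Metric.ball (0 : ℂ) e.ε₀)
    (hsol : e.SolvesBorel S ρ ψ ε fun τ m => ω τ m ε) (h₁ : T₁.HasAngle t₁ φ₁)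
    (h₂ : T₂.HasAngle t₂ φ₂) (hε : E.HasAngle ε η) (h : e.GoodDirection S δ φ₁ φ₂ η ξ) {z : ℂ}
    (hz : z ∈ strip e.β) :
    e.SolvesAt ψ (e.outerSolution δ T₁ T₂ E S ω) t₁ t₂ z ε := by
  -- On these neighbourhoods one fixed `ξ` represents the solution, so derivatives may be taken
  -- under the integral.
  obtain ⟨V₁, V₂, V, hV₁, hV₂, hV, ht₁, ht₂, hεV, H⟩ := h.exists_open h₁ h₂ hε
  have hV : e.IsTimeDomain ((exp (ξ * I) / ε ^ e.lam₂) ^ e.k₂) V₁ V₂ := by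
    refine ⟨hV₁, hV₂, fun s hs => ?_, fun s hs => ?_, fun s hs => ?_⟩
    · obtain ⟨_, _, _, h, _⟩ := H s hs t₂ ht₂ ε hεV
      exact h.ne_zero
    · obtain ⟨_, _, _, _, h, _⟩ := H t₁ ht₁ s hs ε hεV
      exact h.ne_zero
    · obtain ⟨_, _, _, _, h2, h3, h4⟩ := H t₁ ht₁ s hs ε hεV
      rw [← exp_div_mul_pow]
      exact h4.re₂_pos hδ h2 h3
  refine solvesAt_of_isLaplace he hεb hε.ne_zero rfl rfl hV (ω := fun τ m => ω τ m ε)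
    (hw.isKernel he h.1) ?_ (hψ.isKernel he hεb ξ) (fun r hr m => ?_) ht₁ ht₂ hz ?_
  · intro s₁ hs₁ s₂ hs₂ w hz'
    obtain ⟨_, _, _, g1, g2, g3, g4⟩ := H s₁ hs₁ s₂ hs₂ ε hεV
    rw [outerSolution_eq_laplace he hδ hw g1 g2 g3 g4 hz', exp_div_mul_pow, exp_div_mul_pow,
      Pi.one_apply, one_mul]
  · exact hsol _ (Or.inl (mem_unbounded_ray h.1 hr)) m
  · rw [forcing_eq_laplace he hδ hψ hεb h₂ hε h hz, exp_div_mul_pow, exp_div_mul_pow]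

/-- The outer solution is holomorphic. -/
theorem differentiableAt_outerSolution (he : e.Assumptions) (hδ : 0 < δ) {ω : ℂ → ℝ → ℂ → ℂ}
    {ε₁ : ℝ} (hw : ∀ ε ∈ Metric.ball (0 : ℂ) ε₁, e.MemExp S ρ B fun τ m => ω τ m ε)
    (hholo : ∀ τ ∈ S.unbounded, ∀ m : ℝ,
      DifferentiableOn ℂ (fun ε => ω τ m ε) (Metric.ball (0 : ℂ) ε₁))
    (hεb : ε ∈ Metric.ball (0 : ℂ) ε₁) (h₁ : T₁.HasAngle t₁ φ₁)
    (h₂ : T₂.HasAngle t₂ φ₂) (hε : E.HasAngle ε η) (h : e.GoodDirection S δ φ₁ φ₂ η ξ) {z : ℂ}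
    (hz : z ∈ strip e.β) :
    DifferentiableAt ℂ (fun p : ℂ × ℂ × ℂ × ℂ =>
      e.outerSolution δ T₁ T₂ E S ω p.1 p.2.1 p.2.2.1 p.2.2.2) (t₁, t₂, z, ε) := by
  obtain ⟨V₁, V₂, V, hV₁, hV₂, hV, ht₁, ht₂, hεV, H⟩ := h.exists_open h₁ h₂ hε
  obtain ⟨b, hb1, hb2⟩ := exists_between (show |z.im| < e.β from hz)
  set c : ℝ := ((exp (ξ * I) / (ε ^ e.lam₂ * t₂)) ^ e.k₂).re with hc
  have hc0 : 0 < c := h.re₂_pos hδ h₂ hε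
  let s : ℂ × ℂ × ℂ × ℂ → ℂ := fun p => (exp (ξ * I) / (p.2.2.2 ^ e.lam₂ * p.2.1)) ^ e.k₂
  let s' : ℂ × ℂ × ℂ × ℂ → ℂ := fun p => (exp (ξ * I) / (p.2.2.2 ^ e.lam₁ * p.1)) ^ e.k₁
  have hsd : ∀ p : ℂ × ℂ × ℂ × ℂ, p.2.1 ≠ 0 → p.2.2.2 ≠ 0 → DifferentiableAt ℂ s p := by
    intro p h1 h2
    have h3 : p.2.2.2 ^ e.lam₂ * p.2.1 ≠ 0 := mul_ne_zero (pow_ne_zero _ h2) h1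
    have h4 : DifferentiableAt ℂ (fun p : ℂ × ℂ × ℂ × ℂ => exp (ξ * I) /
        (p.2.2.2 ^ e.lam₂ * p.2.1)) p := by
      have h5 : DifferentiableAt ℂ (fun p : ℂ × ℂ × ℂ × ℂ => p.2.2.2 ^ e.lam₂ * p.2.1) p := by
        fun_prop
      simpa only [div_eq_mul_inv] using (h5.fun_inv h3).const_mul (exp (ξ * I))
    exact h4.pow _
  have hsd' : ∀ p : ℂ × ℂ × ℂ × ℂ, p.1 ≠ 0 → p.2.2.2 ≠ 0 → DifferentiableAt ℂ s' p := by
    intro p h1 h2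
    have h3 : p.2.2.2 ^ e.lam₁ * p.1 ≠ 0 := mul_ne_zero (pow_ne_zero _ h2) h1
    have h4 : DifferentiableAt ℂ (fun p : ℂ × ℂ × ℂ × ℂ => exp (ξ * I) /
        (p.2.2.2 ^ e.lam₁ * p.1)) p := by
      have h5 : DifferentiableAt ℂ (fun p : ℂ × ℂ × ℂ × ℂ => p.2.2.2 ^ e.lam₁ * p.1) p := by
        fun_prop
      simpa only [div_eq_mul_inv] using (h5.fun_inv h3).const_mul (exp (ξ * I))
    exact h4.pow _
  -- On `U` the real part of `s₂` exceeds `c/2` and `|Im z| < b < β`, so one integrable function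
  -- dominates all integrands.
  set U : Set (ℂ × ℂ × ℂ × ℂ) :=
    (V₁ ×ˢ V₂ ×ˢ {w : ℂ | |w.im| < b} ×ˢ (V ∩ Metric.ball (0 : ℂ) ε₁)) ∩ {p | c / 2 < (s p).re}
    with hU
  have hbo : IsOpen {w : ℂ | |w.im| < b} := isOpen_lt continuous_im.abs continuous_const
  have hUn : U ∈ 𝓝 (t₁, t₂, z, ε) := by
    refine inter_mem (prod_mem_nhds (hV₁.mem_nhds ht₁) (prod_mem_nhds (hV₂.mem_nhds ht₂)
      (prod_mem_nhds (hbo.mem_nhds hb1) ((hV.inter Metric.isOpen_ball).mem_nhds ⟨hεV, hεb⟩)))) ?_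
    have hcont : ContinuousAt (fun p => (s p).re) (t₁, t₂, z, ε) :=
      continuous_re.continuousAt.comp (hsd _ h₂.ne_zero hε.ne_zero).continuousAt
    exact hcont.eventually (isOpen_Ioi.mem_nhds (half_lt_self hc0))
  have hUeq : ∀ p ∈ U, e.outerSolution δ T₁ T₂ E S ω p.1 p.2.1 p.2.2.1 p.2.2.2 =
      laplace e.k₁ e.k₂ (fun r m => ω (r * exp (ξ * I)) m p.2.2.2) (s' p) (s p) p.2.2.1 ∧
      p.1 ≠ 0 ∧ p.2.1 ≠ 0 ∧ p.2.2.2 ≠ 0 ∧ 0 ≤ (s' p).re := by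
    rintro ⟨p₁, p₂, w, ε'⟩ ⟨⟨hp₁, hp₂, hw', hε', hεb'⟩, -⟩
    obtain ⟨_, _, _, g1, g2, g3, g4⟩ := H p₁ hp₁ p₂ hp₂ ε' hε'
    exact ⟨outerSolution_eq_laplace he hδ (hw ε' hεb') g1 g2 g3 g4
      (show |w.im| < e.β from lt_trans hw' hb2), g1.ne_zero, g2.ne_zero, g3.ne_zero,
      g4.re₁_nonneg hδ g1 g3⟩
  obtain ⟨N, hN, Hb⟩ := exists_laplaceIntegrand_le he.exponents e.ν 0 b e.β (half_pos hc0)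
  have hd : DifferentiableAt ℂ (fun p : ℂ × ℂ × ℂ × ℂ => ∫ q, laplaceIntegrand e.k₁ e.k₂
      (fun r m => ω (r * exp (ξ * I)) m p.2.2.2) (s' p) (s p) p.2.2.1 q ∂stripMeasure)
      (t₁, t₂, z, ε) := by
    refine differentiableAt_integral_of_dominated hUn
      ((integrable_stripMeasure_exp (sub_pos.2 hb2)).const_mul (|B| * N)) ?_ ?_ ?_
    · rintro p hp
      exact aestronglyMeasurable_stripMeasure
        (((hw _ hp.1.2.2.2.2).isKernel he h.1).continuousOn_laplaceIntegrand _ _ _)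
    · filter_upwards [ae_stripMeasure] with q hq p hp
      obtain ⟨-, g1, g2, g3, -⟩ := hUeq p hp
      have d1 := hsd p g2 g3
      have d2 := hsd' p g1 g3
      have d3 : DifferentiableAt ℂ (fun p : ℂ × ℂ × ℂ × ℂ =>
          ω (q.2 * exp (ξ * I)) q.1 p.2.2.2) p :=
        DifferentiableAt.comp (f := fun p : ℂ × ℂ × ℂ × ℂ => p.2.2.2)
          (g := fun ε => ω (q.2 * exp (ξ * I)) q.1 ε) p
          ((hholo _ (mem_unbounded_ray h.1 hq) q.1).differentiableAt
            (Metric.isOpen_ball.mem_nhds hp.1.2.2.2.2)) (by fun_prop)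
      unfold laplaceIntegrand
      have d4 : DifferentiableAt ℂ (fun p : ℂ × ℂ × ℂ × ℂ => I * p.2.2.1 * q.1) p := by fun_prop
      exact ((d3.mul_const _).mul (((d2.const_mul ((q.2 : ℂ) ^ e.k₁)).neg.sub
        (d1.const_mul ((q.2 : ℂ) ^ e.k₂))).add d4).cexp).differentiableWithinAt
    · filter_upwards [ae_stripMeasure] with q hq p hp
      refine Hb |B| q.2 q.1 _ (s' p) (s p) p.2.2.1 hq ?_ ?_ hp.2.le hp.1.2.2.1.le
      · exact (hw _ hp.1.2.2.2.2).norm_ray_le he hq (Or.inl (mem_unbounded_ray h.1 hq)) q.1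
      · rw [neg_zero]; exact (hUeq p hp).2.2.2.2
  refine (hd.const_mul (((Real.sqrt (2 * Real.pi))⁻¹ : ℝ) : ℂ)).congr_of_eventuallyEq ?_
  filter_upwards [hUn] with p hp using (hUeq p hp).1

end Outer

end Equation

end OuterPDE

namespace OuterPDE

/-! ### Comparison of ray integrals in two directions -/

/-- The difference of two ray integrals of a function which is holomorphic only near the origin
between the two directions. -/
theorem norm_rayIntegral_sub_le {k₁ k₂ : ℕ} {k' : ℝ} {g : ℂ → ℂ} {a b B A N R c₀ c₂ : ℝ}
    {T₁ T₂ : ℂ} (hR : 0 < R) (hc₂ : 0 ≤ c₂)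
    (H : ∀ r : ℝ, 0 ≤ r → A * r ^ k' - c₀ * r ^ k₂ ≤ N - r)
    (hg : ∀ r ∈ Ioc 0 R, ∀ y ∈ uIcc a b, DifferentiableAt ℂ g (r * exp (y * I)))
    (hB : ∀ r ∈ Ioc 0 R, ∀ y ∈ uIcc a b,
      ‖g (r * exp (y * I))‖ ≤ B * (r * Real.exp (A * r ^ k')))
    (hga : ∀ r : ℝ, 0 < r → ContinuousAt g (r * exp (a * I)))
    (hgb : ∀ r : ℝ, 0 < r → ContinuousAt g (r * exp (b * I)))
    (hBa : ∀ r : ℝ, 0 < r → ‖g (r * exp (a * I))‖ ≤ B * (r * Real.exp (A * r ^ k')))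
    (hBb : ∀ r : ℝ, 0 < r → ‖g (r * exp (b * I))‖ ≤ B * (r * Real.exp (A * r ^ k')))
    (h₁ : ∀ y ∈ uIcc a b, 0 ≤ ((exp (y * I) / T₁) ^ k₁).re)
    (h₂ : ∀ y ∈ uIcc a b, c₀ + c₂ ≤ ((exp (y * I) / T₂) ^ k₂).re) :
    ‖rayIntegral k₁ k₂ g a T₁ T₂ - rayIntegral k₁ k₂ g b T₁ T₂‖ ≤
      B * (Real.exp N * (2 + R * |b - a|) * Real.exp (-(c₂ * R ^ k₂))) := by
  have hB0 : 0 ≤ B := nonneg_of_mul_nonneg_left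
    ((norm_nonneg _).trans (hBa 1 one_pos)) (by positivity)
  set G : ℂ → ℂ := fun u => g u * exp (-(u / T₁) ^ k₁ - (u / T₂) ^ k₂) with hGdef
  have hcont : ∀ u, ContinuousAt g u → ContinuousAt G u := fun u hu => hu.mul (by fun_prop)
  -- The share `c₀` of the decay beats the growth of `g`; the share `c₂` remains as `e^{-c₂
  -- r^{k₂}}`, which is small for `r ≥ R`.
  have hle : ∀ r : ℝ, 0 < r → ∀ y ∈ uIcc a b,
      ‖g (r * exp (y * I))‖ ≤ B * (r * Real.exp (A * r ^ k')) →
      ‖G (r * exp (y * I))‖ ≤ B * Real.exp N * r * Real.exp (-r) * Real.exp (-(c₂ * r ^ k₂)) := by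
    intro r hr y hy h
    refine (norm_mul_exp_ray_le (M := 0) hr (by simpa using h₁ y hy) (h₂ y hy) h).trans ?_
    calc B * (r * Real.exp (A * r ^ k')) * Real.exp (0 * r ^ k₁ - (c₀ + c₂) * r ^ k₂)
        = B * r * Real.exp ((A * r ^ k' - c₀ * r ^ k₂) + -(c₂ * r ^ k₂)) := by
          rw [mul_assoc, mul_assoc r, ← Real.exp_add]; ring_nf
      _ ≤ B * r * Real.exp ((N - r) + -(c₂ * r ^ k₂)) := by
          have := Real.exp_le_exp.2 (add_le_add_left (H r hr.le) (-(c₂ * r ^ k₂)))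
          gcongr B * r * ?_
      _ = _ := by rw [sub_eq_add_neg, Real.exp_add, Real.exp_add]; ring
  have hle' : ∀ r : ℝ, 0 < r → ∀ y ∈ uIcc a b,
      ‖g (r * exp (y * I))‖ ≤ B * (r * Real.exp (A * r ^ k')) →
      ‖G (r * exp (y * I))‖ ≤ B * Real.exp N * r * Real.exp (-r) := by
    intro r hr y hy h
    refine (hle r hr y hy h).trans (mul_le_of_le_one_right (by positivity) ?_)
    exact Real.exp_le_one_iff.2 (neg_nonpos.2 (by positivity))
  set X : ℝ := Real.exp (-(c₂ * R ^ k₂)) with hX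
  have htail : ∀ y ∈ uIcc a b, (∀ r : ℝ, 0 < r → ContinuousAt g (r * exp (y * I))) →
      (∀ r : ℝ, 0 < r → ‖g (r * exp (y * I))‖ ≤ B * (r * Real.exp (A * r ^ k'))) →
      ∃ w : ℂ, ‖w‖ ≤ B * Real.exp N * X ∧ rayIntegral k₁ k₂ g y T₁ T₂ =
        (∫ r in (0 : ℝ)..R, G (r * exp (y * I)) * (r : ℂ)⁻¹) + w := by
    intro y hy hc hb
    have hi : IntegrableOn (fun r : ℝ => G (r * exp (y * I)) * (r : ℂ)⁻¹) (Ioi 0) :=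
      integrableOn_Ioi_of_le_mul_exp_neg (fun r hr => hcont _ (hc r hr))
        (fun r hr => hle' r hr y hy (hb r hr))
    have hiR := hi.mono_set (Ioi_subset_Ioi hR.le)
    refine ⟨∫ r in Ioi R, G (r * exp (y * I)) * (r : ℂ)⁻¹, ?_,
      (intervalIntegral.integral_interval_add_Ioi hi hiR).symm⟩
    have h_int := (integrableOn_exp_neg_Ioi R).const_mul (B * Real.exp N * X)
    refine (norm_integral_le_of_norm_le h_int ?_).trans ?_
    · filter_upwards [ae_restrict_mem measurableSet_Ioi] with r hr
      have hr : R < r := hr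
      have hr0 : 0 < r := hR.trans hr
      rw [norm_mul, norm_inv, norm_real, Real.norm_of_nonneg hr0.le]
      calc _ ≤ (B * Real.exp N * r * Real.exp (-r) * Real.exp (-(c₂ * r ^ k₂))) * r⁻¹ := by
            gcongr; exact hle r hr0 y hy (hb r hr0)
        _ = B * Real.exp N * Real.exp (-(c₂ * r ^ k₂)) * Real.exp (-r) := by field_simp
        _ ≤ _ := by rw [hX]; gcongr
    · rw [integral_const_mul, integral_exp_neg_Ioi]
      exact mul_le_of_le_one_right (by positivity) (Real.exp_le_one_iff.2 (by linarith))
  obtain ⟨w, hw, hwe⟩ := htail a left_mem_uIcc hga hBa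
  obtain ⟨w', hw', hwe'⟩ := htail b right_mem_uIcc hgb hBb
  -- Holomorphy near the origin replaces the difference of the two inner segments by the arc of
  -- radius `R`.
  have hseg := integral_segment_sub_segment (G := G) (B := B * Real.exp N) (a := a) (b := b) hR
    (fun r hr y hy => (hg r hr y hy).mul (by fun_prop)) (fun r hr y hy =>
      (hle' r hr.1 y hy (hB r hr y hy)).trans (mul_le_of_le_one_right
        (by have := hr.1; positivity) (Real.exp_le_one_iff.2 (by linarith [hr.1]))))
  have harc : ‖∫ y in a..b, G (R * exp (y * I))‖ ≤ B * Real.exp N * R * X * |b - a| := by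
    refine intervalIntegral.norm_integral_le_of_norm_le_const fun y hy => ?_
    have hy := uIoc_subset_uIcc hy
    refine (hle R hR y hy (hB R ⟨hR, le_rfl⟩ y hy)).trans ?_
    have : Real.exp (-R) ≤ 1 := Real.exp_le_one_iff.2 (by linarith)
    calc _ ≤ B * Real.exp N * R * 1 * Real.exp (-(c₂ * R ^ k₂)) := by gcongr
      _ = _ := by rw [mul_one]
  have heq : rayIntegral k₁ k₂ g a T₁ T₂ - rayIntegral k₁ k₂ g b T₁ T₂ =
      -(I * ∫ y in a..b, G (R * exp (y * I))) + w - w' := by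
    rw [hwe, hwe', ← hseg]; ring
  rw [heq]
  calc _ ≤ ‖∫ y in a..b, G (R * exp (y * I))‖ + ‖w‖ + ‖w'‖ := by
        refine (norm_sub_le _ _).trans ?_
        gcongr
        refine (norm_add_le _ _).trans (le_of_eq ?_)
        rw [norm_neg, norm_mul, norm_I, one_mul]
    _ ≤ B * Real.exp N * R * X * |b - a| + B * Real.exp N * X + B * Real.exp N * X := by gcongr
    _ = _ := by ring

theorem integrable_rayIntegral_mul_exp (k₁ k₂ : ℕ) (ω : ℂ → ℝ → ℂ) (γ : ℝ) (T₁ T₂ z : ℂ)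
    (hi : Integrable (laplaceIntegrand k₁ k₂ (fun r m => ω (r * exp (γ * I)) m)
      ((exp (γ * I) / T₁) ^ k₁) ((exp (γ * I) / T₂) ^ k₂) z) stripMeasure) :
    Integrable fun m : ℝ => rayIntegral k₁ k₂ (fun τ => ω τ m) γ T₁ T₂ * exp (I * z * m) := by
  refine hi.integral_prod_left.congr (Eventually.of_forall fun m => ?_)
  simp only [rayIntegral]
  rw [← integral_mul_const]
  congr 1
  ext r
  exact (rayIntegrand_mul_exp k₁ k₂ ω γ T₁ T₂ z (m, r)).symm

theorem norm_invFourier_sub_le {f g : ℝ → ℂ} {z : ℂ} {β β' X : ℝ} (hβ : β' < β)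
    (hz : |z.im| ≤ β') (hf : Integrable fun m : ℝ => f m * exp (I * z * m))
    (hg : Integrable fun m : ℝ => g m * exp (I * z * m))
    (hfg : ∀ m, ‖f m - g m‖ ≤ Real.exp (-(β * |m|)) * X) :
    ‖invFourier f z - invFourier g z‖ ≤
      ((Real.sqrt (2 * Real.pi))⁻¹ * ∫ m : ℝ, Real.exp (-((β - β') * |m|))) * X := by
  have hX : 0 ≤ X := nonneg_of_mul_nonneg_right ((norm_nonneg _).trans (hfg 0)) (Real.exp_pos _)
  rw [invFourier, invFourier, ← mul_sub, ← integral_sub hf hg, norm_mul, norm_real,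
    Real.norm_of_nonneg (by positivity), mul_assoc]
  gcongr
  rw [← integral_mul_const]
  refine norm_integral_le_of_norm_le ((integrable_exp_neg_mul_abs (sub_pos.2 hβ)).mul_const X)
    (Eventually.of_forall fun m => ?_)
  have h := norm_exp_laplace_le 0 0 (r := 1) (m := m) (M := 0) (c := 0) (s₁ := 0) (s₂ := 0)
    one_pos (by simp) (by simp) hz
  simp only [mul_zero, neg_zero, sub_zero, zero_add, zero_mul, Real.exp_zero, one_mul] at h
  rw [← sub_mul, norm_mul]
  calc _ ≤ (Real.exp (-(β * |m|)) * X) * Real.exp (β' * |m|) := by gcongr; exact hfg m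
    _ = (Real.exp (-(β * |m|)) * Real.exp (β' * |m|)) * X := by ring
    _ = _ := by rw [← Real.exp_add]; ring_nf

theorem tendsto_div_norm_pow_atTop {a : ℝ} (ha : 0 < a) {ε : ℂ} (hε : ε ≠ 0) (lam : ℕ) {k : ℕ}
    (hk : k ≠ 0) {U : Set ℂ} (hU : ∀ t ∈ U, t ≠ 0) :
    Tendsto (fun t => a / ‖ε ^ lam * t‖ ^ k) (𝓝[U] 0) atTop := by
  have h : Tendsto (fun t => ‖ε ^ lam * t‖ ^ k) (𝓝[U] 0) (𝓝[>] 0) := by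
    refine tendsto_nhdsWithin_iff.2 ⟨?_, ?_⟩
    · have hc : Continuous fun t => ‖ε ^ lam * t‖ ^ k := by fun_prop
      have := (hc.tendsto 0).mono_left (nhdsWithin_le_nhds (s := U))
      simpa [hk] using this
    · filter_upwards [self_mem_nhdsWithin] with t ht
      exact pow_pos (norm_pos_iff.2 (mul_ne_zero (pow_ne_zero _ hε) (hU t ht))) _
  simp only [div_eq_mul_inv]
  exact (tendsto_inv_nhdsGT_zero.comp h).const_mul_atTop ha

theorem div_norm_pow_mul_le {a x y : ℝ} (ha : 0 ≤ a) {ε t : ℂ} (hε : ε ≠ 0) (ht : t ≠ 0)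
    (hx : ‖ε‖ ≤ x) (hy : ‖t‖ ≤ y) (lam k : ℕ) :
    a / (x ^ lam * y) ^ k ≤ a / ‖ε ^ lam * t‖ ^ k := by
  have hε' := norm_pos_iff.2 hε
  have := norm_pos_iff.2 ht
  have := hε'.le.trans hx
  rw [norm_mul, norm_pow]
  gcongr

namespace Equation

variable {e : Equation} {T₁ T₂ E E' S S' : Sector} {δ φ₁ φ₂ η η' ξ ξ' ρ B : ℝ} {t₁ t₂ ε z : ℂ}

/-- Directions allowed at the same point for two different arguments `η`, `η'` of `ε` lie, up to
a multiple of `2π`, in a common interval of directions in which the exponential decays. -/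
theorem GoodDirection.exists_common (he : e.Assumptions)
    (hε : E.HasAngle ε η) (hε' : E'.HasAngle ε η') (h : e.GoodDirection S δ φ₁ φ₂ η ξ)
    (h' : e.GoodDirection S' δ φ₁ φ₂ η' ξ') (hδ : 0 < δ) :
    ∃ ξ'' : ℝ, exp (ξ' * I) = exp (ξ'' * I) ∧ |ξ'' - ξ| ≤ Real.pi ∧ ∀ y ∈ uIcc ξ ξ'',
      e.k₁ * y - e.k₁ * (e.lam₁ * η + φ₁) ∈ Ioo (-(Real.pi / 2) + δ) (Real.pi / 2 - δ) ∧
      e.k₂ * y - e.k₂ * (e.lam₂ * η + φ₂) ∈ Ioo (-(Real.pi / 2) + δ) (Real.pi / 2 - δ) := by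
  obtain ⟨n, hn⟩ := exists_int_of_exp_eq (exp_eq_of_polar hε.ne_zero hε'.eq hε.eq)
  have hp := Real.pi_pos
  -- This shift compensates the change of `λ₂ arg ε` by `2π n λ₂`, so the condition for `j = 2`
  -- holds with the argument `η`.
  set ξ'' : ℝ := ξ' - n * e.lam₂ * (2 * Real.pi) with hξ''
  have hk₁ : (1 : ℝ) ≤ e.k₁ := by exact_mod_cast he.one_le_k₁
  have hk : (e.k₁ : ℝ) ≤ e.k₂ := by linarith [he.k₁_lt_k', he.k'_lt_k₂]
  obtain ⟨-, ha1, ha2⟩ := h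
  obtain ⟨-, hb1, hb2⟩ := h'
  have hb2' : e.k₂ * ξ'' - e.k₂ * (e.lam₂ * η + φ₂) ∈
      Ioo (-(Real.pi / 2) + δ) (Real.pi / 2 - δ) := by
    convert hb2 using 1
    rw [hξ'', hn]; ring
  have hd : e.k₂ * |ξ'' - ξ| < Real.pi := by
    rw [← abs_of_nonneg (by linarith : (0 : ℝ) ≤ e.k₂), ← abs_mul, abs_lt, mul_sub]
    exact ⟨by linarith [ha2.1, ha2.2, hb2'.1, hb2'.2], by linarith [ha2.1, ha2.2, hb2'.1, hb2'.2]⟩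
  have hd1 : e.k₁ * |ξ'' - ξ| < Real.pi := lt_of_le_of_lt (by gcongr) hd
  have hd0 : |ξ'' - ξ| ≤ Real.pi :=
    (le_mul_of_one_le_left (abs_nonneg _) hk₁).trans hd1.le
  set n' : ℤ := n * (e.lam₂ - e.lam₁) with hn'
  have hb1' : e.k₁ * ξ' - e.k₁ * (e.lam₁ * η' + φ₁) =
      e.k₁ * ξ'' - e.k₁ * (e.lam₁ * η + φ₁) + e.k₁ * n' * (2 * Real.pi) := by
    rw [hξ'', hn, hn']; push_cast; ring
  have hd2 : |e.k₁ * (ξ'' - ξ)| < Real.pi := by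
    rwa [abs_mul, abs_of_nonneg (by linarith : (0 : ℝ) ≤ e.k₁)]
  have hd3 := abs_lt.1 hd2
  -- The same shift misses the condition for `j = 1` by `2π k₁ n'`. Both `k₁`-angles lie within
  -- `π/2` of zero and `k₁|ξ'' - ξ| < π` since `k₁ ≤ k₂`, so the integer `k₁ n'` has absolute value
  -- below `1`.
  have hn0 : (e.k₁ : ℤ) * n' = 0 := by
    have h1 : ((e.k₁ * n' : ℤ) : ℝ) * (2 * Real.pi) < 1 * (2 * Real.pi) := by
      push_cast; rw [hb1'] at hb1; linarith [hb1.2, ha1.1, hd3.1]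
    have h2 : (-1 : ℝ) * (2 * Real.pi) < ((e.k₁ * n' : ℤ) : ℝ) * (2 * Real.pi) := by
      push_cast; rw [hb1'] at hb1; linarith [hb1.1, ha1.2, hd3.2]
    have h1' : ((e.k₁ * n' : ℤ) : ℝ) < 1 := lt_of_mul_lt_mul_right h1 (by positivity)
    have h2' : (-1 : ℝ) < ((e.k₁ * n' : ℤ) : ℝ) := lt_of_mul_lt_mul_right h2 (by positivity)
    have h3 : (e.k₁ * n' : ℤ) < 1 := by exact_mod_cast h1'
    have h4 : -1 < (e.k₁ * n' : ℤ) := by exact_mod_cast h2'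
    omega
  have hn0' : (e.k₁ : ℝ) * n' = 0 := by exact_mod_cast hn0
  rw [hb1', hn0', zero_mul, add_zero] at hb1
  refine ⟨ξ'', ?_, hd0, fun y hy => ⟨mul_sub_mem_Ioo_of_mem_uIcc hy _ ha1 hb1,
    mul_sub_mem_Ioo_of_mem_uIcc hy _ ha2 hb2'⟩⟩
  refine exp_eq_exp_iff_exists_int.2 ⟨n * e.lam₂, ?_⟩
  rw [hξ'']; push_cast; ring

/-- Bound for the outer solutions. -/
theorem exists_norm_outerSolution_le (he : e.Assumptions) (hδ : 0 < δ) (B : ℝ) {β' c : ℝ}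
    (hβ : β' < e.β) (hc : 0 < c) :
    ∃ D : ℝ, 0 ≤ D ∧ ∀ {T₁ T₂ E S : Sector} {ρ φ₁ φ₂ η ξ : ℝ} {ω : ℂ → ℝ → ℂ → ℂ} {t₁ t₂ ε z : ℂ},
      e.MemExp S ρ B (fun τ m => ω τ m ε) → T₁.HasAngle t₁ φ₁ → T₂.HasAngle t₂ φ₂ →
      E.HasAngle ε η → e.GoodDirection S δ φ₁ φ₂ η ξ → z ∈ strip β' → ∀ c₁ c₂ : ℝ, 0 ≤ c₁ →
      0 ≤ c₂ → c₁ ≤ Real.sin δ / ‖ε ^ e.lam₁ * t₁‖ ^ e.k₁ →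
      c + c₂ ≤ Real.sin δ / ‖ε ^ e.lam₂ * t₂‖ ^ e.k₂ →
      ‖e.outerSolution δ T₁ T₂ E S ω t₁ t₂ z ε‖ ≤
        D * ∫ r in Ioi (0 : ℝ), Real.exp (-r - (c₁ * r ^ e.k₁ + c₂ * r ^ e.k₂)) := by
  obtain ⟨D, hD, H⟩ := exists_norm_laplace_le he.exponents e.ν hβ hc
  refine ⟨|B| * D, by positivity, ?_⟩
  intro T₁ T₂ E S ρ φ₁ φ₂ η ξ ω t₁ t₂ ε z hw h₁ h₂ hε h hz c₁ c₂ hc₁ hc₂ hle₁ hle₂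
  have hz : |z.im| < β' := hz
  rw [outerSolution_eq_laplace he hδ hw h₁ h₂ hε h (show |z.im| < e.β from hz.trans hβ)]
  exact H |B| _ (fun r m hr => hw.norm_ray_le he hr (Or.inl (mem_unbounded_ray h.1 hr)) m) c₁ c₂
    _ _ z hc₁ hc₂ (hle₁.trans (h.le_re₁ hδ h₁ hε)) (hle₂.trans (h.le_re₂ hδ h₂ hε)) hz.le

/-- Outer solutions for neighbouring sectors are exponentially close. -/
theorem exists_norm_outerSolution_sub_le (he : e.Assumptions) (hδ : 0 < δ)
    (hs : 0 < Real.sin δ) (hρ : 0 < ρ) (B : ℝ) {β' ρ₂ ε₁ : ℝ} (hβ : β' < e.β) (hρ₂ : 0 < ρ₂)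
    (hε₁ : 0 < ε₁) :
    ∃ Chat > 0, ∃ Dhat > 0, ∀ {T₁ T₂ E E' S S' : Sector} {φ₁ φ₂ η η' ξ ξ' : ℝ}
      {ω : ℂ → ℝ → ℂ → ℂ} {t₁ t₂ ε z : ℂ},
      e.MemExp S ρ B (fun τ m => ω τ m ε) → e.MemExp S' ρ B (fun τ m => ω τ m ε) →
      T₁.HasAngle t₁ φ₁ → T₂.HasAngle t₂ φ₂ → E.HasAngle ε η → E'.HasAngle ε η' →
      e.GoodDirection S δ φ₁ φ₂ η ξ → e.GoodDirection S' δ φ₁ φ₂ η' ξ' → z ∈ strip β' →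
      ‖t₂‖ ≤ ρ₂ → ‖ε‖ ≤ ε₁ →
      ‖e.outerSolution δ T₁ T₂ E' S' ω t₁ t₂ z ε - e.outerSolution δ T₁ T₂ E S ω t₁ t₂ z ε‖ ≤
        Chat * Real.exp (-Dhat / ‖ε‖ ^ (e.lam₂ * e.k₂)) := by
  have hp := Real.pi_pos
  -- Half of the worst decay constant over `‖ε‖ ≤ ε₁`, `‖t₂‖ ≤ ρ₂`; being independent of `ε`, it
  -- yields a uniform `N`.
  set c₀ : ℝ := Real.sin δ / 2 / (ε₁ ^ e.lam₂ * ρ₂) ^ e.k₂ with hc₀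
  have hc₀p : 0 < c₀ := by positivity
  obtain ⟨N, hN, H⟩ := exists_exponent_le he.exponents e.ν 0 hc₀p
  set J : ℝ := (Real.sqrt (2 * Real.pi))⁻¹ * ∫ m : ℝ, Real.exp (-((e.β - β') * |m|)) with hJ
  have hJ0 : 0 ≤ J := mul_nonneg (by positivity) (integral_nonneg fun m => (Real.exp_pos _).le)
  -- The arc has to lie in the open disc where `ω` is holomorphic.
  set R : ℝ := ρ / 2 with hR
  have hR0 : 0 < R := half_pos hρ
  -- `2` counts the two tails and `R π` bounds the arc length; the rate is `c₂ R^{k₂}` below with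
  -- the power of `‖ε‖` removed.
  refine ⟨J * (|B| * (Real.exp N * (2 + R * Real.pi))) + 1, by positivity,
    Real.sin δ / 2 * R ^ e.k₂ / ρ₂ ^ e.k₂, by positivity, ?_⟩
  intro T₁ T₂ E E' S S' φ₁ φ₂ η η' ξ ξ' ω t₁ t₂ ε z hw hw' h₁ h₂ hε hε' h h' hz ht₂ hεle
  have hz : |z.im| < β' := hz
  have hzβ : |z.im| < e.β := hz.trans hβ
  have hεp := hε.norm_pos
  obtain ⟨ξ'', hexp, hπ, hcom⟩ := h.exists_common he hε hε' h' hδ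
  set c₂ : ℝ := Real.sin δ / 2 / (‖ε‖ ^ e.lam₂ * ρ₂) ^ e.k₂ with hc₂
  have hc₂p : 0 ≤ c₂ := by positivity
  have hc₀c₂ : c₀ ≤ c₂ := by rw [hc₀, hc₂]; gcongr
  have hc : c₀ + c₂ ≤ Real.sin δ / ‖ε ^ e.lam₂ * t₂‖ ^ e.k₂ := by
    have h3 := div_norm_pow_mul_le hs.le hε.ne_zero h₂.ne_zero le_rfl ht₂ e.lam₂ e.k₂
    have h4 : c₂ + c₂ = Real.sin δ / (‖ε‖ ^ e.lam₂ * ρ₂) ^ e.k₂ := by rw [hc₂]; ring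
    linarith
  have hexpX : Real.exp (-(c₂ * R ^ e.k₂)) =
      Real.exp (-(Real.sin δ / 2 * R ^ e.k₂ / ρ₂ ^ e.k₂) / ‖ε‖ ^ (e.lam₂ * e.k₂)) := by
    congr 1
    rw [hc₂, mul_pow, ← pow_mul]
    field_simp
  rw [outerSolution_eq he hδ hw h₁ h₂ hε h z, outerSolution_eq he hδ hw' h₁ h₂ hε' h' z, ← hexpX]
  have hdiff : ∀ {U : Sector}, e.MemExp U ρ B (fun τ m => ω τ m ε) → ∀ m,
      ∀ τ ∈ U.unbounded ∪ Metric.ball (0 : ℂ) ρ, DifferentiableAt ℂ (fun τ => ω τ m ε) τ :=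
    fun hU m τ hτ => (hU.holo m).differentiableAt
      ((Sector.isOpen_unbounded _ |>.union Metric.isOpen_ball).mem_nhds hτ)
  have hball : ∀ r ∈ Ioc 0 R, ∀ y : ℝ, (r : ℂ) * exp (y * I) ∈ Metric.ball (0 : ℂ) ρ := by
    intro r hr y
    rw [mem_ball_zero_iff, norm_ofReal_mul_exp hr.1.le]
    linarith [hr.2]
  have hray : ∀ m, ‖rayIntegral e.k₁ e.k₂ (fun τ => ω τ m ε) ξ' (ε ^ e.lam₁ * t₁)
        (ε ^ e.lam₂ * t₂) - rayIntegral e.k₁ e.k₂ (fun τ => ω τ m ε) ξ (ε ^ e.lam₁ * t₁)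
        (ε ^ e.lam₂ * t₂)‖ ≤ Real.exp (-(e.β * |m|)) *
      (|B| * (Real.exp N * (2 + R * Real.pi) * Real.exp (-(c₂ * R ^ e.k₂)))) := by
    intro m
    rw [rayIntegral_congr_direction hexp, norm_sub_rev]
    have key := norm_rayIntegral_sub_le (k₁ := e.k₁) (k₂ := e.k₂) (k' := e.k')
      (g := fun τ => ω τ m ε) (a := ξ) (b := ξ'') (B := |B| * Real.exp (-(e.β * |m|)))
      (A := e.ν) (N := N) (R := R) (c₀ := c₀) (c₂ := c₂)
      (T₁ := ε ^ e.lam₁ * t₁) (T₂ := ε ^ e.lam₂ * t₂) hR0 hc₂p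
      (fun r hr => by simpa using H r hr)
      (fun r hr y hy => hdiff hw m _ (Or.inr (hball r hr y)))
      (fun r hr y hy => hw.norm_ray_le he hr.1
        (Or.inr (Metric.ball_subset_closedBall (hball r hr y))) m)
      (fun r hr => (hdiff hw m _ (Or.inl (mem_unbounded_ray h.1 hr))).continuousAt)
      (fun r hr => by
        rw [← hexp]
        exact (hdiff hw' m _ (Or.inl (mem_unbounded_ray h'.1 hr))).continuousAt)
      (fun r hr => hw.norm_ray_le he hr (Or.inl (mem_unbounded_ray h.1 hr)) m)
      (fun r hr => by
        rw [← hexp]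
        exact hw'.norm_ray_le he hr (Or.inl (mem_unbounded_ray h'.1 hr)) m)
      (fun y hy => le_trans (by positivity) (le_re_exp_div_pow hδ hε.eq h₁.eq (hcom y hy).1))
      (fun y hy => hc.trans (le_re_exp_div_pow hδ hε.eq h₂.eq (hcom y hy).2))
    refine key.trans ?_
    calc _ ≤ |B| * Real.exp (-(e.β * |m|)) *
          (Real.exp N * (2 + R * Real.pi) * Real.exp (-(c₂ * R ^ e.k₂))) := by gcongr
      _ = _ := by ring
  have h_int := norm_invFourier_sub_le hβ hz.le
    (integrable_rayIntegral_mul_exp e.k₁ e.k₂ (fun τ m => ω τ m ε) ξ' (ε ^ e.lam₁ * t₁)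
      (ε ^ e.lam₂ * t₂) z
      ((hw'.isKernel he h'.1).integrable he.exponents (h'.re₂_pos hδ h₂ hε') hzβ))
    (integrable_rayIntegral_mul_exp e.k₁ e.k₂ (fun τ m => ω τ m ε) ξ (ε ^ e.lam₁ * t₁)
      (ε ^ e.lam₂ * t₂) z
      ((hw.isKernel he h.1).integrable he.exponents (h.re₂_pos hδ h₂ hε) hzβ)) hray
  refine h_int.trans ?_
  have hx := Real.exp_pos (-(c₂ * R ^ e.k₂))
  calc _ = J * (|B| * (Real.exp N * (2 + R * Real.pi))) * Real.exp (-(c₂ * R ^ e.k₂)) := by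
        rw [← hJ]; ring
    _ ≤ _ := by gcongr; linarith

end Equation

end OuterPDE

/-! ### Vanishing initial data and the integral representation -/

namespace OuterPDE

namespace Equation

variable {e : Equation} {T₁ T₂ E S : Sector} {δ φ₁ φ₂ η ρ B β' : ℝ} {t₁ t₂ ε z : ℂ} {U : Set ℂ}

/-- With `t₂` and `ε` fixed the whole decay in `s₂` pays for the growth, while `c₁ = sin δ /
|T₁|^{k₁}` tends to infinity. -/
theorem tendsto_outerSolution_fst (he : e.Assumptions) (hδ : 0 < δ) (hs : 0 < Real.sin δ)
    {ω : ℂ → ℝ → ℂ → ℂ} (hw : e.MemExp S ρ B fun τ m => ω τ m ε) (h₂ : T₂.HasAngle t₂ φ₂)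
    (hε : E.HasAngle ε η)
    (hU : ∀ t ∈ U, ∃ φ₁ ξ, T₁.HasAngle t φ₁ ∧ e.GoodDirection S δ φ₁ φ₂ η ξ)
    (hβ : β' < e.β) (hz : z ∈ strip β') :
    Tendsto (fun t => e.outerSolution δ T₁ T₂ E S ω t t₂ z ε) (𝓝[U] 0) (𝓝 0) := by
  obtain ⟨D, hD, H⟩ := exists_norm_outerSolution_le he hδ B hβ
    (div_pos hs (norm_pow_mul_pos hε.ne_zero h₂.ne_zero e.lam₂ e.k₂))
  have hk : e.k₁ ≠ 0 := by have := he.one_le_k₁; omega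
  have hlim : Tendsto (fun c : ℝ => D * ∫ r in Ioi (0 : ℝ),
      Real.exp (-r - (c * r ^ e.k₁ + 0 * r ^ e.k₂))) atTop (𝓝 0) := by
    rw [show 𝓝 (0 : ℝ) = 𝓝 (D * 0) by rw [mul_zero]]
    refine (tendsto_integral_exp_neg_sub (f := fun c r => c * r ^ e.k₁ + 0 * r ^ e.k₂)
      (fun c => by fun_prop) (fun c hc r hr => by positivity) fun r hr => ?_).const_mul D
    simp only [zero_mul, add_zero]
    exact tendsto_id.atTop_mul_const (by positivity)
  refine squeeze_zero_norm' ?_ (hlim.comp (tendsto_div_norm_pow_atTop hs hε.ne_zero e.lam₁ hk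
    (U := U) fun t ht => ?_))
  · filter_upwards [self_mem_nhdsWithin] with t ht
    obtain ⟨φ₁, ξ, h₁, h⟩ := hU t ht
    exact H hw h₁ h₂ hε h hz _ 0 (by positivity) le_rfl le_rfl (by rw [add_zero])
  · obtain ⟨φ₁, ξ, h₁, -⟩ := hU t ht
    exact h₁.ne_zero

/-- The decay in `s₂` must both absorb the growth and force the limit, so it is halved: one half,
evaluated at `‖t₂‖ = 1`, is the fixed `c`, and the other tends to infinity. -/
theorem tendsto_outerSolution_snd (he : e.Assumptions) (hδ : 0 < δ) (hs : 0 < Real.sin δ)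
    {ω : ℂ → ℝ → ℂ → ℂ} (hw : e.MemExp S ρ B fun τ m => ω τ m ε) (h₁ : T₁.HasAngle t₁ φ₁)
    (hε : E.HasAngle ε η)
    (hU : ∀ t ∈ U, ∃ φ₂ ξ, T₂.HasAngle t φ₂ ∧ e.GoodDirection S δ φ₁ φ₂ η ξ)
    (hβ : β' < e.β) (hz : z ∈ strip β') :
    Tendsto (fun t => e.outerSolution δ T₁ T₂ E S ω t₁ t z ε) (𝓝[U] 0) (𝓝 0) := by
  have hεp := hε.norm_pos
  have hk : e.k₂ ≠ 0 := by have := he.k₂_pos; exact fun h => by simp [h] at this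
  obtain ⟨D, hD, H⟩ := exists_norm_outerSolution_le he hδ B hβ
    (show 0 < Real.sin δ / 2 / (‖ε‖ ^ e.lam₂ * 1) ^ e.k₂ by positivity)
  have hlim : Tendsto (fun c : ℝ => D * ∫ r in Ioi (0 : ℝ),
      Real.exp (-r - (0 * r ^ e.k₁ + c * r ^ e.k₂))) atTop (𝓝 0) := by
    rw [show 𝓝 (0 : ℝ) = 𝓝 (D * 0) by rw [mul_zero]]
    refine (tendsto_integral_exp_neg_sub (f := fun c r => 0 * r ^ e.k₁ + c * r ^ e.k₂)
      (fun c => by fun_prop) (fun c hc r hr => by positivity) fun r hr => ?_).const_mul D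
    simp only [zero_mul, zero_add]
    exact tendsto_id.atTop_mul_const (by positivity)
  refine squeeze_zero_norm' ?_ (hlim.comp (tendsto_div_norm_pow_atTop (half_pos hs) hε.ne_zero
    e.lam₂ hk (U := U) fun t ht => ?_))
  · have hnear : ∀ᶠ t : ℂ in 𝓝[U] 0, t ∈ Metric.ball (0 : ℂ) 1 :=
      nhdsWithin_le_nhds (Metric.ball_mem_nhds 0 one_pos)
    filter_upwards [self_mem_nhdsWithin, hnear] with t ht ht'
    obtain ⟨φ₂, ξ, h₂, h⟩ := hU t ht
    refine H hw h₁ h₂ hε h hz 0 _ le_rfl (by positivity) (by positivity) ?_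
    have h3 := div_norm_pow_mul_le (half_pos hs).le hε.ne_zero h₂.ne_zero le_rfl
      (mem_ball_zero_iff.1 ht').le e.lam₂ e.k₂
    calc _ ≤ Real.sin δ / 2 / ‖ε ^ e.lam₂ * t‖ ^ e.k₂ +
          Real.sin δ / 2 / ‖ε ^ e.lam₂ * t‖ ^ e.k₂ := by gcongr
      _ = _ := by ring
  · obtain ⟨φ₂, ξ, h₂, -⟩ := hU t ht
    exact h₂.ne_zero

theorem isGivenByIntegral_outerSolution (he : e.Assumptions) (hδ : 0 < δ) {r₁ rE ε₁ : ℝ}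
    {ω : ℂ → ℝ → ℂ → ℂ} (hE : E.bounded rE ⊆ Metric.ball (0 : ℂ) ε₁)
    (hw : ∀ ε ∈ Metric.ball (0 : ℂ) ε₁, e.MemExp S ρ B fun τ m => ω τ m ε) :
    e.IsGivenByIntegral δ T₁ T₂ r₁ E rE S ω (e.outerSolution δ T₁ T₂ E S ω) := by
  intro x₁ x₂ x hx₁ hx₂ hx φ₁ hφ₁ φ₂ hφ₂ η hη ξ h z hz t₁ t₂ ε
  have h₁ : T₁.HasAngle t₁ φ₁ := Sector.hasAngle_mul_exp hx₁.1 hφ₁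
  have h₂ : T₂.HasAngle t₂ φ₂ := Sector.hasAngle_mul_exp hx₂ hφ₂
  have hε : E.HasAngle ε η := Sector.hasAngle_mul_exp hx.1 hη
  have hw := hw ε (hE ⟨x, hx.1, hx.2, η, hη, rfl⟩)
  refine ⟨?_, outerSolution_eq he hδ hw h₁ h₂ hε h z⟩
  refine Integrable.congr (f := laplaceIntegrand e.k₁ e.k₂ (fun r m => ω (r * exp (ξ * I)) m ε)
    ((exp (ξ * I) / (ε ^ e.lam₁ * t₁)) ^ e.k₁) ((exp (ξ * I) / (ε ^ e.lam₂ * t₂)) ^ e.k₂) z)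
    ((hw.isKernel he h.1).integrable he.exponents (h.re₂_pos hδ h₂ hε) hz)
    (Eventually.of_forall fun p => ?_)
  exact (rayIntegrand_mul_exp e.k₁ e.k₂ (fun τ m => ω τ m ε) ξ _ _ z p).symm

/-- The sectors have nonempty angle intervals, so admissibility does produce a good direction, and
that forces `δ < π/2`. -/
theorem Admissible.sin_pos {ι : ℕ} [NeZero ι] (hδ : 0 < δ) {E S : Fin ι → Sector}
    (h : e.Admissible δ T₁ T₂ E S) : 0 < Real.sin δ := by
  have hdir : ∀ T : Sector, T.dir ∈ T.angles := fun T =>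
    ⟨by linarith [T.opening_pos], by linarith [T.opening_pos]⟩
  obtain ⟨ξ, hξ⟩ := h 0 _ (hdir T₁) _ (hdir T₂) _ (hdir (E 0))
  exact hξ.sin_pos hδ

end Equation

end OuterPDE

/-! ### Assembly of the theorem -/

theorem theorem2 (e : Equation) (he : e.Assumptions) (𝔪 : ℝ) (h𝔪 : 0 < 𝔪) :
    ∃ ε₁ > 0, ε₁ ≤ e.ε₀ ∧ ∃ K > 0,
      ∀ (ι : ℕ) [NeZero ι] (S : Fin ι → Sector) (ρ : ℝ), 0 < ρ →
      (∀ h, e.RootSeparated (S h) ρ 𝔪) →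
      ∀ (ψ : ℂ → ℝ → ℂ → ℂ) (Cψ : ℝ), e.IsForcingKernel ψ Cψ →
      ∃ ω : Fin ι → ℂ → ℝ → ℂ → ℂ, e.IsBorelSolution S ρ ψ ε₁ (K * Cψ) ω ∧
      ∀ (E : Fin ι → Sector) (rE : Fin ι → ℝ) (T₁ T₂ : Sector) (r₁ δ : ℝ),
      e.IsGoodCovering ε₁ E rE → 0 < r₁ → 0 < δ → e.Admissible δ T₁ T₂ E S →
      ∃ u : Fin ι → ℂ → ℂ → ℂ → ℂ → ℂ,
        (∀ h, e.IsGivenByIntegral δ T₁ T₂ r₁ (E h) (rE h) (S h) (ω h) (u h)) ∧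
        ∀ ρ₂ > 0, ∀ β' > 0, β' < e.β →
          -- each `u h` is holomorphic and bounded
          (∀ h, DifferentiableOn ℂ (fun p : ℂ × ℂ × ℂ × ℂ => u h p.1 p.2.1 p.2.2.1 p.2.2.2)
            (T₁.bounded r₁ ×ˢ (T₂.unbounded ∩ Metric.ball 0 ρ₂) ×ˢ strip β' ×ˢ
              (E h).bounded (rE h))) ∧
          (∀ h, ∃ M : ℝ, ∀ t₁ ∈ T₁.bounded r₁, ∀ t₂ ∈ T₂.unbounded ∩ Metric.ball 0 ρ₂,
            ∀ z ∈ strip β', ∀ ε ∈ (E h).bounded (rE h), ‖u h t₁ t₂ z ε‖ ≤ M) ∧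
          -- each `u h` solves the main equation, with vanishing initial data
          (∀ h, ∀ t₁ ∈ T₁.bounded r₁, ∀ t₂ ∈ T₂.unbounded ∩ Metric.ball 0 ρ₂,
            ∀ z ∈ strip β', ∀ ε ∈ (E h).bounded (rE h), e.SolvesAt ψ (u h) t₁ t₂ z ε) ∧
          (∀ h, ∀ t₂ ∈ T₂.unbounded ∩ Metric.ball 0 ρ₂,
            ∀ z ∈ strip β', ∀ ε ∈ (E h).bounded (rE h),
              Tendsto (fun t₁ => u h t₁ t₂ z ε) (𝓝[T₁.bounded r₁] 0) (𝓝 0)) ∧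
          (∀ h, ∀ t₁ ∈ T₁.bounded r₁, ∀ z ∈ strip β', ∀ ε ∈ (E h).bounded (rE h),
              Tendsto (fun t₂ => u h t₁ t₂ z ε) (𝓝[T₂.unbounded] 0) (𝓝 0)) ∧
          -- consecutive solutions are exponentially close
          ∃ Chat > 0, ∃ Dhat > 0, ∀ h, ∀ t₁ ∈ T₁.bounded r₁,
            ∀ t₂ ∈ T₂.unbounded ∩ Metric.ball 0 ρ₂, ∀ z ∈ strip β',
            ∀ ε ∈ (E h).bounded (rE h) ∩ (E (h + 1)).bounded (rE (h + 1)),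
              ‖u (h + 1) t₁ t₂ z ε - u h t₁ t₂ z ε‖ ≤
                Chat * Real.exp (-Dhat / ‖ε‖ ^ (e.lam₂ * e.k₂)) := by
  obtain ⟨K, hK0, hK⟩ := he.exists_norm_Pm_inv_le h𝔪
  obtain ⟨ε₁, hε₁, hε₁le, hcon⟩ := he.exists_contraction h𝔪
  refine ⟨ε₁, hε₁, hε₁le, 2 * K, by positivity, ?_⟩
  intro ι _ S ρ hρ hS ψ Cψ hψ
  have hsol := Equation.isBorelSolution he h𝔪 hε₁le hcon hK0 hK hψ hρ hS
    fun h => (S h).isOpen_unbounded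
  -- The family is constant in `h`: only the direction of integration changes from one outer
  -- solution to the next.
  refine ⟨fun _ => e.borelSolution ψ, hsol, ?_⟩
  intro E rE T₁ T₂ r₁ δ hE hr₁ hδ hadm
  have hs := hadm.sin_pos hδ
  have hT₁ : ∀ t ∈ T₁.bounded r₁, ∃ φ, T₁.HasAngle t φ := fun t ht =>
    (Sector.mem_bounded_iff.1 ht).2
  have hEa : ∀ h, ∀ ε ∈ (E h).bounded (rE h), ∃ η, (E h).HasAngle ε η := fun h ε hε =>
    (Sector.mem_bounded_iff.1 hε).2
  refine ⟨fun h => e.outerSolution δ T₁ T₂ (E h) (S h) (e.borelSolution ψ), fun h =>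
    Equation.isGivenByIntegral_outerSolution he hδ (hE.subset h) (hsol.mem h), ?_⟩
  intro ρ₂ hρ₂ β' hβ' hβ
  have hstrip : ∀ z ∈ strip β', z ∈ strip e.β := fun z hz => lt_trans hz hβ
  refine ⟨fun h => ?_, fun h => ?_, fun h => ?_, fun h => ?_, fun h => ?_, ?_⟩
  · rintro ⟨t₁, t₂, z, ε⟩ ⟨ht₁, ht₂, hz, hε⟩
    obtain ⟨φ₁, h₁⟩ := hT₁ t₁ ht₁
    obtain ⟨φ₂, h₂⟩ := Sector.exists_hasAngle_of_unbounded ht₂.1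
    obtain ⟨η, hη⟩ := hEa h ε hε
    obtain ⟨ξ, hξ⟩ := hadm h φ₁ h₁.mem φ₂ h₂.mem η hη.mem
    exact (Equation.differentiableAt_outerSolution he hδ (hsol.mem h)
      (fun τ hτ m => hsol.holo h τ (Or.inl hτ) m) (hE.subset h hε) h₁ h₂ hη hξ
      (hstrip z hz)).differentiableWithinAt
  · obtain ⟨D, hD, H⟩ := Equation.exists_norm_outerSolution_le he hδ (2 * K * Cψ) hβ
      (show 0 < Real.sin δ / (ε₁ ^ e.lam₂ * ρ₂) ^ e.k₂ by positivity)
    refine ⟨D, fun t₁ ht₁ t₂ ht₂ z hz ε hε => ?_⟩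
    obtain ⟨φ₁, h₁⟩ := hT₁ t₁ ht₁
    obtain ⟨φ₂, h₂⟩ := Sector.exists_hasAngle_of_unbounded ht₂.1
    obtain ⟨η, hη⟩ := hEa h ε hε
    obtain ⟨ξ, hξ⟩ := hadm h φ₁ h₁.mem φ₂ h₂.mem η hη.mem
    have hεb := hE.subset h hε
    refine (H (hsol.mem h ε hεb) h₁ h₂ hη hξ hz 0 0 le_rfl le_rfl (by positivity) ?_).trans
      (mul_le_of_le_one_right hD (integral_exp_neg_sub_le le_rfl le_rfl))
    rw [add_zero]
    exact div_norm_pow_mul_le hs.le hη.ne_zero h₂.ne_zero (mem_ball_zero_iff.1 hεb).le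
      (mem_ball_zero_iff.1 ht₂.2).le _ _
  · intro t₁ ht₁ t₂ ht₂ z hz ε hε
    obtain ⟨φ₁, h₁⟩ := hT₁ t₁ ht₁
    obtain ⟨φ₂, h₂⟩ := Sector.exists_hasAngle_of_unbounded ht₂.1
    obtain ⟨η, hη⟩ := hEa h ε hε
    obtain ⟨ξ, hξ⟩ := hadm h φ₁ h₁.mem φ₂ h₂.mem η hη.mem
    have hεb := hE.subset h hε
    exact Equation.solvesAt_outerSolution he hδ (hsol.mem h ε hεb) hψ
      (Metric.ball_subset_ball hε₁le hεb) (hsol.solves h ε hεb) h₁ h₂ hη hξ (hstrip z hz)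
  · intro t₂ ht₂ z hz ε hε
    obtain ⟨φ₂, h₂⟩ := Sector.exists_hasAngle_of_unbounded ht₂.1
    obtain ⟨η, hη⟩ := hEa h ε hε
    refine Equation.tendsto_outerSolution_fst he hδ hs (hsol.mem h ε (hE.subset h hε)) h₂ hη
      (fun t ht => ?_) hβ hz
    obtain ⟨φ₁, h₁⟩ := hT₁ t ht
    obtain ⟨ξ, hξ⟩ := hadm h φ₁ h₁.mem φ₂ h₂.mem η hη.mem
    exact ⟨φ₁, ξ, h₁, hξ⟩
  · intro t₁ ht₁ z hz ε hε
    obtain ⟨φ₁, h₁⟩ := hT₁ t₁ ht₁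
    obtain ⟨η, hη⟩ := hEa h ε hε
    refine Equation.tendsto_outerSolution_snd he hδ hs (hsol.mem h ε (hE.subset h hε)) h₁ hη
      (fun t ht => ?_) hβ hz
    obtain ⟨φ₂, h₂⟩ := Sector.exists_hasAngle_of_unbounded ht
    obtain ⟨ξ, hξ⟩ := hadm h φ₁ h₁.mem φ₂ h₂.mem η hη.mem
    exact ⟨φ₂, ξ, h₂, hξ⟩
  · obtain ⟨Chat, hC, Dhat, hD, H⟩ := Equation.exists_norm_outerSolution_sub_le he hδ hs hρ
      (2 * K * Cψ) hβ hρ₂ hε₁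
    refine ⟨Chat, hC, Dhat, hD, fun h t₁ ht₁ t₂ ht₂ z hz ε hε => ?_⟩
    obtain ⟨φ₁, h₁⟩ := hT₁ t₁ ht₁
    obtain ⟨φ₂, h₂⟩ := Sector.exists_hasAngle_of_unbounded ht₂.1
    obtain ⟨η, hη⟩ := hEa h ε hε.1
    obtain ⟨η', hη'⟩ := hEa (h + 1) ε hε.2
    obtain ⟨ξ, hξ⟩ := hadm h φ₁ h₁.mem φ₂ h₂.mem η hη.mem
    obtain ⟨ξ', hξ'⟩ := hadm (h + 1) φ₁ h₁.mem φ₂ h₂.mem η' hη'.mem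
    have hεb := hE.subset h hε.1
    exact H (hsol.mem h ε hεb) (hsol.mem (h + 1) ε hεb) h₁ h₂ hη hη' hξ hξ' hz
      (mem_ball_zero_iff.1 ht₂.2).le (mem_ball_zero_iff.1 hεb).le
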